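/- Consider the following problems. * $(\min,+)$-convolution: given $a_0,\dots,a_{n-1},b_0,\dots,b_{n-1}\in\{-W,\dots,W\}$, compute $\min_{0\le i,j<n,\ i+j=k}(a_i+b_j)$ for all $0\le k\le 2n-2$. * Coin Change: given $w_1,\dots,w_n\in\{-W,\dots,W\}\cup\{\infty\}$, compute the minimum of $\sum_{i\in I}w_i$ over all multisets $I$ of elements of $\{1,\dots,n\}$ with $\sum_{i\in I}i=n$. * Unbounded Knapsack: given $p_1,\dots,p_n\in\{0,\dots,W\}$, compute the maximum of $\sum_{i\in I}p_i$ over all multisets $I$ of elements of $\{1,\dots,n\}$ with $\sum_{i\in I}i\le n$. * Bounded (0/1) Knapsack: the same as Unbounded Knapsack, with sets $I\subseteq\{1,\dots,n\}$ in place of multisets. The size of an instance is $n\ge1$ (the length of the vectors, respectively the target or budget). The model of computation is the word RAM with words of $\Theta(\log n)$ bits, and the input numbers fit into a constant number of words: a problem is solvable in time $O(n^{2-\varepsilon})$ if for every constant $c$ there is an algorithm that solves all instances with $W\le (n+2)^c$ in time $O(n^{2-\varepsilon})$. Write $A\le_2 B$ if for every $\varepsilon>0$ there is a $\delta>0$ such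 that an $O(n^{2-\varepsilon})$-time algorithm for $B$ implies an $O(n^{2-\delta})$-time algorithm for $A$, and $A\equiv_2 B$ if $A\le_2 B$ and $B\le_2 A$. A problem is solvable in strongly subquadratic time if it is solvable in time $O(n^{2-\varepsilon})$ for some $\varepsilon>0$. Theorem. $(\min,+)$-convolution, Coin Change and Unbounded Knapsack are pairwise equivalent under $\equiv_2$. Furthermore, Bounded Knapsack is not solvable in strongly subquadratic time unless $(\min,+)$-convolution is solvable in strongly subquadratic time. -/

import Mathlib

/-! ## A word RAM

A word RAM with `w`-bit words, presented as structured programs over integer registers and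
integer arrays.  A word is an integer in `[-2^(w-1), 2^(w-1))` (two's complement) and all
operations are computed modulo `2^w`.  A program is a finite text, so it uses finitely many
registers and finitely many arrays; an array is addressed by a word that may be computed at run
time (indirect addressing).  Every evaluated node of an expression and every executed
instruction or test costs one step. -/

namespace WordRAM

/-- The unit-cost operations on words. -/
inductive Op
  | add | sub | mul | div | mod
  | and | or | xor | shl | shr
  | lt | eq

/-- The value of an operation, before reduction modulo `2^w`.  Division rounds down for positive
divisors and yields `0` for the divisor `0`; `and`, `or`, `xor` act on two's complement
representations; a comparison yields `1` or `0`. -/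
def Op.apply : Op → ℤ → ℤ → ℤ
  | .add, x, y => x + y
  | .sub, x, y => x - y
  | .mul, x, y => x * y
  | .div, x, y => x / y
  | .mod, x, y => x % y
  | .and, x, y => Int.land x y
  | .or, x, y => Int.lor x y
  | .xor, x, y => Int.xor x y
  | .shl, x, y => x * 2 ^ y.toNat
  | .shr, x, y => x / 2 ^ y.toNat
  | .lt, x, y => if x < y then 1 else 0
  | .eq, x, y => if x = y then 1 else 0

/-- The integer `v` is a `w`-bit word: `-2^(w-1) ≤ v < 2^(w-1)`. -/
def IsWord (w : ℕ) (v : ℤ) : Prop := -(2 : ℤ) ^ w ≤ 2 * v ∧ 2 * v < (2 : ℤ) ^ w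

/-- Reduction modulo `2^w` to the range of `w`-bit words. -/
def wrap (w : ℕ) (v : ℤ) : ℤ := Int.bmod v (2 ^ w)

/-- A memory state: the contents of the registers, and of the cells of each array. -/
structure State where
  reg : ℕ → ℤ
  mem : ℕ → ℤ → ℤ

/-- All registers and all memory cells hold `w`-bit words. -/
def State.IsWordState (w : ℕ) (s : State) : Prop :=
  (∀ r, IsWord w (s.reg r)) ∧ ∀ arr x, IsWord w (s.mem arr x)

/-- Overwrite register `r`. -/
def State.setReg (s : State) (r : ℕ) (v : ℤ) : State :=
  { s with reg := Function.update s.reg r v }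

/-- Overwrite cell `x` of array `arr`. -/
def State.setMem (s : State) (arr : ℕ) (x v : ℤ) : State :=
  { s with mem := Function.update s.mem arr (Function.update (s.mem arr) x v) }

/-- Expressions: constants, registers, array cells, and operations. -/
inductive Expr
  | const (c : ℤ)
  | reg (r : ℕ)
  | load (arr : ℕ) (addr : Expr)
  | bin (o : Op) (e₁ e₂ : Expr)

/-- The value of an expression on a machine with `w`-bit words. -/
def Expr.eval (w : ℕ) (s : State) : Expr → ℤ
  | .const c => wrap w c
  | .reg r => s.reg r
  | .load arr addr => s.mem arr (addr.eval w s)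
  | .bin o e₁ e₂ => wrap w (o.apply (e₁.eval w s) (e₂.eval w s))

/-- The number of steps for evaluating an expression: one for each node. -/
def Expr.cost : Expr → ℕ
  | .const _ => 1
  | .reg _ => 1
  | .load _ addr => addr.cost + 1
  | .bin _ e₁ e₂ => e₁.cost + e₂.cost + 1

/-- Programs. `loop e p` repeats `p` as long as `e` is nonzero. -/
inductive Prog
  | skip
  | assign (r : ℕ) (e : Expr)
  | store (arr : ℕ) (addr e : Expr)
  | seq (p q : Prog)
  | cond (e : Expr) (p q : Prog)
  | loop (e : Expr) (p : Prog)

/-- `Exec w p s t s'`: on a machine with `w`-bit words, the program `p` started in state `s` halts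
after exactly `t` steps in state `s'`. -/
inductive Exec (w : ℕ) : Prog → State → ℕ → State → Prop
  | skip (s : State) : Exec w .skip s 1 s
  | assign (s : State) (r : ℕ) (e : Expr) :
      Exec w (.assign r e) s (e.cost + 1) (s.setReg r (e.eval w s))
  | store (s : State) (arr : ℕ) (addr e : Expr) :
      Exec w (.store arr addr e) s (addr.cost + e.cost + 1)
        (s.setMem arr (addr.eval w s) (e.eval w s))
  | seq {p q : Prog} {s s' s'' : State} {t t' : ℕ} :
      Exec w p s t s' → Exec w q s' t' s'' → Exec w (.seq p q) s (t + t') s''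
  | cond_true {e : Expr} {p q : Prog} {s s' : State} {t : ℕ} :
      e.eval w s ≠ 0 → Exec w p s t s' → Exec w (.cond e p q) s (e.cost + 1 + t) s'
  | cond_false {e : Expr} {p q : Prog} {s s' : State} {t : ℕ} :
      e.eval w s = 0 → Exec w q s t s' → Exec w (.cond e p q) s (e.cost + 1 + t) s'
  | loop_true {e : Expr} {p : Prog} {s s' s'' : State} {t t' : ℕ} :
      e.eval w s ≠ 0 → Exec w p s t s' → Exec w (.loop e p) s' t' s'' →
        Exec w (.loop e p) s (e.cost + 1 + t + t') s''
  | loop_false {e : Expr} {p : Prog} {s : State} :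
      e.eval w s = 0 → Exec w (.loop e p) s (e.cost + 1) s

end WordRAM

/-! ## Computational problems and subquadratic reductions -/

/-- A computational problem on integer data: its instances, their size, the assertion that all
numbers of an instance have absolute value at most `W`, the way in which an instance is presented
in memory, and the assertion that the memory holds a correct answer. -/
structure Problem where
  Inst : Type
  size : Inst → ℕ
  Bounded : ℕ → Inst → Prop
  Input : Inst → WordRAM.State → Prop
  Output : Inst → WordRAM.State → Prop

/-- `P.SolvableInTime f`: `P` has a word-RAM algorithm with running time `O(f n)`, where the numbers
of the input fit into a constant number of words of `Θ(log n)` bits.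

That is, for every polynomial bound on the input numbers there are a program and constants `κ`, `C`
such that, whenever the word size is at least `κ (⌊log₂ n⌋ + 1)`, the program halts on every
instance of size `n ≥ 1` within `C * f n` steps with a correct answer.  Registers and memory cells
that do not belong to the input may initially hold arbitrary words. -/
def Problem.SolvableInTime (P : Problem) (f : ℕ → ℝ) : Prop :=
  ∀ c : ℕ, ∃ (p : WordRAM.Prog) (κ : ℕ) (C : ℝ), ∀ I : P.Inst,
    1 ≤ P.size I → P.Bounded ((P.size I + 2) ^ c) I →
      ∀ w : ℕ, κ * (Nat.log 2 (P.size I) + 1) ≤ w →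
        ∀ s : WordRAM.State, s.IsWordState w → P.Input I s →
          ∃ (t : ℕ) (s' : WordRAM.State),
            WordRAM.Exec w p s t s' ∧ (t : ℝ) ≤ C * f (P.size I) ∧ P.Output I s'

/-- `A ≤₂ B`: for every `ε > 0` there is a `δ > 0` such that an `O(n^(2-ε))`-time algorithm for `B`
implies an `O(n^(2-δ))`-time algorithm for `A`. -/
def SubquadraticallyReduces (A B : Problem) : Prop :=
  ∀ ε : ℝ, 0 < ε → ∃ δ : ℝ, 0 < δ ∧
    (B.SolvableInTime (fun n => (n : ℝ) ^ (2 - ε)) →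
      A.SolvableInTime (fun n => (n : ℝ) ^ (2 - δ)))

/-- `A ≡₂ B`: subquadratic reductions both ways. -/
def SubquadraticallyEquivalent (A B : Problem) : Prop :=
  SubquadraticallyReduces A B ∧ SubquadraticallyReduces B A

/-- `P` has a strongly subquadratic algorithm, i.e. one with running time `O(n^(2-ε))` for some
`ε > 0`. -/
def StronglySubquadratic (P : Problem) : Prop :=
  ∃ ε : ℝ, 0 < ε ∧ P.SolvableInTime (fun n => (n : ℝ) ^ (2 - ε))

/-! ## The problems

In all problems, register `0` holds the size `n` of the instance. -/

/-- An instance of `(min,+)`-convolution: two vectors `(a 0, …, a (n-1))` and `(b 0, …, b (n-1))`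
of integers (the values of `a` and `b` outside this range play no role). -/
structure ConvInstance where
  n : ℕ
  a : ℕ → ℤ
  b : ℕ → ℤ

/-- `v` is the entry `k` of the `(min,+)`-convolution: the minimum of `a i + b j` over all
`0 ≤ i, j < n` with `i + j = k`. -/
def ConvInstance.IsEntry (I : ConvInstance) (k : ℕ) (v : ℤ) : Prop :=
  IsLeast {x : ℤ | ∃ i j : ℕ, i < I.n ∧ j < I.n ∧ i + j = k ∧ x = I.a i + I.b j} v

/-- `(min,+)`-convolution: the vectors are given in the arrays `0` and `1`; all entries
`0 ≤ k ≤ 2n - 2` of the convolution have to be written to array `2`. -/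
def minPlusConvolution : Problem where
  Inst := ConvInstance
  size I := I.n
  Bounded W I := ∀ i < I.n, |I.a i| ≤ (W : ℤ) ∧ |I.b i| ≤ (W : ℤ)
  Input I s := s.reg 0 = (I.n : ℤ) ∧
    ∀ i : ℕ, i < I.n → s.mem 0 (i : ℤ) = I.a i ∧ s.mem 1 (i : ℤ) = I.b i
  Output I s := ∀ k : ℕ, k + 2 ≤ 2 * I.n → I.IsEntry k (s.mem 2 (k : ℤ))

/-- An element of `ℤ ∪ {∞}` is represented by two words: a value, and a flag for `∞`. -/
def Represents (value flag : ℤ) (x : WithTop ℤ) : Prop :=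
  (flag = 0 ∧ x = (value : WithTop ℤ)) ∨ (flag = 1 ∧ value = 0 ∧ x = ⊤)

/-- An instance of Coin Change: the target `n`, and the weight `weight i ∈ ℤ ∪ {∞}` of the coin of
value `i` for `1 ≤ i ≤ n` (other values of `weight` play no role). -/
structure CoinInstance where
  n : ℕ
  weight : ℕ → WithTop ℤ

/-- `v` is the minimal total weight of a multiset of coins of total value exactly `n`. -/
def CoinInstance.IsOptimum (I : CoinInstance) (v : WithTop ℤ) : Prop :=
  IsLeast {x : WithTop ℤ | ∃ S : Multiset ℕ, (∀ i ∈ S, 1 ≤ i ∧ i ≤ I.n) ∧ S.sum = I.n ∧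
    x = (S.map I.weight).sum} v

/-- Coin Change: the weights are given in the arrays `0` (values) and `1` (flags); the minimal weight
has to be written to the registers `1` (value) and `2` (flag). -/
def coinChange : Problem where
  Inst := CoinInstance
  size I := I.n
  Bounded W I := ∀ i : ℕ, 1 ≤ i → i ≤ I.n →
    I.weight i = ⊤ ∨ ∃ z : ℤ, I.weight i = (z : WithTop ℤ) ∧ |z| ≤ (W : ℤ)
  Input I s := s.reg 0 = (I.n : ℤ) ∧
    ∀ i : ℕ, 1 ≤ i → i ≤ I.n → Represents (s.mem 0 (i : ℤ)) (s.mem 1 (i : ℤ)) (I.weight i)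
  Output I s := ∃ v : WithTop ℤ, I.IsOptimum v ∧ Represents (s.reg 1) (s.reg 2) v

/-- An instance of a knapsack problem: the budget `n`, and the profit `profit i` of the item of size
`i` for `1 ≤ i ≤ n` (other values of `profit` play no role). -/
structure KnapsackInstance where
  n : ℕ
  profit : ℕ → ℕ

/-- `v` is the maximal total profit of a multiset of items of total size at most `n`. -/
def KnapsackInstance.IsUnboundedOptimum (I : KnapsackInstance) (v : ℕ) : Prop :=
  IsGreatest {x : ℕ | ∃ S : Multiset ℕ, (∀ i ∈ S, 1 ≤ i ∧ i ≤ I.n) ∧ S.sum ≤ I.n ∧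
    x = (S.map I.profit).sum} v

/-- `v` is the maximal total profit of a set of items of total size at most `n`. -/
def KnapsackInstance.IsBoundedOptimum (I : KnapsackInstance) (v : ℕ) : Prop :=
  IsGreatest {x : ℕ | ∃ S : Finset ℕ, (∀ i ∈ S, 1 ≤ i ∧ i ≤ I.n) ∧ ∑ i ∈ S, i ≤ I.n ∧
    x = ∑ i ∈ S, I.profit i} v

/-- Unbounded Knapsack: the profits are given in array `0`; the maximal profit of a multiset of items
has to be written to register `1`. -/
def unboundedKnapsack : Problem where
  Inst := KnapsackInstance
  size I := I.n
  Bounded W I := ∀ i : ℕ, 1 ≤ i → i ≤ I.n → I.profit i ≤ W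
  Input I s := s.reg 0 = (I.n : ℤ) ∧
    ∀ i : ℕ, 1 ≤ i → i ≤ I.n → s.mem 0 (i : ℤ) = (I.profit i : ℤ)
  Output I s := ∃ v : ℕ, I.IsUnboundedOptimum v ∧ s.reg 1 = (v : ℤ)

/-- Bounded (0/1) Knapsack: the same with sets of items in place of multisets. -/
def boundedKnapsack : Problem where
  Inst := KnapsackInstance
  size I := I.n
  Bounded W I := ∀ i : ℕ, 1 ≤ i → i ≤ I.n → I.profit i ≤ W
  Input I s := s.reg 0 = (I.n : ℤ) ∧
    ∀ i : ℕ, 1 ≤ i → i ≤ I.n → s.mem 0 (i : ℤ) = (I.profit i : ℤ)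
  Output I s := ∃ v : ℕ, I.IsBoundedOptimum v ∧ s.reg 1 = (v : ℤ)

/-!
The four problems are compared by three reductions, which form a cycle through the first three
problems, and by a variant of the last of them.

*Unbounded Knapsack to Coin Change* (`unboundedKnapsack_reduces_coinChange`). Profits are
nonnegative and there is an item of size `1`, so some optimal multiset exhausts the budget; it
suffices to negate the profits.

*Coin Change to `(min,+)`-convolution* (`coinChange_reduces_minPlusConvolution`). The table of
minimal weights of multisets of at most `2 * P` coins, for all total values up to `n`, is the
convolution of the table for `P` coins with itself, as a multiset can be split in two halves
(`CoinInstance.IsMinWeight.convolution`). Every coin has value at least `1`, hence `⌈log₂ n⌉`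
squarings suffice. The weight `∞` becomes a number that is large enough to be recognized after each
convolution.

*`(min,+)`-convolution to Knapsack* (`minPlusConvolution_reduces_knapsack`). All entries of the
convolution are found by a simultaneous binary search. In a phase of the search, each entry `k` has
a threshold `c k`, and one has to decide whether `a i + b j < c (i + j)` for some pair with
`i + j = k`. The vectors are cut into about `√n` blocks of length `g ≈ √n`. For one pair of blocks,
one call of Knapsack maximizes `2 * g * (c (i + j) - a i - b j) + k`, where `k < 2 * g` is the offset
of `i + j`; so the result tells whether there is a pair below its threshold, and for which `k`. Then
the threshold `k` is marked and the same pair of blocks is searched again; otherwise the pair of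
blocks is finished. Since a threshold is marked only once, a phase makes `O(n)` calls of Knapsack
with budget `O(√n)` (`searchMeasure_le`), in time `O(n ^ (2 - ε / 2))`; the number of phases is
`O(log n)`.

The Knapsack instance (`KnapsackInstance.IsGadget`) has items of sizes near `64 * g`, `96 * g` and
`112 * g` for the entries of `a`, `b` and `c`, and the budget `272 * g`. A profit is a large multiple
of the size, so that an optimal solution has to exhaust the budget. The sizes are such that this is
possible only by one item of each kind, with matching indices. Such a solution is a set, so the
reduction works for Bounded and for Unbounded Knapsack.

Programs are verified by Hoare-style rules for total correctness with time bounds (`Run`). An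
algorithm that is used as a subroutine is a finite text, so it leaves all registers and arrays from
some number `K` on unchanged (`Prog.exists_bound`); the calling program keeps its data there.
-/

/-! ### Words -/

namespace WordRAM

theorem wrap_eq_self {w : ℕ} {B v : ℤ} (hB : 2 * B < 2 ^ w) (hv : |v| ≤ B) : wrap w v = v := by
  have h1 := abs_le.mp hv
  unfold wrap
  rw [Int.bmod_eq_iff (by positivity)]
  push_cast
  have hdiv := Int.emod_add_mul_ediv ((2 : ℤ) ^ w) 2
  have hdiv' := Int.emod_two_eq ((2 : ℤ) ^ w)
  refine ⟨by omega, ?_, by simp⟩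
  have := Int.emod_add_mul_ediv ((2 : ℤ) ^ w + 1) 2
  have := Int.emod_two_eq ((2 : ℤ) ^ w + 1)
  omega

theorem isWord_wrap {w : ℕ} (hw : 1 ≤ w) (v : ℤ) : IsWord w (wrap w v) := by
  have h1 := Int.le_bmod (x := v) (m := 2 ^ w) (by positivity)
  have h2 := Int.bmod_lt (x := v) (m := 2 ^ w) (by positivity)
  obtain ⟨k, rfl⟩ : ∃ k, w = k + 1 := ⟨w - 1, by omega⟩
  unfold IsWord wrap
  push_cast at h1 h2
  have h3 : (2 : ℤ) ^ (k + 1) = 2 * 2 ^ k := by ring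
  rw [h3] at h1 h2 ⊢
  omega

theorem wrap_add_wrap_left (w : ℕ) (x y : ℤ) : wrap w (wrap w x + y) = wrap w (x + y) :=
  Int.bmod_add_bmod

theorem wrap_add_wrap_right (w : ℕ) (x y : ℤ) : wrap w (x + wrap w y) = wrap w (x + y) :=
  Int.add_bmod_bmod

theorem wrap_sub_wrap_left (w : ℕ) (x y : ℤ) : wrap w (wrap w x - y) = wrap w (x - y) :=
  Int.bmod_sub_bmod

theorem wrap_sub_wrap_right (w : ℕ) (x y : ℤ) : wrap w (x - wrap w y) = wrap w (x - y) :=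
  Int.sub_bmod_bmod

theorem wrap_mul_wrap_left (w : ℕ) (x y : ℤ) : wrap w (wrap w x * y) = wrap w (x * y) :=
  Int.bmod_mul_bmod

theorem wrap_mul_wrap_right (w : ℕ) (x y : ℤ) : wrap w (x * wrap w y) = wrap w (x * y) :=
  Int.mul_bmod_bmod

/-! ### Expressions -/

instance : Zero Expr := ⟨.const 0⟩
instance : One Expr := ⟨.const 1⟩
instance : Add Expr := ⟨.bin .add⟩
instance : Sub Expr := ⟨.bin .sub⟩
instance : Mul Expr := ⟨.bin .mul⟩
instance : Div Expr := ⟨.bin .div⟩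
instance : Mod Expr := ⟨.bin .mod⟩

/-- The comparison `e < f` as an expression with value `1` or `0`. -/
def Expr.lt (e f : Expr) : Expr := .bin .lt e f

/-- The power `e ^ c` with a constant exponent, unfolded into `c` multiplications. -/
def Expr.npow (e : Expr) : ℕ → Expr
  | 0 => 1
  | c + 1 => e.npow c * e

section eval

variable (w : ℕ) (s : State) (e f : Expr)

theorem Expr.eval_const (c : ℤ) : (Expr.const c).eval w s = wrap w c := rfl
theorem Expr.eval_zero : (0 : Expr).eval w s = wrap w 0 := rfl
theorem Expr.eval_one : (1 : Expr).eval w s = wrap w 1 := rfl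
theorem Expr.eval_add : (e + f).eval w s = wrap w (e.eval w s + f.eval w s) := rfl
theorem Expr.eval_sub : (e - f).eval w s = wrap w (e.eval w s - f.eval w s) := rfl
theorem Expr.eval_mul : (e * f).eval w s = wrap w (e.eval w s * f.eval w s) := rfl
theorem Expr.eval_div : (e / f).eval w s = wrap w (e.eval w s / f.eval w s) := rfl
theorem Expr.eval_mod : (e % f).eval w s = wrap w (e.eval w s % f.eval w s) := rfl
theorem Expr.eval_lt : (e.lt f).eval w s =
    wrap w (if e.eval w s < f.eval w s then 1 else 0) := rfl
theorem Expr.eval_reg (r : ℕ) : (Expr.reg r).eval w s = s.reg r := rfl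
theorem Expr.eval_load (a : ℕ) : (Expr.load a e).eval w s = s.mem a (e.eval w s) := rfl

theorem Expr.eval_npow (c : ℕ) :
    (e.npow c).eval w s = wrap w (e.eval w s ^ c) := by
  induction c with
  | zero => simp [npow, eval_one]
  | succ c ih => rw [npow, eval_mul, ih, pow_succ, wrap_mul_wrap_left]

theorem Expr.eval_lt_ne_zero {w : ℕ} (hw : 2 ≤ w) (s : State) (e f : Expr) :
    (e.lt f).eval w s ≠ 0 ↔ e.eval w s < f.eval w s := by
  have : (2 : ℤ) * 1 < 2 ^ w := by
    calc (2 : ℤ) * 1 < 2 ^ 2 := by norm_num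
      _ ≤ 2 ^ w := pow_le_pow_right₀ (by norm_num) hw
  rw [eval_lt, wrap_eq_self this (by split_ifs <;> simp)]
  split_ifs with h <;> simp [h]

theorem Expr.eval_lt_eq_zero {w : ℕ} (hw : 2 ≤ w) (s : State) (e f : Expr) :
    (e.lt f).eval w s = 0 ↔ f.eval w s ≤ e.eval w s := by
  rw [← not_lt, ← eval_lt_ne_zero hw, not_not]

theorem Expr.cost_const (c : ℤ) : (Expr.const c).cost = 1 := rfl
theorem Expr.cost_zero : (0 : Expr).cost = 1 := rfl
theorem Expr.cost_one : (1 : Expr).cost = 1 := rfl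
theorem Expr.cost_add : (e + f).cost = e.cost + f.cost + 1 := rfl
theorem Expr.cost_sub : (e - f).cost = e.cost + f.cost + 1 := rfl
theorem Expr.cost_mul : (e * f).cost = e.cost + f.cost + 1 := rfl
theorem Expr.cost_mod : (e % f).cost = e.cost + f.cost + 1 := rfl
theorem Expr.cost_lt : (e.lt f).cost = e.cost + f.cost + 1 := rfl
theorem Expr.cost_reg (r : ℕ) : (Expr.reg r).cost = 1 := rfl
theorem Expr.cost_load (a : ℕ) : (Expr.load a e).cost = e.cost + 1 := rfl

theorem Expr.cost_npow (c : ℕ) : (e.npow c).cost = c * (e.cost + 1) + 1 := by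
  induction c with
  | zero => simp [npow, cost_one]
  | succ c ih =>
    rw [npow, cost_mul, ih]
    ring

theorem Expr.isWord_eval {w : ℕ} (hw : 1 ≤ w) {s : State} (hs : s.IsWordState w) (e : Expr) :
    IsWord w (e.eval w s) := by
  cases e with
  | const c => exact isWord_wrap hw _
  | reg r => exact hs.1 r
  | load a e => exact hs.2 _ _
  | bin o e f => exact isWord_wrap hw _

end eval

/-! ### What a program can change -/

/-- The program `p` contains an assignment to register `r`. -/
def Prog.WritesReg : Prog → ℕ → Prop
  | .skip, _ => False
  | .assign r _, x => x = r
  | .store _ _ _, _ => False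
  | .seq p q, x => p.WritesReg x ∨ q.WritesReg x
  | .cond _ p q, x => p.WritesReg x ∨ q.WritesReg x
  | .loop _ p, x => p.WritesReg x

/-- The program `p` contains a store instruction for the array `a`. -/
def Prog.WritesMem : Prog → ℕ → Prop
  | .skip, _ => False
  | .assign _ _, _ => False
  | .store a _ _, x => x = a
  | .seq p q, x => p.WritesMem x ∨ q.WritesMem x
  | .cond _ p q, x => p.WritesMem x ∨ q.WritesMem x
  | .loop _ p, x => p.WritesMem x

/-- The states `s` and `s'` agree on all registers and arrays that `p` does not write. -/
def Prog.Frame (p : Prog) (s s' : State) : Prop :=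
  (∀ r, ¬ p.WritesReg r → s'.reg r = s.reg r) ∧ ∀ a, ¬ p.WritesMem a → s'.mem a = s.mem a

theorem Prog.Frame.trans {p q : Prog} {s s' s'' : State} (h : p.Frame s s') (h' : q.Frame s' s'')
    {p' : Prog} (hr : ∀ r, p.WritesReg r ∨ q.WritesReg r → p'.WritesReg r)
    (hm : ∀ r, p.WritesMem r ∨ q.WritesMem r → p'.WritesMem r) : p'.Frame s s'' :=
  ⟨fun r hn => (h'.1 r fun h => hn (hr r (.inr h))).trans (h.1 r fun h => hn (hr r (.inl h))),
    fun r hn => (h'.2 r fun h => hn (hm r (.inr h))).trans (h.2 r fun h => hn (hm r (.inl h)))⟩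

theorem Prog.Frame.refl (p : Prog) (s : State) : p.Frame s s := ⟨fun _ _ => rfl, fun _ _ => rfl⟩

theorem Exec.frame {w : ℕ} {p : Prog} {s s' : State} {t : ℕ} (h : Exec w p s t s') :
    p.Frame s s' := by
  induction h with
  | skip s => exact .refl _ _
  | assign s r e =>
    exact ⟨fun x hx => Function.update_of_ne hx _ _, fun _ _ => rfl⟩
  | store s a e f =>
    exact ⟨fun _ _ => rfl, fun x hx => Function.update_of_ne hx _ _⟩
  | seq _ _ ih ih' => exact ih.trans ih' (fun _ h => h) (fun _ h => h)
  | cond_true _ _ ih => exact ih.trans (Prog.Frame.refl _ _) (fun _ h => h) (fun _ h => h)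
  | cond_false _ _ ih => exact (Prog.Frame.refl _ _).trans ih (fun _ h => h) (fun _ h => h)
  | loop_true _ _ _ ih ih' => exact ih.trans ih' (fun _ h => h.elim id id) (fun _ h => h.elim id id)
  | loop_false => exact .refl _ _

/-- All registers and arrays written by a program lie below some bound, as the program is a finite
text. -/
theorem Prog.exists_bound (p : Prog) : ∃ K, ∀ r, K ≤ r → ¬ p.WritesReg r ∧ ¬ p.WritesMem r := by
  induction p with
  | skip => exact ⟨0, fun r _ => ⟨id, id⟩⟩
  | assign x e => exact ⟨x + 1, fun r h => ⟨by simp only [WritesReg]; omega, id⟩⟩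
  | store a e f => exact ⟨a + 1, fun r h => ⟨id, by simp only [WritesMem]; omega⟩⟩
  | seq p q ihp ihq | cond _ p q ihp ihq =>
    obtain ⟨K, hK⟩ := ihp
    obtain ⟨K', hK'⟩ := ihq
    refine ⟨max K K', fun r h => ?_⟩
    have h1 := hK r (by omega)
    have h2 := hK' r (by omega)
    simp [WritesReg, WritesMem, h1, h2]
  | loop _ p ih => exact ih

theorem Exec.isWordState {w : ℕ} (hw : 1 ≤ w) {p : Prog} {s s' : State} {t : ℕ}
    (h : Exec w p s t s') (hs : s.IsWordState w) : s'.IsWordState w := by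
  induction h with
  | skip s => exact hs
  | assign s r e =>
    refine ⟨fun x => ?_, hs.2⟩
    by_cases hx : x = r
    · subst hx
      simpa [State.setReg] using e.isWord_eval hw hs
    · simpa [State.setReg, hx] using hs.1 x
  | store s a e f =>
    refine ⟨hs.1, fun x y => ?_⟩
    by_cases hx : x = a
    · subst hx
      by_cases hy : y = e.eval w s
      · subst hy
        simpa [State.setMem] using f.isWord_eval hw hs
      · simpa [State.setMem, hy] using hs.2 x y
    · simpa [State.setMem, hx] using hs.2 x y
  | seq _ _ ih ih' => exact ih' (ih hs)
  | cond_true _ _ ih => exact ih hs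
  | cond_false _ _ ih => exact ih hs
  | loop_true _ _ _ ih ih' => exact ih' (ih hs)
  | loop_false => exact hs

/-! ### Total correctness with time bounds -/

/-- Started in `s`, the program `p` halts within `T` steps in a state that satisfies `Q`. -/
def Run (w : ℕ) (p : Prog) (s : State) (T : ℕ) (Q : State → Prop) : Prop :=
  ∃ t s', Exec w p s t s' ∧ t ≤ T ∧ Q s'

variable {w : ℕ} {p q : Prog} {s : State} {T T' : ℕ} {Q Q' : State → Prop}

theorem Run.mono (h : Run w p s T Q) (hT : T ≤ T') (hQ : ∀ s', p.Frame s s' → Q s' → Q' s') :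
    Run w p s T' Q' := by
  obtain ⟨t, s', he, ht, hs⟩ := h
  exact ⟨t, s', he, ht.trans hT, hQ s' he.frame hs⟩

theorem Run.isWordState (h : Run w p s T Q) (hw : 1 ≤ w) (hs : s.IsWordState w) :
    Run w p s T (fun s' => s'.IsWordState w ∧ Q s') := by
  obtain ⟨t, s', he, ht, hs'⟩ := h
  exact ⟨t, s', he, ht, he.isWordState hw hs, hs'⟩

theorem Run.seq (h : Run w p s T Q)
    (h' : ∀ s', p.Frame s s' → Q s' → Run w q s' T' Q') : Run w (.seq p q) s (T + T') Q' := by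
  obtain ⟨t, s', he, ht, hs⟩ := h
  obtain ⟨t', s'', he', ht', hs'⟩ := h' s' he.frame hs
  exact ⟨_, s'', .seq he he', by omega, hs'⟩

theorem Run.assign {r : ℕ} {e : Expr} (h : Q (s.setReg r (e.eval w s))) :
    Run w (.assign r e) s (e.cost + 1) Q := ⟨_, _, .assign s r e, le_rfl, h⟩

theorem Run.store {a : ℕ} {e f : Expr} (h : Q (s.setMem a (e.eval w s) (f.eval w s))) :
    Run w (.store a e f) s (e.cost + f.cost + 1) Q := ⟨_, _, .store s a e f, le_rfl, h⟩

theorem Run.cond {e : Expr} (h : e.eval w s ≠ 0 → Run w p s T Q)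
    (h' : e.eval w s = 0 → Run w q s T Q) : Run w (.cond e p q) s (e.cost + 1 + T) Q := by
  by_cases he : e.eval w s = 0
  · obtain ⟨t, s', hx, ht, hs⟩ := h' he
    exact ⟨_, s', .cond_false he hx, by omega, hs⟩
  · obtain ⟨t, s', hx, ht, hs⟩ := h he
    exact ⟨_, s', .cond_true he hx, by omega, hs⟩

/-- A loop whose body takes at most `T` steps and decreases the measure `m` of the invariant `J`. -/
theorem Run.loop {e : Expr} (J : ℕ → State → Prop)
    (hJ : ∀ m s, J m s → e.eval w s ≠ 0 → Run w p s T (fun s' => ∃ m' < m, J m' s'))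
    (m : ℕ) (s : State) (hs : J m s) :
    Run w (.loop e p) s (m * (e.cost + 1 + T) + (e.cost + 1))
      (fun s' => e.eval w s' = 0 ∧ ∃ m', J m' s') := by
  induction m using Nat.strong_induction_on generalizing s with
  | _ m ih =>
    by_cases he : e.eval w s = 0
    · exact ⟨_, s, .loop_false he, by omega, he, m, hs⟩
    · obtain ⟨t, s', hx, ht, m', hm, hs'⟩ := hJ m s hs he
      obtain ⟨t', s'', hx', ht', hs''⟩ := ih m' hm s' hs'
      refine ⟨_, s'', .loop_true he hx hx', ?_, hs''⟩
      have : (m' + 1) * (e.cost + 1 + T) ≤ m * (e.cost + 1 + T) := Nat.mul_le_mul_right _ hm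
      rw [Nat.add_mul] at this
      omega

/-- Store the values of `ev` at the addresses `ea` of array `a`, for all values of register `i` from
`0` up to `lim - 1`. -/
def Prog.fill (i a : ℕ) (lim ea ev : Expr) : Prog :=
  .seq (.assign i 0) (.loop ((Expr.reg i).lt lim)
    (.seq (.store a ea ev) (.assign i (.reg i + 1))))

/-- The outcome of `Prog.fill`, where `f k` and `v k` are the values of `ea` and `ev` when register `i`
holds `k`. These expressions may depend on cells of the array `a` that have not yet been
overwritten. -/
theorem Run.fill {i a : ℕ} {lim ea ev : Expr} (cnt : ℕ) (f v : ℕ → ℤ) (hw : 2 ≤ w)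
    (hcnt : 2 * (cnt : ℤ) < 2 ^ w) (hf : ∀ j k, j < k → k < cnt → f j ≠ f k)
    (h : ∀ k s', k ≤ cnt → s'.reg i = (k : ℤ) → (∀ r, r ≠ i → s'.reg r = s.reg r) →
      (∀ b, b ≠ a → s'.mem b = s.mem b) →
      (∀ x, (∀ j < k, x ≠ f j) → s'.mem a x = s.mem a x) →
      lim.eval w s' = cnt ∧ (k < cnt → ea.eval w s' = f k ∧ ev.eval w s' = v k)) :
    Run w (.fill i a lim ea ev) s ((lim.cost + ea.cost + ev.cost + 12) * (cnt + 1))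
      (fun s' => (∀ k < cnt, s'.mem a (f k) = v k) ∧
        ∀ x, (∀ j < cnt, x ≠ f j) → s'.mem a x = s.mem a x) := by
  let J : ℕ → State → Prop := fun m s' => ∃ k, k + m = cnt ∧ s'.reg i = k ∧
    (∀ r, r ≠ i → s'.reg r = s.reg r) ∧ (∀ b, b ≠ a → s'.mem b = s.mem b) ∧
    (∀ j < k, s'.mem a (f j) = v j) ∧ ∀ x, (∀ j < k, x ≠ f j) → s'.mem a x = s.mem a x
  have h0 : wrap w 0 = 0 := wrap_eq_self (B := cnt) hcnt (by simp)
  have key := Run.loop (w := w) (e := (Expr.reg i).lt lim)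
    (p := .seq (.store a ea ev) (.assign i (.reg i + 1))) (T := ea.cost + ev.cost + 1 + 4) J
    (by
      rintro m s' ⟨k, hkm, hi, hr, hb, hv, hx⟩ hne
      obtain ⟨hl, hev⟩ := h k s' (by omega) hi hr hb hx
      rw [Expr.eval_lt_ne_zero hw, hl, Expr.eval_reg, hi] at hne
      have hk : k < cnt := by exact_mod_cast hne
      obtain ⟨hea, hev⟩ := hev hk
      refine Run.seq (Run.store (Q := fun t => t = s'.setMem a (f k) (v k)) (by rw [hea, hev])) ?_
      rintro _ - rfl
      refine Run.assign (e := .reg i + 1) ?_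
      have h1 : (Expr.reg i + 1).eval w (s'.setMem a (f k) (v k)) = (k + 1 : ℕ) := by
        rw [Expr.eval_add, Expr.eval_reg, Expr.eval_one, wrap_add_wrap_right]
        simp only [State.setMem, hi]
        push_cast
        exact wrap_eq_self hcnt (by rw [abs_of_nonneg (by positivity)]; omega)
      rw [h1]
      refine ⟨m - 1, by omega, k + 1, by omega, by simp [State.setReg], ?_, ?_, ?_, ?_⟩
      · intro r hne
        simp [State.setReg, State.setMem, hne, hr r hne]
      · intro b hne
        simp [State.setReg, State.setMem, hne, hb b hne]
      · intro j hj
        rcases Nat.lt_succ_iff_lt_or_eq.mp hj with hj | rfl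
        · simp [State.setReg, State.setMem, hf j k hj hk, hv j hj]
        · simp [State.setReg, State.setMem]
      · intro x hx'
        simp only [State.setReg, State.setMem, Function.update_self]
        rw [Function.update_of_ne (hx' k (by omega))]
        exact hx x fun j hj => hx' j (by omega))
    cnt (s.setReg i 0)
    ⟨0, by omega, by simp [State.setReg], fun r hr => by simp [State.setReg, hr],
      fun _ _ => rfl, by simp, fun _ _ => rfl⟩
  refine (Run.seq (T' := cnt * (lim.cost + ea.cost + ev.cost + 8) + (lim.cost + 3))
    (Run.assign (Q := fun t => t = s.setReg i 0) (by rw [Expr.eval_zero, h0])) ?_).mono ?_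
    fun _ _ h => h
  · rintro _ - rfl
    refine key.mono ?_ ?_
    · simp only [Expr.cost_lt, Expr.cost_reg]
      apply le_of_eq
      ring
    · rintro s' - ⟨he, m, k, hkm, hi, hr, hb, hv, hx⟩
      obtain ⟨hl, -⟩ := h k s' (by omega) hi hr hb hx
      rw [Expr.eval_lt_eq_zero hw, hl, Expr.eval_reg, hi] at he
      obtain rfl : k = cnt := by omega
      exact ⟨hv, hx⟩
  · rw [Expr.cost_zero]
    nlinarith

end WordRAM

/-! ### Word sizes and running times -/

open WordRAM

theorem exists_wordSize (A d : ℕ) : ∃ κ : ℕ, ∀ n : ℕ, 1 ≤ n → ∀ w, κ * (Nat.log 2 n + 1) ≤ w →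
    2 * ((A : ℤ) * ((n : ℤ) + 2) ^ d) < 2 ^ w ∧ 2 ≤ w := by
  refine ⟨A + 2 * d + 2, fun n hn w hw => ?_⟩
  have h1 : n + 1 ≤ 2 ^ (Nat.log 2 n + 1) := Nat.lt_pow_succ_log_self (by norm_num) n
  have h2 : (n + 1) ^ (A + 2 * d + 2) ≤ 2 ^ w := by
    calc (n + 1) ^ (A + 2 * d + 2) ≤ (2 ^ (Nat.log 2 n + 1)) ^ (A + 2 * d + 2) :=
          Nat.pow_le_pow_left h1 _
      _ = 2 ^ ((A + 2 * d + 2) * (Nat.log 2 n + 1)) := by rw [← pow_mul, mul_comm]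
      _ ≤ 2 ^ w := Nat.pow_le_pow_right (by norm_num) hw
  have h3 : 2 * (A * (n + 2) ^ d) < (n + 1) ^ (A + 2 * d + 2) := by
    calc 2 * (A * (n + 2) ^ d) ≤ 2 * (A * ((n + 1) ^ 2) ^ d) := by
          gcongr
          nlinarith
      _ < 2 * (2 ^ A * ((n + 1) ^ 2) ^ d) := by
          have := @Nat.lt_two_pow_self A
          gcongr
      _ ≤ (n + 1) * ((n + 1) ^ A * ((n + 1) ^ 2) ^ d) := by gcongr <;> omega
      _ = (n + 1) ^ (A + 2 * d + 1) := by
          rw [← pow_mul]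
          ring
      _ ≤ (n + 1) ^ (A + 2 * d + 2) := Nat.pow_le_pow_right (by omega) (by omega)
  refine ⟨by exact_mod_cast h3.trans_le h2, ?_⟩
  calc 2 ≤ (A + 2 * d + 2) * 1 := by omega
    _ ≤ (A + 2 * d + 2) * (Nat.log 2 n + 1) := by gcongr; omega
    _ ≤ w := hw

theorem log_add_one_le_of_le_mul {A m n : ℕ} (h : m ≤ A * n) :
    Nat.log 2 m + 1 ≤ (A + 1) * (Nat.log 2 n + 1) := by
  have h1 : Nat.log 2 m < A + (Nat.log 2 n + 1) := by
    apply Nat.log_lt_of_lt_pow' (by omega)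
    calc m ≤ A * n := h
      _ < 2 ^ A * 2 ^ (Nat.log 2 n + 1) :=
        Nat.mul_lt_mul_of_lt_of_le Nat.lt_two_pow_self
          (Nat.lt_pow_succ_log_self (by norm_num) n).le (by positivity)
      _ = _ := (pow_add _ _ _).symm
  nlinarith

theorem exists_log_le_rpow {η : ℝ} (hη : 0 < η) :
    ∃ C : ℝ, 0 ≤ C ∧ ∀ n : ℕ, 1 ≤ n → ((Nat.log 2 n + 1 : ℕ) : ℝ) ≤ C * (n : ℝ) ^ η := by
  have h2 : 0 < Real.log 2 := Real.log_pos (by norm_num)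
  refine ⟨1 / η / Real.log 2 + 1, by positivity, fun n hn => ?_⟩
  have hn' : (1 : ℝ) ≤ n := by exact_mod_cast hn
  have h3 : (1 : ℝ) ≤ (n : ℝ) ^ η := Real.one_le_rpow hn' hη.le
  have h4 := Real.log_le_rpow_div (x := n) (by positivity) hη
  have h5 : (Nat.log 2 n : ℝ) ≤ Real.log n / Real.log 2 := by
    have := Real.natLog_le_logb n 2
    simpa [Real.logb] using this
  push_cast
  calc (Nat.log 2 n : ℝ) + 1 ≤ ((n : ℝ) ^ η / η) / Real.log 2 + (n : ℝ) ^ η := by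
        gcongr
        exact h5.trans (by gcongr)
    _ = _ := by ring

/-- A linear bound survives powers with exponents up to `2`, with the square of the constant. -/
theorem rpow_le_of_le_mul {x y A b : ℝ} (hx : 0 ≤ x) (hy : 0 ≤ y) (hA : 1 ≤ A) (hb : 0 ≤ b)
    (hb2 : b ≤ 2) (h : x ≤ A * y) : x ^ b ≤ A ^ 2 * y ^ b := by
  calc x ^ b ≤ (A * y) ^ b := Real.rpow_le_rpow hx h hb
    _ = A ^ b * y ^ b := Real.mul_rpow (by linarith) hy
    _ ≤ A ^ (2 : ℝ) * y ^ b := by gcongr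
    _ = _ := by norm_num

/-- The time bound of the reduction from Unbounded Knapsack to Coin Change. -/
theorem time_bound_linear {ε C : ℝ} (hε1 : ε ≤ 1) (A : ℕ) :
    ∃ C' : ℝ, ∀ n : ℕ, 1 ≤ n →
      ((A * (n + 1) + ⌊C * (n : ℝ) ^ (2 - ε)⌋₊ : ℕ) : ℝ) ≤ C' * (n : ℝ) ^ (2 - ε) := by
  refine ⟨2 * A + |C|, fun n hn => ?_⟩
  have hn' : (1 : ℝ) ≤ n := by exact_mod_cast hn
  have h1 : (n : ℝ) ≤ (n : ℝ) ^ (2 - ε) := by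
    conv_lhs => rw [← Real.rpow_one (n : ℝ)]
    exact Real.rpow_le_rpow_of_exponent_le hn' (by linarith)
  have h2 : ((⌊C * (n : ℝ) ^ (2 - ε)⌋₊ : ℕ) : ℝ) ≤ |C| * (n : ℝ) ^ (2 - ε) := by
    refine (Nat.cast_le.mpr (Nat.floor_mono
      (mul_le_mul_of_nonneg_right (le_abs_self C) (by positivity)))).trans
      (Nat.floor_le (by positivity))
  push_cast
  nlinarith [(Nat.cast_nonneg A : (0 : ℝ) ≤ A)]

/-- The time bound of the reduction from Coin Change to `(min,+)`-convolution. -/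
theorem time_bound_squaring {ε C : ℝ} (hε : 0 < ε) (hε1 : ε ≤ 1) (A : ℕ) :
    ∃ C' : ℝ, ∀ n : ℕ, 1 ≤ n →
      ((A * (Nat.log 2 n + 1) * (⌊C * ((n + 1 : ℕ) : ℝ) ^ (2 - ε)⌋₊ + (n + 1)) : ℕ) : ℝ) ≤
        C' * (n : ℝ) ^ (2 - ε / 2) := by
  obtain ⟨Cl, hCl, hlog⟩ := exists_log_le_rpow (half_pos hε)
  refine ⟨A * Cl * (4 * |C| + 2), fun n hn => ?_⟩
  have hn' : (1 : ℝ) ≤ n := by exact_mod_cast hn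
  have h1 : (n : ℝ) ≤ (n : ℝ) ^ (2 - ε) := by
    conv_lhs => rw [← Real.rpow_one (n : ℝ)]
    exact Real.rpow_le_rpow_of_exponent_le hn' (by linarith)
  have h2 : ((⌊C * ((n + 1 : ℕ) : ℝ) ^ (2 - ε)⌋₊ : ℕ) : ℝ) ≤ 4 * |C| * (n : ℝ) ^ (2 - ε) := by
    calc ((⌊C * ((n + 1 : ℕ) : ℝ) ^ (2 - ε)⌋₊ : ℕ) : ℝ)
        ≤ (⌊|C| * ((n + 1 : ℕ) : ℝ) ^ (2 - ε)⌋₊ : ℕ) := Nat.cast_le.mpr (Nat.floor_mono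
          (mul_le_mul_of_nonneg_right (le_abs_self C) (by positivity)))
      _ ≤ |C| * ((n + 1 : ℕ) : ℝ) ^ (2 - ε) := Nat.floor_le (by positivity)
      _ ≤ |C| * (2 ^ 2 * (n : ℝ) ^ (2 - ε)) := by
          gcongr
          exact rpow_le_of_le_mul (by positivity) (by positivity) (by norm_num) (by linarith)
            (by linarith) (by push_cast; linarith)
      _ = _ := by ring
  have h3 : (n : ℝ) ^ (2 - ε / 2) = (n : ℝ) ^ (ε / 2) * (n : ℝ) ^ (2 - ε) := by
    rw [← Real.rpow_add (by linarith)]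
    ring_nf
  rw [h3, Nat.cast_mul, Nat.cast_mul]
  calc (A : ℝ) * ((Nat.log 2 n + 1 : ℕ) : ℝ) * _
      ≤ A * (Cl * (n : ℝ) ^ (ε / 2)) * ((4 * |C| + 2) * (n : ℝ) ^ (2 - ε)) := by
        gcongr
        · exact hlog n hn
        · push_cast at h2 ⊢
          nlinarith
    _ = _ := by ring

/-- The time bound of the reduction from `(min,+)`-convolution to Knapsack, with blocks of length
`g ≈ √n`. -/
theorem time_bound_blocks {ε C : ℝ} (hε : 0 < ε) (hε1 : ε ≤ 1) (A B : ℕ) :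
    ∃ C' : ℝ, ∀ n g : ℕ, 1 ≤ n → g ^ 2 ≤ 4 * n →
      ((A * (Nat.log 2 n + 1) * (n * (⌊C * ((B * g : ℕ) : ℝ) ^ (2 - ε)⌋₊ + (g + 1))) : ℕ) : ℝ) ≤
        C' * (n : ℝ) ^ (2 - ε / 4) := by
  obtain ⟨Cl, hCl, hlog⟩ := exists_log_le_rpow (show 0 < ε / 4 by linarith)
  refine ⟨A * Cl * (|C| * (2 * (B + 1)) ^ 2 + 3), fun n g hn hg => ?_⟩
  have hn' : (1 : ℝ) ≤ n := by exact_mod_cast hn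
  have hs : Real.sqrt n ^ 2 = n := Real.sq_sqrt (by linarith)
  have hs0 : 1 ≤ Real.sqrt n := Real.one_le_sqrt.mpr hn'
  have hg' : (g : ℝ) ≤ 2 * Real.sqrt n := by
    have : (g : ℝ) ^ 2 ≤ 4 * n := by exact_mod_cast hg
    exact le_of_sq_le_sq (by nlinarith) (by positivity)
  have hpow : (Real.sqrt n) ^ (2 - ε) = (n : ℝ) ^ (1 - ε / 2) := by
    rw [Real.sqrt_eq_rpow, ← Real.rpow_mul (by linarith)]
    ring_nf
  have h1 : Real.sqrt n ≤ (n : ℝ) ^ (1 - ε / 2) := by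
    rw [← hpow]
    conv_lhs => rw [← Real.rpow_one (Real.sqrt n)]
    exact Real.rpow_le_rpow_of_exponent_le hs0 (by linarith)
  have h2 : ((⌊C * ((B * g : ℕ) : ℝ) ^ (2 - ε)⌋₊ : ℕ) : ℝ) ≤
      |C| * (2 * (B + 1)) ^ 2 * (n : ℝ) ^ (1 - ε / 2) := by
    calc ((⌊C * ((B * g : ℕ) : ℝ) ^ (2 - ε)⌋₊ : ℕ) : ℝ)
        ≤ (⌊|C| * ((B * g : ℕ) : ℝ) ^ (2 - ε)⌋₊ : ℕ) := Nat.cast_le.mpr (Nat.floor_mono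
          (mul_le_mul_of_nonneg_right (le_abs_self C) (by positivity)))
      _ ≤ |C| * ((B * g : ℕ) : ℝ) ^ (2 - ε) := Nat.floor_le (by positivity)
      _ ≤ |C| * ((2 * (B + 1)) ^ 2 * (Real.sqrt n) ^ (2 - ε)) := by
          gcongr
          refine rpow_le_of_le_mul (by positivity) (by positivity) ?_ (by linarith)
            (by linarith) ?_
          · nlinarith [(Nat.cast_nonneg B : (0 : ℝ) ≤ B)]
          · push_cast
            nlinarith [(Nat.cast_nonneg B : (0 : ℝ) ≤ B)]
      _ = _ := by
          rw [hpow]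
          ring
  have h3 : (n : ℝ) ^ (2 - ε / 4) = (n : ℝ) ^ (ε / 4) * (n * (n : ℝ) ^ (1 - ε / 2)) := by
    conv_rhs => rw [← Real.rpow_one_add' (by linarith) (by linarith)]
    rw [← Real.rpow_add (by linarith)]
    ring_nf
  rw [h3, Nat.cast_mul, Nat.cast_mul, Nat.cast_mul]
  calc (A : ℝ) * ((Nat.log 2 n + 1 : ℕ) : ℝ) * (n * _)
      ≤ A * (Cl * (n : ℝ) ^ (ε / 4)) *
          (n * ((|C| * (2 * (B + 1)) ^ 2 + 3) * (n : ℝ) ^ (1 - ε / 2))) := by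
        gcongr
        · exact hlog n hn
        · push_cast at h2 ⊢
          nlinarith
    _ = _ := by ring

/-! ### Subquadratic reductions -/

theorem Problem.SolvableInTime.mono {P : Problem} {ε ε' : ℝ} (h : ε' ≤ ε)
    (hP : P.SolvableInTime fun n => (n : ℝ) ^ (2 - ε)) :
    P.SolvableInTime fun n => (n : ℝ) ^ (2 - ε') := by
  intro c
  obtain ⟨p, κ, C, hp⟩ := hP c
  refine ⟨p, κ, |C|, fun I hI hb w hw s hs hin => ?_⟩
  obtain ⟨t, s', he, ht, ho⟩ := hp I hI hb w hw s hs hin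
  refine ⟨t, s', he, ht.trans ?_, ho⟩
  have : (1 : ℝ) ≤ P.size I := by exact_mod_cast hI
  calc C * (P.size I : ℝ) ^ (2 - ε) ≤ |C| * (P.size I : ℝ) ^ (2 - ε) := by
        gcongr
        exact le_abs_self C
    _ ≤ _ := mul_le_mul_of_nonneg_left (Real.rpow_le_rpow_of_exponent_le this (by linarith))
        (abs_nonneg C)

/-- It suffices to reduce to running times `O(n ^ (2 - ε))` with `ε ≤ 1`. -/
theorem SubquadraticallyReduces.of_le_one {A B : Problem}
    (h : ∀ ε : ℝ, 0 < ε → ε ≤ 1 → ∃ δ : ℝ, 0 < δ ∧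
      (B.SolvableInTime (fun n => (n : ℝ) ^ (2 - ε)) →
        A.SolvableInTime (fun n => (n : ℝ) ^ (2 - δ)))) : SubquadraticallyReduces A B := by
  intro ε hε
  obtain ⟨δ, hδ, h'⟩ := h (min ε 1) (by positivity) (min_le_right _ _)
  exact ⟨δ, hδ, fun hB => h' (hB.mono (min_le_left _ _))⟩

theorem SubquadraticallyReduces.trans {A B C : Problem} (h : SubquadraticallyReduces A B)
    (h' : SubquadraticallyReduces B C) : SubquadraticallyReduces A C := by
  intro ε hε
  obtain ⟨δ, hδ, h1⟩ := h' ε hε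
  obtain ⟨δ', hδ', h2⟩ := h δ hδ
  exact ⟨δ', hδ', h2 ∘ h1⟩

theorem StronglySubquadratic.of_reduces {A B : Problem} (h : SubquadraticallyReduces A B)
    (hB : StronglySubquadratic B) : StronglySubquadratic A := by
  obtain ⟨ε, hε, hB⟩ := hB
  obtain ⟨δ, hδ, h'⟩ := h ε hε
  exact ⟨δ, hδ, h' hB⟩

/-- A fast algorithm, as a subroutine: beyond its running time, the calling program needs a bound
`K` such that the registers and arrays from `K` on are not touched. -/
theorem Problem.SolvableInTime.exists_subroutine {P : Problem} {ε : ℝ}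
    (h : P.SolvableInTime fun n => (n : ℝ) ^ (2 - ε)) (c : ℕ) :
    ∃ (p : Prog) (κ : ℕ) (C : ℝ) (K : ℕ), 3 ≤ K ∧
      (∀ r, K ≤ r → ¬ p.WritesReg r ∧ ¬ p.WritesMem r) ∧
      ∀ I : P.Inst, 1 ≤ P.size I → P.Bounded ((P.size I + 2) ^ c) I →
        ∀ w : ℕ, κ * (Nat.log 2 (P.size I) + 1) ≤ w → ∀ s : State, s.IsWordState w → P.Input I s →
          Run w p s ⌊C * (P.size I : ℝ) ^ (2 - ε)⌋₊ (P.Output I) := by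
  obtain ⟨p, κ, C, hp⟩ := h c
  obtain ⟨K, hK⟩ := p.exists_bound
  refine ⟨p, κ, C, max K 3, le_max_right _ _, fun r hr => hK r (le_of_max_le_left hr),
    fun I hI hb w hw s hs hin => ?_⟩
  obtain ⟨t, s', he, ht, ho⟩ := hp I hI hb w hw s hs hin
  exact ⟨t, s', he, Nat.le_floor ht, ho⟩

theorem Problem.solvableInTime_of_run {P : Problem} {f : ℕ → ℝ}
    (h : ∀ c : ℕ, ∃ (p : Prog) (κ : ℕ) (C : ℝ), ∀ I : P.Inst, 1 ≤ P.size I →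
      P.Bounded ((P.size I + 2) ^ c) I → ∀ w : ℕ, κ * (Nat.log 2 (P.size I) + 1) ≤ w →
        ∀ s : State, s.IsWordState w → P.Input I s →
          ∃ T : ℕ, (T : ℝ) ≤ C * f (P.size I) ∧ Run w p s T (P.Output I)) :
    P.SolvableInTime f := by
  intro c
  obtain ⟨p, κ, C, hp⟩ := h c
  refine ⟨p, κ, C, fun I hI hb w hw s hs hin => ?_⟩
  obtain ⟨T, hT, t, s', he, ht, ho⟩ := hp I hI hb w hw s hs hin
  exact ⟨t, s', he, (Nat.cast_le.mpr ht).trans hT, ho⟩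

/-! ### Unbounded Knapsack reduces to Coin Change -/

theorem Multiset.card_le_sum {S : Multiset ℕ} (h : ∀ i ∈ S, 1 ≤ i) : S.card ≤ S.sum := by
  simpa using Multiset.card_nsmul_le_sum (s := S) (a := 1) h

/-- Negated profits: as profits are nonnegative and there is an item of size `1`, some optimal
multiset of items exhausts the budget. -/
def KnapsackInstance.toCoin (I : KnapsackInstance) : CoinInstance where
  n := I.n
  weight i := ((-(I.profit i : ℤ) : ℤ) : WithTop ℤ)

theorem KnapsackInstance.sum_toCoin_weight (I : KnapsackInstance) (S : Multiset ℕ) :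
    (S.map I.toCoin.weight).sum = ((-((S.map I.profit).sum : ℤ) : ℤ) : WithTop ℤ) := by
  induction S using Multiset.induction with
  | empty => simp
  | cons i S ih =>
    rw [Multiset.map_cons, Multiset.sum_cons, ih, toCoin, ← WithTop.coe_add, Multiset.map_cons,
      Multiset.sum_cons]
    exact congrArg _ (by push_cast; ring)

theorem KnapsackInstance.IsUnboundedOptimum.of_toCoin {I : KnapsackInstance} {v : WithTop ℤ}
    (hI : 1 ≤ I.n) (h : I.toCoin.IsOptimum v) :
    ∃ z : ℕ, v = ((-(z : ℤ) : ℤ) : WithTop ℤ) ∧ I.IsUnboundedOptimum z := by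
  obtain ⟨⟨S, hS, hsum, hv⟩, hmin⟩ := h
  rw [sum_toCoin_weight] at hv
  refine ⟨(S.map I.profit).sum, hv, ⟨S, hS, hsum.le, rfl⟩, ?_⟩
  rintro _ ⟨S', hS', hsum', rfl⟩
  have h1 := hmin ⟨S' + Multiset.replicate (I.n - S'.sum) 1, ?_, ?_, rfl⟩
  · rw [hv, sum_toCoin_weight, WithTop.coe_le_coe] at h1
    simp only [Multiset.map_add, Multiset.sum_add] at h1
    omega
  · intro i hi
    rcases Multiset.mem_add.mp hi with hi | hi
    · exact hS' i hi
    · rw [Multiset.eq_of_mem_replicate hi]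
      exact ⟨le_rfl, hI⟩
  · simp only [Multiset.sum_add, Multiset.sum_replicate, smul_eq_mul, mul_one]
    change _ = I.n
    omega

theorem KnapsackInstance.IsUnboundedOptimum.le {I : KnapsackInstance} {z W : ℕ}
    (h : I.IsUnboundedOptimum z) (hW : ∀ i : ℕ, 1 ≤ i → i ≤ I.n → I.profit i ≤ W) :
    z ≤ I.n * W := by
  obtain ⟨⟨S, hS, hsum, rfl⟩, -⟩ := h
  calc (S.map I.profit).sum ≤ (S.map I.profit).card • W := by
        apply Multiset.sum_le_card_nsmul
        intro x hx
        obtain ⟨i, hi, rfl⟩ := Multiset.mem_map.mp hx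
        exact hW i (hS i hi).1 (hS i hi).2
    _ = S.card * W := by rw [Multiset.card_map, smul_eq_mul]
    _ ≤ I.n * W := Nat.mul_le_mul_right _
        ((Multiset.card_le_sum fun i hi => (hS i hi).1).trans hsum)

theorem Represents.exists_eq {x y : ℤ} {z : ℤ} (h : Represents x y (z : WithTop ℤ)) :
    y = 0 ∧ x = z := by
  rcases h with ⟨h, h'⟩ | ⟨-, -, h⟩
  · exact ⟨h, (WithTop.coe_injective h').symm⟩
  · exact absurd h (WithTop.coe_ne_top)

/-- Negate the profits, call `p` for Coin Change, and negate the result. -/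
def knapsackViaCoin (p : Prog) (K : ℕ) : Prog :=
  .seq (.fill K 0 (.reg 0) (.reg K + 1) (0 - .load 0 (.reg K + 1)))
    (.seq (.fill K 1 (.reg 0) (.reg K + 1) 0) (.seq p (.assign 1 (0 - .reg 1))))

theorem unboundedKnapsack_reduces_coinChange :
    SubquadraticallyReduces unboundedKnapsack coinChange := by
  refine .of_le_one fun ε hε hε1 => ⟨ε, hε, fun hB => Problem.solvableInTime_of_run fun c => ?_⟩
  obtain ⟨p, κ, C, K, hK3, hK, hp⟩ := hB.exists_subroutine c
  obtain ⟨κ', hκ'⟩ := exists_wordSize 1 (c + 1)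
  obtain ⟨C', hC'⟩ := time_bound_linear (C := C) hε1 60
  refine ⟨knapsackViaCoin p K, κ + κ', C', fun (I : KnapsackInstance) hI hb w hw s hs hin => ?_⟩
  change 1 ≤ I.n at hI
  change (κ + κ') * (Nat.log 2 I.n + 1) ≤ w at hw
  change ∀ i : ℕ, 1 ≤ i → i ≤ I.n → I.profit i ≤ (I.n + 2) ^ c at hb
  obtain ⟨hn, hin⟩ := hin
  obtain ⟨hB, hw2⟩ := hκ' I.n hI w (le_trans (by gcongr; omega) hw)
  set B : ℤ := (1 : ℕ) * ((I.n : ℤ) + 2) ^ (c + 1) with hBdef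
  have hnB : (I.n : ℤ) + 2 ≤ B := by
    rw [hBdef, Nat.cast_one, one_mul]
    exact le_self_pow₀ (by omega) (by omega)
  have hpB : ∀ z : ℕ, z ≤ (I.n + 2) * (I.n + 2) ^ c → |(z : ℤ)| ≤ B := by
    intro z hz
    rw [Nat.abs_cast, hBdef, Nat.cast_one, one_mul, pow_succ']
    exact_mod_cast hz
  have hpB' : ∀ i : ℕ, 1 ≤ i → i ≤ I.n → |(I.profit i : ℤ)| ≤ B := fun i h1 h2 =>
    hpB _ ((hb i h1 h2).trans (Nat.le_mul_of_pos_left _ (by omega)))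
  have hB0 : 0 ≤ B := by omega
  have hcnt : 2 * (I.n : ℤ) < 2 ^ w := by linarith
  have haddr : ∀ (k : ℕ) (s' : State), k < I.n → s'.reg K = k →
      (Expr.reg K + 1).eval w s' = ((k + 1 : ℕ) : ℤ) := by
    intro k s' hk hs'
    rw [Expr.eval_add, Expr.eval_one, wrap_add_wrap_right, Expr.eval_reg, hs']
    push_cast
    exact wrap_eq_self hB (by rw [abs_of_nonneg (by positivity)]; omega)
  refine ⟨_, hC' I.n hI, ?_⟩
  refine Run.mono (T := 25 * (I.n + 1) + (25 * (I.n + 1) +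
    (⌊C * (I.n : ℝ) ^ (2 - ε)⌋₊ + 4))) (Q := unboundedKnapsack.Output I) ?_ (by omega)
    fun _ _ h => h
  refine Run.seq (Run.isWordState (Run.mono (Run.fill (s := s) I.n (fun k => ((k + 1 : ℕ) : ℤ))
    (fun k => -(I.profit (k + 1) : ℤ)) hw2 hcnt (fun j k h _ => by simpa using h.ne) ?_)
    (T' := 25 * (I.n + 1)) ?_ fun _ _ h => h) (by omega) hs) ?_
  · intro k s' hk hi hr hb' hx
    refine ⟨?_, fun hk => ⟨haddr k s' hk hi, ?_⟩⟩
    · rw [Expr.eval_reg, hr 0 (by omega), hn]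
    · rw [Expr.eval_sub, Expr.eval_load, haddr k s' hk hi, Expr.eval_zero, wrap_sub_wrap_left,
        hx _ (fun j hj => by simpa using hj.ne'), hin (k + 1) (by omega) (by omega), zero_sub]
      exact wrap_eq_self hB (by rw [abs_neg]; exact hpB' _ (by omega) (by omega))
  · simp only [Expr.cost_add, Expr.cost_sub, Expr.cost_reg, Expr.cost_load, Expr.cost_one,
      Expr.cost_zero]
    omega
  rintro s₁ ⟨hf₁, -⟩ ⟨hs₁, h₁, -⟩
  have hn₁ : s₁.reg 0 = I.n := by
    rw [hf₁ 0 (by simp [Prog.fill, Prog.WritesReg]; omega), hn]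
  refine Run.seq (Run.isWordState (Run.mono (Run.fill (s := s₁) I.n (fun k => ((k + 1 : ℕ) : ℤ))
    (fun k => 0) hw2 hcnt (fun j k h _ => by simpa using h.ne) ?_)
    (T' := 25 * (I.n + 1)) ?_ fun _ _ h => h) (by omega) hs₁) ?_
  · intro k s' hk hi hr hb' hx
    refine ⟨?_, fun hk => ⟨haddr k s' hk hi, ?_⟩⟩
    · rw [Expr.eval_reg, hr 0 (by omega), hn₁]
    · rw [Expr.eval_zero]
      exact wrap_eq_self hB (by rwa [abs_zero])
  · simp only [Expr.cost_add, Expr.cost_reg, Expr.cost_one, Expr.cost_zero]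
    omega
  rintro s₂ hf₂ ⟨hs₂, h₂, -⟩
  refine Run.seq (hp I.toCoin hI ?_ w (le_trans ?_ hw) s₂ hs₂ ⟨?_, ?_⟩) ?_
  · intro i h1 h2
    refine .inr ⟨_, rfl, ?_⟩
    rw [abs_neg, Nat.abs_cast]
    exact_mod_cast hb i h1 h2
  · change _ * (Nat.log 2 I.n + 1) ≤ _
    gcongr
    omega
  · rw [hf₂.1 0 (by simp [Prog.fill, Prog.WritesReg]; omega), hn₁]
    rfl
  · intro i h1 h2
    obtain ⟨k, rfl⟩ : ∃ k, i = k + 1 := ⟨i - 1, by omega⟩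
    refine .inl ⟨h₂ k h2, ?_⟩
    rw [hf₂.2 0 (by simp [Prog.fill, Prog.WritesMem]), h₁ k h2]
    rfl
  · rintro s₃ - ⟨v, hv, hrep⟩
    refine Run.assign (e := 0 - .reg 1) ?_
    obtain ⟨z, rfl, hz⟩ := KnapsackInstance.IsUnboundedOptimum.of_toCoin hI hv
    refine ⟨z, hz, ?_⟩
    obtain ⟨-, hr⟩ := hrep.exists_eq
    simp only [State.setReg, Function.update_self]
    rw [Expr.eval_sub, Expr.eval_reg, hr, Expr.eval_zero, wrap_sub_wrap_left]
    simp only [zero_sub, neg_neg]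
    exact wrap_eq_self hB (hpB z ((hz.le hb).trans (by gcongr; omega)))

/-! ### Repeated squaring for Coin Change -/

/-- The finite weights of multisets of at most `P` coins of total value `j`. -/
def CoinInstance.weights (I : CoinInstance) (P j : ℕ) : Set ℤ :=
  {z | ∃ S : Multiset ℕ, (∀ i ∈ S, 1 ≤ i ∧ i ≤ I.n) ∧ S.sum = j ∧ S.card ≤ P ∧
    (S.map I.weight).sum = (z : WithTop ℤ)}

/-- `v` is the minimal weight of a multiset of at most `P` coins of total value `j`, where `∞` is
encoded by `3 * X`. -/
def CoinInstance.IsMinWeight (I : CoinInstance) (X : ℤ) (P j : ℕ) (v : ℤ) : Prop :=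
  IsLeast (I.weights P j) v ∨ (I.weights P j = ∅ ∧ v = 3 * X)

namespace CoinInstance

variable {I : CoinInstance} {X : ℤ} {P j k : ℕ} {v : ℤ}

theorem add_mem_weights {x y : ℤ} (hx : x ∈ I.weights P j) (hy : y ∈ I.weights P k) :
    x + y ∈ I.weights (P + P) (j + k) := by
  obtain ⟨S, hS, rfl, hc, hx⟩ := hx
  obtain ⟨S', hS', rfl, hc', hy⟩ := hy
  refine ⟨S + S', fun i hi => (Multiset.mem_add.mp hi).elim (hS i) (hS' i), Multiset.sum_add _ _,
    by rw [Multiset.card_add]; omega, ?_⟩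
  rw [Multiset.map_add, Multiset.sum_add, hx, hy, WithTop.coe_add]

theorem exists_of_mem_weights {z : ℤ} (hz : z ∈ I.weights (P + P) k) :
    ∃ i j x y, i + j = k ∧ x ∈ I.weights P i ∧ y ∈ I.weights P j ∧ x + y = z := by
  obtain ⟨S, hS, rfl, hc, hz⟩ := hz
  obtain ⟨A, B, rfl, hA, hB⟩ : ∃ A B : Multiset ℕ, A + B = S ∧ A.card ≤ P ∧ B.card ≤ P := by
    induction S using Quotient.inductionOn with
    | _ l =>
      refine ⟨(l.take P : List ℕ), (l.drop P : List ℕ), ?_, ?_, ?_⟩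
      · rw [Multiset.coe_add, List.take_append_drop]
        rfl
      · simp
      · simp only [Multiset.quot_mk_to_coe, Multiset.coe_card, List.length_drop] at hc ⊢
        omega
  rw [Multiset.map_add, Multiset.sum_add] at hz
  obtain ⟨x, y, hx, hy, hxy⟩ := WithTop.add_eq_coe.mp hz
  exact ⟨A.sum, B.sum, x, y, (Multiset.sum_add A B).symm,
    ⟨A, fun i hi => hS i (Multiset.mem_add.mpr (.inl hi)), rfl, hA, hx.symm⟩,
    ⟨B, fun i hi => hS i (Multiset.mem_add.mpr (.inr hi)), rfl, hB, hy.symm⟩, hxy⟩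

theorem abs_le_of_mem_weights {W : ℕ} (hW : coinChange.Bounded W I) {z : ℤ}
    (hz : z ∈ I.weights P j) : |z| ≤ j * W := by
  obtain ⟨S, hS, rfl, -, hz⟩ := hz
  suffices |z| ≤ S.card * W by
    have h := Multiset.card_le_sum fun i hi => (hS i hi).1
    refine this.trans ?_
    gcongr
  clear * - hS hz hW
  induction S using Multiset.induction generalizing z with
  | empty =>
    have : z = 0 := (WithTop.coe_injective (by simpa using hz)).symm
    simp [this]
  | cons i S ih =>
    rw [Multiset.map_cons, Multiset.sum_cons] at hz
    obtain ⟨x, y, hx, hy, rfl⟩ := WithTop.add_eq_coe.mp hz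
    have h1 := ih (fun i hi => hS i (Multiset.mem_cons_of_mem hi)) hy.symm
    have h2 : |x| ≤ W := by
      have hi := hS i (Multiset.mem_cons_self i S)
      rcases hW i hi.1 hi.2 with h | ⟨x', h, h'⟩
      · rw [h] at hx
        exact absurd hx WithTop.coe_ne_top
      · rw [h] at hx
        rwa [WithTop.coe_injective hx]
    rw [Multiset.card_cons]
    push_cast
    linarith [abs_add_le x y]

theorem IsMinWeight.abs_le {W n : ℕ} (hW : coinChange.Bounded W I) (hX : (n : ℤ) * W ≤ X)
    (hj : j ≤ n) (h : I.IsMinWeight X P j v) :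
    (v ∈ I.weights P j ∧ |v| ≤ X) ∨ v = 3 * X := by
  refine h.imp (fun h => ⟨h.1, (abs_le_of_mem_weights hW h.1).trans (le_trans ?_ hX)⟩) And.right
  gcongr

theorem isMinWeight_zero : I.IsMinWeight X 1 0 0 := by
  have : ∀ z, z ∈ I.weights 1 0 ↔ z = 0 := by
    intro z
    constructor
    · rintro ⟨S, hS, hsum, -, hz⟩
      obtain rfl : S = 0 := by
        apply Multiset.card_eq_zero.mp
        have := Multiset.card_le_sum fun i hi => (hS i hi).1
        omega
      exact (WithTop.coe_injective (by simpa using hz)).symm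
    · rintro rfl
      exact ⟨0, by simp, by simp, by simp, by simp⟩
  exact .inl ⟨(this 0).mpr rfl, fun z hz => ((this z).mp hz).ge⟩

theorem isMinWeight_one (h1 : 1 ≤ j) (hj : j ≤ I.n) {x y : ℤ} (h : Represents x y (I.weight j)) :
    I.IsMinWeight X 1 j (x + y * (3 * X)) := by
  have : ∀ z, z ∈ I.weights 1 j ↔ I.weight j = (z : WithTop ℤ) := by
    intro z
    constructor
    · rintro ⟨S, hS, hsum, hc, hz⟩
      have hc' : S.card ≠ 0 := by
        rintro h0
        rw [Multiset.card_eq_zero.mp h0] at hsum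
        simp at hsum
        omega
      obtain ⟨a, rfl⟩ := Multiset.card_eq_one.mp (show S.card = 1 by omega)
      simp at hsum hz
      rw [← hsum, hz]
    · intro h
      refine ⟨{j}, ?_, by simp, by simp, by simpa using h⟩
      intro i hi
      rw [Multiset.mem_singleton.mp hi]
      exact ⟨h1, hj⟩
  rcases h with ⟨rfl, h⟩ | ⟨rfl, rfl, h⟩
  · left
    simp only [zero_mul, add_zero]
    exact ⟨(this x).mpr h, fun z hz => (WithTop.coe_injective (h.symm.trans ((this z).mp hz))).le⟩
  · right
    refine ⟨?_, by ring⟩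
    ext z
    rw [this, h]
    simp

/-- One squaring: the `(min,+)`-convolution of the table with itself, with all entries above `X`
replaced by the encoding of `∞`, is the table for twice as many coins. -/
theorem IsMinWeight.convolution {W n : ℕ} {T : ℕ → ℤ} (hW : coinChange.Bounded W I)
    (hX : (n : ℤ) * W ≤ X) (hX0 : 0 < X) (hT : ∀ j ≤ n, I.IsMinWeight X P j (T j)) (hk : k ≤ n)
    (hv : ConvInstance.IsEntry ⟨n + 1, T, T⟩ k v) :
    I.IsMinWeight X (P + P) k (v + (if X < v then 1 else 0) * (3 * X - v)) := by
  obtain ⟨⟨i, j, hi, hj, hij, rfl⟩, hmin⟩ := hv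
  change i < n + 1 at hi
  change j < n + 1 at hj
  change i + j = k at hij
  have hlow : ∀ z ∈ I.weights (P + P) k, T i + T j ≤ z ∧ z ≤ X := by
    intro z hz
    refine ⟨?_, ?_⟩
    · obtain ⟨i', j', x, y, hij', hx, hy, rfl⟩ := exists_of_mem_weights hz
      refine (hmin ⟨i', j', show i' < n + 1 by omega, show j' < n + 1 by omega, hij', rfl⟩).trans ?_
      have h1 : T i' ≤ x := by
        rcases hT i' (by omega) with h | ⟨h, -⟩
        · exact h.2 hx
        · rw [h] at hx
          exact hx.elim
      have h2 : T j' ≤ y := by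
        rcases hT j' (by omega) with h | ⟨h, -⟩
        · exact h.2 hy
        · rw [h] at hy
          exact hy.elim
      exact add_le_add h1 h2
    · refine (le_abs_self z).trans ((abs_le_of_mem_weights hW hz).trans (le_trans ?_ hX))
      gcongr
  by_cases h : X < T i + T j
  · right
    refine ⟨Set.eq_empty_of_forall_notMem fun z hz => ?_, by simp [h]⟩
    have := hlow z hz
    linarith
  · left
    simp only [h, if_false, zero_mul, add_zero]
    refine ⟨?_, fun z hz => (hlow z hz).1⟩
    have h1 := (hT i (by omega)).abs_le hW hX (by omega)
    have h2 := (hT j (by omega)).abs_le hW hX (by omega)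
    simp only [_root_.abs_le] at h1 h2
    rw [← hij]
    refine add_mem_weights ?_ ?_
    · rcases h1 with h1 | h1
      · exact h1.1
      · rcases h2 with h2 | h2 <;> linarith
    · rcases h2 with h2 | h2
      · exact h2.1
      · rcases h1 with h1 | h1 <;> linarith

theorem IsMinWeight.isOptimum {W : ℕ} (hW : coinChange.Bounded W I) (hX : (I.n : ℤ) * W ≤ X)
    (hX0 : 0 < X) (hn : 1 ≤ I.n) (hP : I.n ≤ P) (hv : I.IsMinWeight X P I.n v) :
    I.IsOptimum (if X < v then ⊤ else (v : WithTop ℤ)) := by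
  have hmem : ∀ S : Multiset ℕ, (∀ i ∈ S, 1 ≤ i ∧ i ≤ I.n) → S.sum = I.n → ∀ z : ℤ,
      (S.map I.weight).sum = (z : WithTop ℤ) → z ∈ I.weights P I.n := fun S hS hsum z hz =>
    ⟨S, hS, hsum, ((Multiset.card_le_sum fun i hi => (hS i hi).1).trans hsum.le).trans hP, hz⟩
  rcases hv with h | ⟨h, rfl⟩
  · have := (le_abs_self v).trans ((abs_le_of_mem_weights hW h.1).trans hX)
    rw [if_neg (by linarith)]
    refine ⟨?_, ?_⟩
    · obtain ⟨S, hS, hsum, -, hz⟩ := h.1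
      exact ⟨S, hS, hsum, hz.symm⟩
    · rintro x ⟨S, hS, hsum, rfl⟩
      cases hx : (S.map I.weight).sum with
      | top => exact le_top
      | coe z => exact WithTop.coe_le_coe.mpr (h.2 (hmem S hS hsum z hx))
  · rw [if_pos (by linarith)]
    have htop : ∀ S : Multiset ℕ, (∀ i ∈ S, 1 ≤ i ∧ i ≤ I.n) → S.sum = I.n →
        (S.map I.weight).sum = ⊤ := by
      intro S hS hsum
      cases hx : (S.map I.weight).sum with
      | top => rfl
      | coe z =>
        have := hmem S hS hsum z hx
        rw [h] at this
        exact this.elim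
    refine ⟨⟨{I.n}, ?_, by simp, (htop _ ?_ (by simp)).symm⟩, ?_⟩
    · simpa using hn
    · simpa using hn
    · rintro x ⟨S, hS, hsum, rfl⟩
      exact (htop S hS hsum).ge

end CoinInstance

/-! ### Coin Change reduces to `(min,+)`-convolution -/

/-- One squaring of the table in array `K`, by the algorithm `p` for `(min,+)`-convolution.
Register `K` holds `n`, register `K + 1` the bound `X`, and register `K + 2` the number `P` of coins
that the table accounts for. -/
def squaringStep (p : Prog) (K : ℕ) : Prog :=
  .seq (.assign 0 (.reg K + 1))
    (.seq (.fill (K + 3) 0 (.reg 0) (.reg (K + 3)) (.load K (.reg (K + 3))))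
    (.seq (.fill (K + 3) 1 (.reg 0) (.reg (K + 3)) (.load K (.reg (K + 3))))
    (.seq p
    (.seq (.fill (K + 3) K (.reg K + 1) (.reg (K + 3))
      (.load 2 (.reg (K + 3)) + (Expr.reg (K + 1)).lt (.load 2 (.reg (K + 3))) *
        (.const 3 * .reg (K + 1) - .load 2 (.reg (K + 3)))))
    (.assign (K + 2) (.reg (K + 2) + .reg (K + 2)))))))

/-- The whole algorithm: the table for at most one coin is squared until it accounts for `n` coins;
then the entry `n` is the result. -/
def coinViaConvolution (p : Prog) (K c : ℕ) : Prog :=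
  .seq (.assign K (.reg 0))
    (.seq (.assign (K + 1) ((Expr.reg 0 + .const 2).npow (c + 1)))
    (.seq (.fill (K + 3) K (.reg K) (.reg (K + 3) + 1)
      (.load 0 (.reg (K + 3) + 1) + .load 1 (.reg (K + 3) + 1) * (.const 3 * .reg (K + 1))))
    (.seq (.store K 0 0)
    (.seq (.assign (K + 2) 1)
    (.seq (.loop ((Expr.reg (K + 2)).lt (.reg K)) (squaringStep p K))
    (.seq (.assign 1 (.load K (.reg K)))
    (.cond ((Expr.reg (K + 1)).lt (.reg 1))
      (.seq (.assign 1 0) (.assign 2 1)) (.assign 2 0))))))))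

/-- The state of the algorithm between two squarings. -/
structure CoinInstance.Tabulated (I : CoinInstance) (X : ℤ) (K P : ℕ) (s : State) : Prop where
  reg_n : s.reg K = I.n
  reg_X : s.reg (K + 1) = X
  reg_P : s.reg (K + 2) = P
  table : ∀ j ≤ I.n, I.IsMinWeight X P j (s.mem K j)

theorem CoinInstance.Tabulated.run_squaringStep {I : CoinInstance} {X : ℤ} {K P W w TB : ℕ}
    {p : Prog} {s : State} (hK3 : 3 ≤ K) (hK : ∀ r, K ≤ r → ¬ p.WritesReg r ∧ ¬ p.WritesMem r)
    (hW : coinChange.Bounded W I) (hX : (I.n : ℤ) * W ≤ X) (hnX : (I.n : ℤ) + 2 ≤ X) (hw : 2 ≤ w)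
    (hB : 2 * (3 * X) < 2 ^ w)
    (hp : ∀ T : ℕ → ℤ, (∀ j ≤ I.n, |T j| ≤ 3 * X) → ∀ s : State, s.IsWordState w →
      minPlusConvolution.Input ⟨I.n + 1, T, T⟩ s →
      Run w p s TB (minPlusConvolution.Output ⟨I.n + 1, T, T⟩))
    (hs : s.IsWordState w) (h : I.Tabulated X K P s) (hP : P < I.n) :
    Run w (squaringStep p K) s (TB + 100 * (I.n + 2))
      (fun s' => s'.IsWordState w ∧ I.Tabulated X K (P + P) s') := by
  have hX0 : 0 < X := by omega
  have hcnt : 2 * ((I.n + 1 : ℕ) : ℤ) < 2 ^ w := by push_cast; omega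
  have hT : ∀ j ≤ I.n, |s.mem K j| ≤ 3 * X := by
    intro j hj
    rcases (h.table j hj).abs_le hW hX hj with ⟨-, h⟩ | h
    · omega
    · rw [h, abs_of_pos (by omega)]
  have hlen : (Expr.reg K + 1).eval w s = ((I.n + 1 : ℕ) : ℤ) := by
    rw [Expr.eval_add, Expr.eval_one, wrap_add_wrap_right, Expr.eval_reg, h.reg_n]
    push_cast
    exact wrap_eq_self hB (by rw [abs_of_nonneg (by positivity)]; omega)
  refine Run.isWordState ?_ (by omega) hs
  refine Run.mono (T := 4 + (20 * (I.n + 2) + (20 * (I.n + 2) + (TB + (45 * (I.n + 2) + 4)))))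
    (Q := I.Tabulated X K (P + P)) ?_ (by omega) fun _ _ h => h
  refine Run.seq (T := 4) (Run.isWordState (Run.assign (e := .reg K + 1)
    (Q := fun t => t.reg 0 = ((I.n + 1 : ℕ) : ℤ)) (by simp [State.setReg, hlen]))
    (by omega) hs) ?_
  rintro s₁ hf₁ ⟨hs₁, h₁⟩
  have hm₁ : s₁.mem K = s.mem K := hf₁.2 K (by simp [Prog.WritesMem])
  refine Run.seq (Run.isWordState (Run.mono (Run.fill (s := s₁) (I.n + 1) (fun k => (k : ℤ))
    (fun k => s.mem K k) hw hcnt (fun j k h _ => by simpa using h.ne) ?_)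
    (T' := 20 * (I.n + 2)) ?_ fun _ _ h => h) (by omega) hs₁) ?_
  · intro k s' hk hi hr hb hx
    rw [Expr.eval_reg, Expr.eval_reg, Expr.eval_load, Expr.eval_reg, hr 0 (by omega), h₁, hi,
      hb K (by omega), hm₁]
    exact ⟨rfl, fun _ => ⟨rfl, rfl⟩⟩
  · simp only [Expr.cost_reg, Expr.cost_load]
    omega
  rintro s₂ hf₂ ⟨hs₂, h₂, -⟩
  have hm₂ : s₂.mem K = s.mem K := by
    rw [hf₂.2 K (by simp [Prog.fill, Prog.WritesMem]; omega), hm₁]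
  have hr₂ : s₂.reg 0 = ((I.n + 1 : ℕ) : ℤ) := by
    rw [hf₂.1 0 (by simp [Prog.fill, Prog.WritesReg]), h₁]
  refine Run.seq (Run.isWordState (Run.mono (Run.fill (s := s₂) (I.n + 1) (fun k => (k : ℤ))
    (fun k => s.mem K k) hw hcnt (fun j k h _ => by simpa using h.ne) ?_)
    (T' := 20 * (I.n + 2)) ?_ fun _ _ h => h) (by omega) hs₂) ?_
  · intro k s' hk hi hr hb hx
    rw [Expr.eval_reg, Expr.eval_reg, Expr.eval_load, Expr.eval_reg, hr 0 (by omega), hr₂, hi,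
      hb K (by omega), hm₂]
    exact ⟨rfl, fun _ => ⟨rfl, rfl⟩⟩
  · simp only [Expr.cost_reg, Expr.cost_load]
    omega
  rintro s₃ hf₃ ⟨hs₃, h₃, -⟩
  refine Run.seq (Run.isWordState (hp (fun k => s.mem K k) hT s₃ hs₃ ⟨?_, fun i hi => ⟨?_, ?_⟩⟩)
    (by omega) hs₃) ?_
  · rw [hf₃.1 0 (by simp [Prog.fill, Prog.WritesReg]), hr₂]
  · rw [hf₃.2 0 (by simp [Prog.fill, Prog.WritesMem])]
    exact h₂ i hi
  · exact h₃ i hi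
  rintro s₄ hf₄ ⟨hs₄, h₄⟩
  have hreg : ∀ j, j ≤ 2 → s₄.reg (K + j) = s.reg (K + j) := by
    intro j hj
    rw [hf₄.1 _ (hK _ (by omega)).1, hf₃.1 _ (by simp [Prog.fill, Prog.WritesReg]; omega),
      hf₂.1 _ (by simp [Prog.fill, Prog.WritesReg]; omega),
      hf₁.1 _ (by simp [Prog.WritesReg]; omega)]
  refine Run.seq (Run.isWordState (Run.mono (Run.fill (s := s₄) (I.n + 1) (fun k => (k : ℤ))
    (fun k => s₄.mem 2 k + (if X < s₄.mem 2 k then 1 else 0) * (3 * X - s₄.mem 2 k)) hw hcnt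
    (fun j k h _ => by simpa using h.ne) ?_)
    (T' := 45 * (I.n + 2)) ?_ fun _ _ h => h) (by omega) hs₄) ?_
  · intro k s' hk hi hr hb hx
    have hKn : s'.reg K = I.n := by rw [hr K (by omega), ← h.reg_n]; exact hreg 0 (by omega)
    have hKX : s'.reg (K + 1) = X := by rw [hr _ (by omega), hreg 1 (by omega), h.reg_X]
    refine ⟨?_, fun hk => ⟨by rw [Expr.eval_reg, hi], ?_⟩⟩
    · rw [Expr.eval_add, Expr.eval_one, wrap_add_wrap_right, Expr.eval_reg, hKn]
      push_cast
      exact wrap_eq_self hB (by rw [abs_of_nonneg (by positivity)]; omega)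
    · simp only [Expr.eval_add, Expr.eval_mul, Expr.eval_sub, Expr.eval_lt, Expr.eval_load,
        Expr.eval_reg, Expr.eval_const, wrap_add_wrap_right, wrap_sub_wrap_left,
        wrap_mul_wrap_left, wrap_mul_wrap_right, hi, hKX, hb 2 (by omega)]
      refine wrap_eq_self hB ?_
      have := CoinInstance.IsMinWeight.convolution hW hX hX0 h.table (show k ≤ I.n by omega)
        (h₄ k (by change k + 2 ≤ 2 * (I.n + 1); omega))
      rcases this.abs_le hW hX (by omega) with ⟨-, h⟩ | h
      · exact h.trans (by omega)
      · rw [h, abs_of_pos (by omega)]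
  · simp only [Expr.cost_reg, Expr.cost_load, Expr.cost_add, Expr.cost_mul, Expr.cost_sub,
      Expr.cost_lt, Expr.cost_const, Expr.cost_one]
    omega
  rintro s₅ hf₅ ⟨hs₅, h₅, -⟩
  have hreg' : ∀ j, j ≤ 2 → s₅.reg (K + j) = s.reg (K + j) := by
    intro j hj
    rw [hf₅.1 _ (by simp [Prog.fill, Prog.WritesReg]; omega), hreg j hj]
  refine Run.assign (e := .reg (K + 2) + .reg (K + 2)) ?_
  have hPP : (Expr.reg (K + 2) + Expr.reg (K + 2)).eval w s₅ = ((P + P : ℕ) : ℤ) := by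
    rw [Expr.eval_add, Expr.eval_reg, hreg' 2 (by omega), h.reg_P]
    push_cast
    exact wrap_eq_self hB (by rw [abs_of_nonneg (by positivity)]; omega)
  rw [hPP]
  refine ⟨?_, ?_, by simp [State.setReg], fun j hj => ?_⟩
  · simpa [State.setReg, h.reg_n] using hreg' 0 (by omega)
  · simpa [State.setReg, h.reg_X] using hreg' 1 (by omega)
  · simp only [State.setReg]
    rw [h₅ j (by omega)]
    exact CoinInstance.IsMinWeight.convolution hW hX hX0 h.table hj
        (h₄ j (by change j + 2 ≤ 2 * (I.n + 1); omega))

theorem coinChange_reduces_minPlusConvolution :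
    SubquadraticallyReduces coinChange minPlusConvolution := by
  refine .of_le_one fun ε hε hε1 => ⟨ε / 2, half_pos hε, fun hB =>
    Problem.solvableInTime_of_run fun c => ?_⟩
  -- The entries of the table are at most `3 * (n + 2) ^ (c + 1)`, and vectors have length `n + 1`.
  obtain ⟨p, κ, C, K, hK3, hK, hp⟩ := hB.exists_subroutine (c + 3)
  obtain ⟨κ', hκ'⟩ := exists_wordSize 3 (c + 1)
  obtain ⟨C', hC'⟩ := time_bound_squaring (C := C) hε hε1 (260 + 5 * c)
  refine ⟨coinViaConvolution p K c, 3 * κ + κ', C', fun (I : CoinInstance) hI hb w hw s hs hin => ?_⟩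
  change 1 ≤ I.n at hI
  change (3 * κ + κ') * (Nat.log 2 I.n + 1) ≤ w at hw
  change coinChange.Bounded ((I.n + 2) ^ c) I at hb
  obtain ⟨hn, hin⟩ := hin
  obtain ⟨hB, hw2⟩ := hκ' I.n hI w (le_trans (by gcongr; omega) hw)
  obtain ⟨X, hXdef⟩ : ∃ X : ℤ, X = ((I.n : ℤ) + 2) ^ (c + 1) := ⟨_, rfl⟩
  rw [← hXdef] at hB
  push_cast at hB
  have hnX : (I.n : ℤ) + 2 ≤ X := by
    rw [hXdef]
    exact le_self_pow₀ (by omega) (by omega)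
  have hX : (I.n : ℤ) * ((I.n + 2) ^ c : ℕ) ≤ X := by
    rw [hXdef, pow_succ']
    push_cast
    gcongr
    omega
  have hX0 : 0 < X := by omega
  have hcnt : 2 * (I.n : ℤ) < 2 ^ w := by omega
  set TB := ⌊C * ((I.n + 1 : ℕ) : ℝ) ^ (2 - ε)⌋₊ with hTB
  have hp' : ∀ T : ℕ → ℤ, (∀ j ≤ I.n, |T j| ≤ 3 * X) → ∀ s : State, s.IsWordState w →
      minPlusConvolution.Input ⟨I.n + 1, T, T⟩ s →
      Run w p s TB (minPlusConvolution.Output ⟨I.n + 1, T, T⟩) := by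
    intro T hT s hs hin
    refine hp ⟨I.n + 1, T, T⟩ (show 1 ≤ I.n + 1 by omega) ?_ w (le_trans ?_ hw) s hs hin
    · have : 3 * X ≤ ((I.n + 1 + 2) ^ (c + 3) : ℕ) := by
        rw [hXdef]
        push_cast
        calc (3 : ℤ) * (I.n + 2) ^ (c + 1) ≤ (I.n + 1 + 2) ^ 2 * (I.n + 1 + 2) ^ (c + 1) := by
              gcongr
              · nlinarith
              · omega
          _ = _ := by ring
      intro i hi
      change i < I.n + 1 at hi
      exact ⟨(hT i (by omega)).trans this, (hT i (by omega)).trans this⟩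
    · change κ * (Nat.log 2 (I.n + 1) + 1) ≤ _
      calc κ * (Nat.log 2 (I.n + 1) + 1) ≤ κ * ((2 + 1) * (Nat.log 2 I.n + 1)) := by
            gcongr
            exact log_add_one_le_of_le_mul (by omega)
        _ ≤ _ := by
            rw [← mul_assoc]
            gcongr
            omega
  refine ⟨_, hC' I.n hI, ?_⟩
  refine Run.mono (T := 2 + (((c + 1) * 4 + 2) + (40 * (I.n + 1) + (3 + (2 +
    ((Nat.clog 2 I.n * (4 + (TB + 100 * (I.n + 2))) + 4) + (3 + (4 + 4))))))))
    (Q := coinChange.Output I) ?_ ?_ fun _ _ h => h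
  swap
  · have hc : Nat.clog 2 I.n ≤ Nat.log 2 I.n + 1 := by
      rw [Nat.clog_le_iff_le_pow (by norm_num)]
      exact (Nat.lt_pow_succ_log_self (by norm_num) _).le
    have hL : 1 ≤ Nat.log 2 I.n + 1 := by omega
    generalize Nat.log 2 I.n + 1 = L at hc hL ⊢
    have h1 := Nat.mul_le_mul hc (show 4 + (TB + 100 * (I.n + 2)) ≤ 160 * (TB + (I.n + 1)) by omega)
    have h2 : 28 + 4 * c + 40 * (I.n + 1) ≤ (100 + 5 * c) * (TB + (I.n + 1)) := by nlinarith
    have h3 := Nat.mul_le_mul hL h2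
    rw [← hTB]
    linarith
  refine Run.seq (T := 2) (Run.isWordState (Run.assign (e := .reg 0)
    (Q := fun t => t = s.setReg K I.n) (by rw [Expr.eval_reg, hn])) (by omega) hs) ?_
  rintro _ - ⟨hs₁, rfl⟩
  refine Run.seq (Run.mono (Run.isWordState (Run.assign (e := (Expr.reg 0 + .const 2).npow (c + 1))
    (Q := fun t => t = (s.setReg K I.n).setReg (K + 1) X) ?_) (by omega) hs₁)
    (T' := (c + 1) * 4 + 2) ?_ fun _ _ h => h) ?_
  · have : (Expr.reg 0 + .const 2).eval w (s.setReg K I.n) = (I.n : ℤ) + 2 := by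
      rw [Expr.eval_add, Expr.eval_reg, Expr.eval_const, wrap_add_wrap_right]
      simp only [State.setReg, Function.update_of_ne (show 0 ≠ K by omega), hn]
      exact wrap_eq_self hB (by rw [abs_of_nonneg (by positivity)]; omega)
    rw [Expr.eval_npow, this, ← hXdef, wrap_eq_self hB (by rw [abs_of_pos hX0]; omega)]
  · rw [Expr.cost_npow]
    simp only [Expr.cost_add, Expr.cost_reg, Expr.cost_const]
    omega
  rintro s₂ - ⟨hs₂, rfl⟩
  obtain ⟨s₂, hs₂def⟩ : ∃ s₂, s₂ = (s.setReg K I.n).setReg (K + 1) X := ⟨_, rfl⟩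
  have hn₂ : s₂.reg K = I.n := by simp [hs₂def, State.setReg]
  have hX₂ : s₂.reg (K + 1) = X := by simp [hs₂def, State.setReg]
  have hm₂ : s₂.mem = s.mem := by simp [hs₂def, State.setReg]
  rw [← hs₂def] at hs₂ ⊢
  refine Run.seq (Run.isWordState (Run.mono (Run.fill (s := s₂) I.n (fun k => ((k + 1 : ℕ) : ℤ))
    (fun k => s.mem 0 (k + 1 : ℕ) + s.mem 1 (k + 1 : ℕ) * (3 * X)) hw2 hcnt
    (fun j k h _ => by simpa using h.ne) ?_)
    (T' := 40 * (I.n + 1)) ?_ fun _ _ h => h) (by omega) hs₂) ?_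
  · intro k s' hk hi hr hb' hx
    refine ⟨by rw [Expr.eval_reg, hr K (by omega), hn₂], fun hk => ?_⟩
    have haddr : (Expr.reg (K + 3) + 1).eval w s' = ((k + 1 : ℕ) : ℤ) := by
      rw [Expr.eval_add, Expr.eval_one, wrap_add_wrap_right, Expr.eval_reg, hi]
      push_cast
      exact wrap_eq_self hB (by rw [abs_of_nonneg (by positivity)]; omega)
    refine ⟨haddr, ?_⟩
    simp only [Expr.eval_add w s' (.load _ _), Expr.eval_mul, Expr.eval_load, haddr, Expr.eval_reg,
      Expr.eval_const, wrap_add_wrap_right, wrap_mul_wrap_left, wrap_mul_wrap_right,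
      hb' 0 (by omega), hb' 1 (by omega), hm₂, hr (K + 1) (by omega), hX₂]
    refine wrap_eq_self hB ?_
    rcases (CoinInstance.isMinWeight_one (X := X) (by omega) (by omega)
      (hin (k + 1) (by omega) (by omega))).abs_le hb hX (by omega) with ⟨-, h⟩ | h
    · exact h.trans (by omega)
    · rw [h, abs_of_pos (by omega)]
  · simp only [Expr.cost_reg, Expr.cost_load, Expr.cost_add, Expr.cost_mul, Expr.cost_const,
      Expr.cost_one]
    omega
  rintro s₃ hf₃ ⟨hs₃, h₃, -⟩
  have h0 : wrap w 0 = 0 := wrap_eq_self hB (by rw [abs_zero]; omega)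
  have h1 : wrap w 1 = 1 := wrap_eq_self hB (by rw [abs_one]; omega)
  refine Run.seq (T := 3) (Run.isWordState (Run.store (e := 0) (f := 0)
    (Q := fun t => t = s₃.setMem K 0 0) (by rw [Expr.eval_zero, h0])) (by omega) hs₃) ?_
  rintro _ - ⟨hs₄, rfl⟩
  refine Run.seq (T := 2) (Run.isWordState (Run.assign (e := 1)
    (Q := fun t => t = (s₃.setMem K 0 0).setReg (K + 2) 1) (by rw [Expr.eval_one, h1]))
    (by omega) hs₄) ?_
  rintro _ - ⟨hs₅, rfl⟩
  have htab : I.Tabulated X K (2 ^ 0) ((s₃.setMem K 0 0).setReg (K + 2) 1) := by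
    refine ⟨?_, ?_, by simp [State.setReg], fun j hj => ?_⟩
    · simp only [State.setReg, State.setMem, Function.update_of_ne (show K ≠ K + 2 by omega)]
      rw [hf₃.1 K (by simp [Prog.fill, Prog.WritesReg]), hn₂]
    · simp only [State.setReg, State.setMem, Function.update_of_ne (show K + 1 ≠ K + 2 by omega)]
      rw [hf₃.1 (K + 1) (by simp [Prog.fill, Prog.WritesReg]), hX₂]
    · simp only [State.setReg, State.setMem, Function.update_self, pow_zero]
      rcases j with - | j
      · simpa using CoinInstance.isMinWeight_zero
      · rw [Function.update_of_ne (by push_cast; omega), h₃ j (by omega)]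
        exact CoinInstance.isMinWeight_one (by omega) hj (hin _ (by omega) hj)
  refine Run.seq (Run.loop (fun m s' => s'.IsWordState w ∧ ∃ q, q + m = Nat.clog 2 I.n ∧
    I.Tabulated X K (2 ^ q) s') (T := TB + 100 * (I.n + 2)) ?_ (Nat.clog 2 I.n) _
    ⟨hs₅, 0, by omega, htab⟩) ?_
  · rintro m s' ⟨hs', q, hq, ht⟩ hne
    rw [Expr.eval_lt_ne_zero hw2, Expr.eval_reg, Expr.eval_reg, ht.reg_n, ht.reg_P] at hne
    have hlt : 2 ^ q < I.n := by exact_mod_cast hne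
    have hqc : q < Nat.clog 2 I.n := by rwa [Nat.lt_clog_iff_pow_lt (by norm_num)]
    refine (ht.run_squaringStep hK3 hK hb hX hnX hw2 hB hp' hs' hlt).mono le_rfl ?_
    rintro s'' - ⟨hs'', ht'⟩
    refine ⟨m - 1, by omega, hs'', q + 1, by omega, ?_⟩
    rwa [pow_succ, mul_two]
  rintro s₆ - ⟨he, m, hs₆, q, hq, ht⟩
  rw [Expr.eval_lt_eq_zero hw2, Expr.eval_reg, Expr.eval_reg, ht.reg_n, ht.reg_P] at he
  have hle : I.n ≤ 2 ^ q := by exact_mod_cast he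
  refine Run.seq (T := 3) (Run.assign (e := .load K (.reg K))
    (Q := fun t => t = s₆.setReg 1 (s₆.mem K I.n))
    (by rw [Expr.eval_load, Expr.eval_reg, ht.reg_n])) ?_
  rintro _ - rfl
  have hopt := (ht.table I.n le_rfl).isOptimum hb hX hX0 hI hle
  have hX₆ : (s₆.setReg 1 (s₆.mem K I.n)).reg (K + 1) = X := by
    simp only [State.setReg]
    rw [Function.update_of_ne (by omega), ht.reg_X]
  have hv₆ : (s₆.setReg 1 (s₆.mem K I.n)).reg 1 = s₆.mem K I.n := by simp [State.setReg]
  refine Run.cond (T := 4) (fun h => ?_) fun h => ?_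
  · rw [Expr.eval_lt_ne_zero hw2, Expr.eval_reg, Expr.eval_reg, hX₆, hv₆] at h
    rw [if_pos h] at hopt
    refine Run.seq (T := 2) (T' := 2) (Run.assign (e := 0) (Q := fun t => t.reg 1 = 0) ?_) ?_
    · simp [State.setReg, Expr.eval_zero, h0]
    · intro s' hf h'
      refine Run.assign (e := 1) ⟨⊤, hopt, .inr ⟨?_, ?_, rfl⟩⟩
      · simp [State.setReg, Expr.eval_one, h1]
      · simpa [State.setReg] using h'
  · rw [Expr.eval_lt_eq_zero hw2, Expr.eval_reg, Expr.eval_reg, hX₆, hv₆] at h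
    rw [if_neg (by omega)] at hopt
    refine Run.mono (Run.assign (e := 0) (Q := coinChange.Output I) ⟨_, hopt, .inl ⟨?_, ?_⟩⟩)
      (by simp only [Expr.cost_zero]; omega) fun _ _ h => h
    · simp [State.setReg, Expr.eval_zero, h0]
    · simp [State.setReg]

/-! ### A Knapsack instance that maximizes over pairs of indices -/

/-- The instance `I` has items of three kinds, of sizes about `64 * g`, `96 * g` and `112 * g`, and
its budget is the sum of these numbers. The profit of an item of size `i` is `M * i`, up to a
comparatively small term `α`, `β` or `γ`; so a good solution exhausts the budget, and the sizes are
such that it consists of one item of each kind. All other items are worthless. -/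
structure KnapsackInstance.IsGadget (I : KnapsackInstance) (g : ℕ) (M : ℤ) (α β γ : ℕ → ℤ) :
    Prop where
  n_eq : I.n = 272 * g
  left : ∀ i < g, (I.profit (64 * g + i) : ℤ) = M * (64 * g + i) + α i
  right : ∀ i < g, (I.profit (96 * g + i) : ℤ) = M * (96 * g + i) + β i
  target : ∀ i < 2 * g, (I.profit (112 * g - i) : ℤ) = M * (112 * g - i) + γ i
  other : ∀ s, 1 ≤ s → s ≤ I.n → ¬ (64 * g ≤ s ∧ s < 65 * g) → ¬ (96 * g ≤ s ∧ s < 97 * g) →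
    ¬ (110 * g < s ∧ s ≤ 112 * g) → I.profit s = 0

namespace KnapsackInstance.IsGadget

variable {I : KnapsackInstance} {g : ℕ} {M U : ℤ} {α β γ : ℕ → ℤ}

theorem sum_profit_triple (h : I.IsGadget g M α β γ) {i j : ℕ} (hi : i < g) (hj : j < g) :
    (I.profit (64 * g + i) : ℤ) + I.profit (96 * g + j) + I.profit (112 * g - (i + j)) =
      M * I.n + (α i + β j + γ (i + j)) := by
  rw [h.left i hi, h.right j hj, h.target (i + j) (by omega), h.n_eq]
  push_cast
  ring

theorem profit_le (h : I.IsGadget g M α β γ) (hα : ∀ i < g, |α i| ≤ U) (hβ : ∀ i < g, |β i| ≤ U)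
    (hγ : ∀ i < 2 * g, |γ i| ≤ U) (hU : 0 ≤ U) (hM : 0 ≤ M) {s : ℕ} (h1 : 1 ≤ s) (h2 : s ≤ I.n) :
    (I.profit s : ℤ) ≤ M * s + U := by
  by_cases hA : 64 * g ≤ s ∧ s < 65 * g
  · obtain ⟨i, rfl⟩ : ∃ i, s = 64 * g + i := ⟨s - 64 * g, by omega⟩
    rw [h.left i (by omega)]
    have := (abs_le.mp (hα i (by omega))).2
    push_cast
    linarith
  by_cases hB : 96 * g ≤ s ∧ s < 97 * g
  · obtain ⟨i, rfl⟩ : ∃ i, s = 96 * g + i := ⟨s - 96 * g, by omega⟩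
    rw [h.right i (by omega)]
    have := (abs_le.mp (hβ i (by omega))).2
    push_cast
    linarith
  by_cases hC : 110 * g < s ∧ s ≤ 112 * g
  · obtain ⟨i, hi, rfl⟩ : ∃ i, i < 2 * g ∧ s = 112 * g - i := ⟨112 * g - s, by omega, by omega⟩
    rw [h.target i hi]
    have := (abs_le.mp (hγ i (by omega))).2
    rw [Nat.cast_sub (by omega)]
    push_cast
    linarith
  · rw [h.other s h1 h2 hA hB hC]
    push_cast
    positivity

theorem sum_profit_le (h : I.IsGadget g M α β γ) (hα : ∀ i < g, |α i| ≤ U)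
    (hβ : ∀ i < g, |β i| ≤ U) (hγ : ∀ i < 2 * g, |γ i| ≤ U) (hU : 0 ≤ U) (hM : 0 ≤ M)
    (S : Multiset ℕ) (hS : ∀ i ∈ S, 1 ≤ i ∧ i ≤ I.n) :
    (((S.map I.profit).sum : ℕ) : ℤ) ≤ M * S.sum + U * S.card := by
  induction S using Multiset.induction with
  | empty => simp
  | cons i S ih =>
    have h1 := ih fun i hi => hS i (Multiset.mem_cons_of_mem hi)
    have h2 := hS i (Multiset.mem_cons_self i S)
    have h3 := h.profit_le hα hβ hγ hU hM h2.1 h2.2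
    rw [Multiset.map_cons, Multiset.sum_cons, Multiset.sum_cons, Multiset.card_cons]
    push_cast at h1 ⊢
    linarith

/-- A multiset of valuable items that exhausts the budget consists of one item of each kind. -/
theorem exists_eq_of_sum_eq (hg : 1 ≤ g) (S : Multiset ℕ)
    (hS : ∀ s ∈ S, (64 * g ≤ s ∧ s < 65 * g) ∨ (96 * g ≤ s ∧ s < 97 * g) ∨
      (110 * g < s ∧ s ≤ 112 * g)) (hsum : S.sum = 272 * g) :
    ∃ i j, i < g ∧ j < g ∧ S = {64 * g + i, 96 * g + j, 112 * g - (i + j)} := by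
  obtain ⟨A, R, hAR, hA, hR⟩ : ∃ A R, A + R = S ∧ (∀ s ∈ A, 64 * g ≤ s ∧ s < 65 * g) ∧
      ∀ s ∈ R, (96 * g ≤ s ∧ s < 97 * g) ∨ (110 * g < s ∧ s ≤ 112 * g) := by
    refine ⟨S.filter fun s => 64 * g ≤ s ∧ s < 65 * g,
      S.filter fun s => ¬ (64 * g ≤ s ∧ s < 65 * g), Multiset.filter_add_not _ _,
      fun s hs => (Multiset.mem_filter.mp hs).2, fun s hs => ?_⟩
    exact (hS s (Multiset.mem_filter.mp hs).1).resolve_left (Multiset.mem_filter.mp hs).2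
  obtain ⟨B, C, hBC, hB, hC⟩ : ∃ B C, B + C = R ∧ (∀ s ∈ B, 96 * g ≤ s ∧ s < 97 * g) ∧
      ∀ s ∈ C, 110 * g < s ∧ s ≤ 112 * g := by
    refine ⟨R.filter fun s => 96 * g ≤ s ∧ s < 97 * g,
      R.filter fun s => ¬ (96 * g ≤ s ∧ s < 97 * g), Multiset.filter_add_not _ _,
      fun s hs => (Multiset.mem_filter.mp hs).2, fun s hs => ?_⟩
    exact (hR s (Multiset.mem_filter.mp hs).1).resolve_left (Multiset.mem_filter.mp hs).2
  subst hBC hAR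
  have bounds : ∀ (D : Multiset ℕ) (l u : ℕ), (∀ s ∈ D, l * g ≤ s ∧ s ≤ u * g) →
      (D.card * l) * g ≤ D.sum ∧ D.sum ≤ (D.card * u) * g := by
    intro D l u hD
    have h1 := Multiset.card_nsmul_le_sum fun s hs => (hD s hs).1
    have h2 := Multiset.sum_le_card_nsmul D _ fun s hs => (hD s hs).2
    rw [smul_eq_mul] at h1 h2
    rw [mul_assoc, mul_assoc]
    exact ⟨h1, h2⟩
  have hA' := bounds A 64 65 fun s hs => ⟨(hA s hs).1, (hA s hs).2.le⟩
  have hB' := bounds B 96 97 fun s hs => ⟨(hB s hs).1, (hB s hs).2.le⟩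
  have hC' := bounds C 110 112 fun s hs => ⟨(hC s hs).1.le, (hC s hs).2⟩
  rw [Multiset.sum_add, Multiset.sum_add] at hsum
  have h1 : A.card * 64 + B.card * 96 + C.card * 110 ≤ 272 := by
    refine Nat.le_of_mul_le_mul_right ?_ hg
    rw [Nat.add_mul, Nat.add_mul]
    omega
  have h2 : 272 ≤ A.card * 65 + B.card * 97 + C.card * 112 := by
    refine Nat.le_of_mul_le_mul_right ?_ hg
    rw [Nat.add_mul, Nat.add_mul]
    omega
  -- Up to the tolerances, `64 * a + 96 * b + 112 * c = 272` has the single solution `(1, 1, 1)`.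
  have hcard : A.card = 1 ∧ B.card = 1 ∧ C.card = 1 := by
    clear * - h1 h2
    generalize A.card = a at *
    generalize B.card = b at *
    generalize C.card = c at *
    have hb : b ≤ 2 := by omega
    have hc : c ≤ 2 := by omega
    interval_cases b <;> interval_cases c <;> omega
  obtain ⟨x, rfl⟩ := Multiset.card_eq_one.mp hcard.1
  obtain ⟨y, rfl⟩ := Multiset.card_eq_one.mp hcard.2.1
  obtain ⟨z, rfl⟩ := Multiset.card_eq_one.mp hcard.2.2
  have hx := hA x (Multiset.mem_singleton_self x)
  have hy := hB y (Multiset.mem_singleton_self y)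
  have hz := hC z (Multiset.mem_singleton_self z)
  simp only [Multiset.sum_singleton] at hsum
  refine ⟨x - 64 * g, y - 96 * g, by omega, by omega, ?_⟩
  rw [show 64 * g + (x - 64 * g) = x by omega, show 96 * g + (y - 96 * g) = y by omega,
    show 112 * g - (x - 64 * g + (y - 96 * g)) = z by omega]
  rfl

/-- A solution other than a triple loses at least one unit of size, and with it more profit than the
small terms can make up for. -/
theorem exists_or_lt (h : I.IsGadget g M α β γ) (hg : 1 ≤ g) (hα : ∀ i < g, |α i| ≤ U)
    (hβ : ∀ i < g, |β i| ≤ U) (hγ : ∀ i < 2 * g, |γ i| ≤ U) (hU : 0 < U)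
    (hM : U * (I.n + 4) ≤ M) (S : Multiset ℕ) (hS : ∀ i ∈ S, 1 ≤ i ∧ i ≤ I.n)
    (hsum : S.sum ≤ I.n) :
    (∃ i j, i < g ∧ j < g ∧
      (((S.map I.profit).sum : ℕ) : ℤ) = M * I.n + (α i + β j + γ (i + j))) ∨
    (((S.map I.profit).sum : ℕ) : ℤ) < M * I.n - 3 * U := by
  have hM0 : 0 ≤ M := le_trans (by positivity) hM
  have small : ∀ S : Multiset ℕ, (∀ i ∈ S, 1 ≤ i ∧ i ≤ I.n) → S.sum + 1 ≤ I.n →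
      (((S.map I.profit).sum : ℕ) : ℤ) < M * I.n - 3 * U := by
    intro S hS hsum
    have h1 := h.sum_profit_le hα hβ hγ hU.le hM0 S hS
    have h2 := Multiset.card_le_sum fun i hi => (hS i hi).1
    have h3 : (S.card : ℤ) ≤ I.n := by exact_mod_cast (by omega : S.card ≤ I.n)
    have h4 : (S.sum : ℤ) + 1 ≤ I.n := by exact_mod_cast hsum
    have h5 := mul_le_mul_of_nonneg_left h3 hU.le
    have h6 := mul_le_mul_of_nonneg_left h4 hM0
    linarith
  by_cases hlt : S.sum + 1 ≤ I.n
  · exact .inr (small S hS hlt)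
  by_cases hval : ∀ s ∈ S, (64 * g ≤ s ∧ s < 65 * g) ∨ (96 * g ≤ s ∧ s < 97 * g) ∨
      (110 * g < s ∧ s ≤ 112 * g)
  · left
    obtain ⟨i, j, hi, hj, rfl⟩ := exists_eq_of_sum_eq hg S hval (by rw [← h.n_eq]; omega)
    refine ⟨i, j, hi, hj, ?_⟩
    rw [← h.sum_profit_triple hi hj]
    simp [add_assoc]
  · right
    push Not at hval
    obtain ⟨s, hs, h1, h2, h3⟩ := hval
    obtain ⟨S, rfl⟩ := Multiset.exists_cons_of_mem hs
    have hs1 := hS s hs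
    rw [Multiset.map_cons, Multiset.sum_cons,
      h.other s hs1.1 hs1.2 (by omega) (by omega) (by omega), zero_add]
    rw [Multiset.sum_cons] at hsum
    exact small S (fun i hi => hS i (Multiset.mem_cons_of_mem hi)) (by omega)

/-- The optimum of the instance is the best value of a triple, provided that triples are admissible
solutions. This covers both versions of the problem. -/
theorem optimum (h : I.IsGadget g M α β γ) (hg : 1 ≤ g) (hα : ∀ i < g, |α i| ≤ U)
    (hβ : ∀ i < g, |β i| ≤ U) (hγ : ∀ i < 2 * g, |γ i| ≤ U) (hU : 0 < U)
    (hM : U * (I.n + 4) ≤ M) {v : ℕ} {X : Set ℕ} (hv : IsGreatest X v)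
    (hX : ∀ x ∈ X, ∃ S : Multiset ℕ, (∀ i ∈ S, 1 ≤ i ∧ i ≤ I.n) ∧ S.sum ≤ I.n ∧
      x = (S.map I.profit).sum)
    (hX' : ∀ i j, i < g → j < g →
      I.profit (64 * g + i) + I.profit (96 * g + j) + I.profit (112 * g - (i + j)) ∈ X) :
    (∃ i j, i < g ∧ j < g ∧ (v : ℤ) = M * I.n + (α i + β j + γ (i + j))) ∧
      ∀ i j, i < g → j < g → M * I.n + (α i + β j + γ (i + j)) ≤ v := by
  have hle : ∀ i j, i < g → j < g → M * I.n + (α i + β j + γ (i + j)) ≤ v := by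
    intro i j hi hj
    rw [← h.sum_profit_triple hi hj]
    exact_mod_cast hv.2 (hX' i j hi hj)
  refine ⟨?_, hle⟩
  obtain ⟨S, hS, hsum, hvS⟩ := hX v hv.1
  rcases h.exists_or_lt hg hα hβ hγ hU hM S hS hsum with h1 | h1
  · rwa [← hvS] at h1
  · rw [← hvS] at h1
    have h2 := hle 0 0 hg hg
    have h3 := abs_le.mp (hα 0 (by omega))
    have h4 := abs_le.mp (hβ 0 (by omega))
    have h5 := abs_le.mp (hγ (0 + 0) (by omega))
    linarith

end KnapsackInstance.IsGadget

/-- A version of Knapsack whose solutions are among the multisets of items, and include all sets of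
items. -/
def KnapsackInstance.AdmitsSets (opt : KnapsackInstance → ℕ → Prop) : Prop :=
  ∀ I v, opt I v → ∃ X : Set ℕ, IsGreatest X v ∧
    (∀ x ∈ X, ∃ S : Multiset ℕ, (∀ i ∈ S, 1 ≤ i ∧ i ≤ I.n) ∧ S.sum ≤ I.n ∧
      x = (S.map I.profit).sum) ∧
    ∀ S : Finset ℕ, (∀ i ∈ S, 1 ≤ i ∧ i ≤ I.n) → ∑ i ∈ S, i ≤ I.n → ∑ i ∈ S, I.profit i ∈ X

theorem KnapsackInstance.admitsSets_isUnboundedOptimum :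
    AdmitsSets KnapsackInstance.IsUnboundedOptimum := by
  intro I v hv
  refine ⟨_, hv, fun x hx => hx, fun S hS hsum => ⟨S.val, hS, (Finset.sum_val S).trans_le hsum, rfl⟩⟩

theorem KnapsackInstance.admitsSets_isBoundedOptimum :
    AdmitsSets KnapsackInstance.IsBoundedOptimum := by
  intro I v hv
  refine ⟨_, hv, ?_, fun S hS hsum => ⟨S, hS, hsum, rfl⟩⟩
  rintro x ⟨S, hS, hsum, rfl⟩
  exact ⟨S.val, hS, (Finset.sum_val S).trans_le hsum, rfl⟩

theorem KnapsackInstance.IsGadget.optimum_of_admitsSets {opt : KnapsackInstance → ℕ → Prop}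
    (hopt : KnapsackInstance.AdmitsSets opt) {I : KnapsackInstance} {g : ℕ} {M U : ℤ}
    {α β γ : ℕ → ℤ} (h : I.IsGadget g M α β γ) (hg : 1 ≤ g) (hα : ∀ i < g, |α i| ≤ U)
    (hβ : ∀ i < g, |β i| ≤ U) (hγ : ∀ i < 2 * g, |γ i| ≤ U) (hU : 0 < U)
    (hM : U * (I.n + 4) ≤ M) {v : ℕ} (hv : opt I v) :
    (∃ i j, i < g ∧ j < g ∧ (v : ℤ) = M * I.n + (α i + β j + γ (i + j))) ∧
      ∀ i j, i < g → j < g → M * I.n + (α i + β j + γ (i + j)) ≤ v := by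
  obtain ⟨X, hX, hX1, hX2⟩ := hopt I v hv
  refine h.optimum hg hα hβ hγ hU hM hX hX1 fun i j hi hj => ?_
  have hn := h.n_eq
  have h1 : 64 * g + i ∉ ({96 * g + j, 112 * g - (i + j)} : Finset ℕ) := by
    simp only [Finset.mem_insert, Finset.mem_singleton]
    omega
  have h2 : 96 * g + j ∉ ({112 * g - (i + j)} : Finset ℕ) := by
    simp only [Finset.mem_singleton]
    omega
  have := hX2 {64 * g + i, 96 * g + j, 112 * g - (i + j)} (by
    intro s hs
    simp only [Finset.mem_insert, Finset.mem_singleton] at hs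
    omega) (by
    rw [Finset.sum_insert h1, Finset.sum_insert h2, Finset.sum_singleton]
    omega)
  rwa [Finset.sum_insert h1, Finset.sum_insert h2, Finset.sum_singleton, ← add_assoc] at this

/-! ### Simultaneous binary search for the entries of a convolution -/

/-- `lo` approximates the `(min,+)`-convolution of two vectors of length `G` from below, up to an
error less than `S`. -/
structure IsApprox (a b : ℕ → ℤ) (G : ℕ) (lo : ℕ → ℤ) (S : ℤ) : Prop where
  le : ∀ i j, i < G → j < G → lo (i + j) ≤ a i + b j
  lt : ∀ k, k + 2 ≤ 2 * G → ∃ i j, i < G ∧ j < G ∧ i + j = k ∧ a i + b j < lo k + S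

/-- The state of a phase of the binary search. The entry `k` of `c` is the threshold `lo k + S` as
long as no sum below this threshold has been found, and afterwards the marker `m`. No block of
pairs before block `z` has a sum below the current threshold, where the pair `(i, j)` belongs to
the block `(i / g) * g + j / g`. -/
structure IsSearch (a b : ℕ → ℤ) (g : ℕ) (lo : ℕ → ℤ) (S m : ℤ) (z : ℕ) (c : ℕ → ℤ) : Prop where
  eq_or : ∀ k < 2 * (g * g), c k = lo k + S ∨
    (c k = m ∧ ∃ i j, i < g * g ∧ j < g * g ∧ i + j = k ∧ a i + b j < lo k + S)
  le : ∀ i j, i < g * g → j < g * g → (i / g) * g + j / g < z → c (i + j) ≤ a i + b j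

/-- The remaining work in a phase: blocks to be finished, and thresholds that may still be marked. -/
def searchMeasure (g : ℕ) (m : ℤ) (z : ℕ) (c : ℕ → ℤ) : ℕ :=
  (g * g - z) + ((Finset.range (2 * (g * g))).filter fun k => c k ≠ m).card

theorem searchMeasure_le (g : ℕ) (m : ℤ) (c : ℕ → ℤ) : searchMeasure g m 0 c ≤ 3 * (g * g) := by
  have := Finset.card_filter_le (Finset.range (2 * (g * g))) fun k => c k ≠ m
  rw [Finset.card_range] at this
  unfold searchMeasure
  omega

section

variable {a b lo c c' : ℕ → ℤ} {g z : ℕ} {S m : ℤ}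

theorem block_lt {x y : ℕ} (hx : x < g) (hy : y < g) : x * g + y < g * g := by
  calc x * g + y < x * g + g := by omega
    _ = (x + 1) * g := by ring
    _ ≤ g * g := Nat.mul_le_mul_right _ hx

theorem IsSearch.start (hlo : ∀ k < 2 * (g * g), c k = lo k + S) : IsSearch a b g lo S m 0 c :=
  ⟨fun k hk => .inl (hlo k hk), fun _ _ _ _ h => absurd h (Nat.not_lt_zero _)⟩

theorem IsSearch.next_block (h : IsSearch a b g lo S m z c) (hz : z < g * g)
    (hc : ∀ i j, i < g → j < g →
      c (z / g * g + z % g * g + (i + j)) ≤ a (z / g * g + i) + b (z % g * g + j))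
    (hcc' : ∀ k < 2 * (g * g), c' k = c k) :
    IsSearch a b g lo S m (z + 1) c' ∧ searchMeasure g m (z + 1) c' < searchMeasure g m z c := by
  have hg : 0 < g := Nat.pos_of_ne_zero (by rintro rfl; simp at hz)
  refine ⟨⟨fun k hk => by rw [hcc' k hk]; exact h.eq_or k hk, fun i j hi hj hlt => ?_⟩, ?_⟩
  · rw [hcc' _ (by omega)]
    rcases Nat.lt_succ_iff_lt_or_eq.mp hlt with hlt | heq
    · exact h.le i j hi hj hlt
    · have hj' : j / g < g := Nat.div_lt_of_lt_mul hj
      have h1 : z / g = i / g := by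
        rw [← heq, mul_comm, Nat.mul_add_div hg, Nat.div_eq_of_lt hj', add_zero]
      have h2 : z % g = j / g := by
        rw [← heq, mul_comm, Nat.mul_add_mod, Nat.mod_eq_of_lt hj']
      have h3 := Nat.div_add_mod' i g
      have h4 := Nat.div_add_mod' j g
      have h5 := hc (i % g) (j % g) (Nat.mod_lt _ hg) (Nat.mod_lt _ hg)
      rw [h1, h2, h3, h4] at h5
      rwa [show i / g * g + j / g * g + (i % g + j % g) = i + j by omega] at h5
  · have : (Finset.range (2 * (g * g))).filter (fun k => c' k ≠ m) =
        (Finset.range (2 * (g * g))).filter fun k => c k ≠ m := by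
      apply Finset.filter_congr
      intro k hk
      rw [hcc' k (Finset.mem_range.mp hk)]
    unfold searchMeasure
    rw [this]
    omega

theorem IsSearch.mark (h : IsSearch a b g lo S m z c)
    (hm : ∀ i j, i < g * g → j < g * g → m ≤ a i + b j) {i j : ℕ} (hi : i < g * g) (hj : j < g * g)
    (hc : a i + b j < c (i + j))
    (hcc' : ∀ k < 2 * (g * g), c' k = if k = i + j then m else c k) :
    IsSearch a b g lo S m z c' ∧ searchMeasure g m z c' < searchMeasure g m z c := by
  have hm' := hm i j hi hj
  have hne : c (i + j) ≠ m := by omega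
  refine ⟨⟨fun k hk => ?_, fun i' j' hi' hj' hlt => ?_⟩, ?_⟩
  · rw [hcc' k hk]
    split_ifs with hk'
    · subst hk'
      refine .inr ⟨rfl, i, j, hi, hj, rfl, ?_⟩
      rcases h.eq_or _ hk with h1 | ⟨h1, -⟩
      · rwa [← h1]
      · exact absurd h1 hne
    · exact h.eq_or k hk
  · rw [hcc' _ (by omega)]
    split_ifs
    · exact hm i' j' hi' hj'
    · exact h.le i' j' hi' hj' hlt
  · unfold searchMeasure
    refine Nat.add_lt_add_left (Finset.card_lt_card ?_) _
    rw [Finset.ssubset_iff_of_subset]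
    · refine ⟨i + j, ?_, ?_⟩
      · simp only [Finset.mem_filter, Finset.mem_range]
        exact ⟨by omega, hne⟩
      · simp only [Finset.mem_filter, Finset.mem_range, not_and, not_not]
        intro hk
        rw [hcc' _ hk, if_pos rfl]
    · intro k hk
      simp only [Finset.mem_filter, Finset.mem_range] at hk ⊢
      refine ⟨hk.1, ?_⟩
      rw [hcc' k hk.1] at hk
      split_ifs at hk
      · exact absurd rfl hk.2
      · exact hk.2

theorem IsSearch.finish (h : IsSearch a b g lo S m z c) (hz : g * g ≤ z) (hS : 0 ≤ S)
    (hlo : ∀ k < 2 * (g * g), m ≤ lo k) (ha : IsApprox a b (g * g) lo (S + S)) {lo' : ℕ → ℤ}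
    (hlo' : ∀ k < 2 * (g * g), lo' k = max (lo k) (c k)) : IsApprox a b (g * g) lo' S := by
  have hg : ∀ i, i < g * g → i / g < g := fun i hi => Nat.div_lt_of_lt_mul hi
  refine ⟨fun i j hi hj => ?_, fun k hk => ?_⟩
  · rw [hlo' _ (by omega)]
    exact max_le (ha.le i j hi hj)
      (h.le i j hi hj ((block_lt (hg i hi) (hg j hj)).trans_le hz))
  · rw [hlo' _ (by omega)]
    rcases h.eq_or k (by omega) with h1 | ⟨h1, i, j, hi, hj, hij, h2⟩
    · rw [h1, max_eq_right (by omega)]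
      obtain ⟨i, j, hi, hj, hij, h2⟩ := ha.lt k hk
      exact ⟨i, j, hi, hj, hij, by omega⟩
    · rw [h1, max_eq_left (hlo k (by omega))]
      exact ⟨i, j, hi, hj, hij, h2⟩

/-- The vectors of a convolution instance, padded to length `G` by entries that are too large to
occur in an optimal sum. -/
structure ConvInstance.IsPadding (I : ConvInstance) (G : ℕ) (W : ℤ) (a b : ℕ → ℤ) : Prop where
  n_le : I.n ≤ G
  left : ∀ i < I.n, a i = I.a i ∧ b i = I.b i
  right : ∀ i < G, I.n ≤ i → a i = 4 * W ∧ b i = 4 * W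

theorem ConvInstance.IsPadding.abs_le {I : ConvInstance} {G W : ℕ} (h : I.IsPadding G W a b)
    (hI : minPlusConvolution.Bounded W I) {i : ℕ} (hi : i < G) :
    |a i| ≤ 4 * W ∧ |b i| ≤ 4 * W := by
  by_cases hin : i < I.n
  · obtain ⟨h1, h2⟩ := hI i hin
    rw [(h.left i hin).1, (h.left i hin).2]
    exact ⟨h1.trans (by omega), h2.trans (by omega)⟩
  · obtain ⟨h1, h2⟩ := h.right i hi (by omega)
    rw [h1, h2, abs_of_nonneg (by positivity)]
    exact ⟨le_rfl, le_rfl⟩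

theorem ConvInstance.IsPadding.isEntry {I : ConvInstance} {G W : ℕ} (hW : 1 ≤ W)
    (h : I.IsPadding G W a b) (hI : minPlusConvolution.Bounded W I) (ha : IsApprox a b G lo 1)
    {k : ℕ} (hk : k + 2 ≤ 2 * I.n) : I.IsEntry k (lo k) := by
  have hle : ∀ i j, i < I.n → j < I.n → i + j = k → lo k ≤ I.a i + I.b j := by
    rintro i j hi hj rfl
    rw [← (h.left i hi).1, ← (h.left j hj).2]
    exact ha.le i j (hi.trans_le h.n_le) (hj.trans_le h.n_le)
  have hn := h.n_le
  obtain ⟨i, j, hi, hj, hij, hlt⟩ := ha.lt k (by omega)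
  have h1 := ha.le i j hi hj
  rw [hij] at h1
  have h2 := hle (min k (I.n - 1)) (k - min k (I.n - 1)) (by omega) (by omega) (by omega)
  have h3 := (hI (min k (I.n - 1)) (by omega)).1
  have h4 := (hI (k - min k (I.n - 1)) (by omega)).2
  rw [_root_.abs_le] at h3 h4
  have hi' : -(W : ℤ) ≤ a i ∧ (I.n ≤ i → a i = 4 * W) := by
    by_cases hin : i < I.n
    · rw [(h.left i hin).1]
      exact ⟨(_root_.abs_le.mp (hI i hin).1).1, fun h => absurd h (by omega)⟩
    · have := (h.right i hi (by omega)).1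
      exact ⟨by omega, fun _ => this⟩
  have hj' : -(W : ℤ) ≤ b j ∧ (I.n ≤ j → b j = 4 * W) := by
    by_cases hjn : j < I.n
    · rw [(h.left j hjn).2]
      exact ⟨(_root_.abs_le.mp (hI j hjn).2).1, fun h => absurd h (by omega)⟩
    · have := (h.right j hj (by omega)).2
      exact ⟨by omega, fun _ => this⟩
  have hin : i < I.n := by
    by_contra hin
    have := hi'.2 (by omega)
    omega
  have hjn : j < I.n := by
    by_contra hjn
    have := hj'.2 (by omega)
    omega
  refine ⟨⟨i, j, hin, hjn, hij, ?_⟩, ?_⟩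
  · rw [← (h.left i hin).1, ← (h.left j hjn).2]
    omega
  · rintro _ ⟨i, j, hi, hj, hij, rfl⟩
    exact hle i j hi hj hij

theorem IsApprox.init {G : ℕ} {V : ℤ} (hab : ∀ i < G, |a i| ≤ V ∧ |b i| ≤ V)
    (hlo : ∀ k < 2 * G, lo k = -(2 * V)) (hS : 4 * V < S) : IsApprox a b G lo S := by
  simp only [abs_le] at hab
  refine ⟨fun i j hi hj => ?_, fun k hk => ?_⟩
  · rw [hlo _ (by omega)]
    linarith [(hab i hi).1.1, (hab j hj).2.1]
  · have hi : min k (G - 1) < G := by omega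
    have hj : k - min k (G - 1) < G := by omega
    refine ⟨_, _, hi, hj, by omega, ?_⟩
    rw [hlo _ (by omega)]
    linarith [(hab _ hi).1.2, (hab _ hj).2.2]

end

/-! ### Searching one block pair by a call of Knapsack -/

/-- The Knapsack problem with optimality condition `opt`; this covers the bounded and the unbounded
version. -/
def knapsackProblem (opt : KnapsackInstance → ℕ → Prop) : Problem where
  Inst := KnapsackInstance
  size I := I.n
  Bounded W I := ∀ i : ℕ, 1 ≤ i → i ≤ I.n → I.profit i ≤ W
  Input I s := s.reg 0 = (I.n : ℤ) ∧
    ∀ i : ℕ, 1 ≤ i → i ≤ I.n → s.mem 0 (i : ℤ) = (I.profit i : ℤ)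
  Output I s := ∃ v : ℕ, opt I v ∧ s.reg 1 = (v : ℤ)

/-- The numbers that control the size of Knapsack profits: `U` bounds the data-dependent part of a
profit, `M` is the profit per unit of size, and `B` bounds all numbers that are computed. -/
structure BlockParams (g W : ℕ) (U M B : ℤ) : Prop where
  one_le_g : 1 ≤ g
  one_le_W : 1 ≤ W
  U_eq : U = W * (272 * g)
  M_eq : M = U * (272 * g + 4)
  B_eq : B = M * (272 * g) + 3 * U

namespace BlockParams

variable {g W : ℕ} {U M B : ℤ}

theorem le_U (h : BlockParams g W U M B) : 272 * (W : ℤ) ≤ U ∧ 272 * (g : ℤ) ≤ U ∧ 0 < U := by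
  have hg : (1 : ℤ) ≤ g := by exact_mod_cast h.one_le_g
  have hW : (1 : ℤ) ≤ W := by exact_mod_cast h.one_le_W
  rw [h.U_eq]
  refine ⟨by nlinarith, by nlinarith, by positivity⟩

theorem le_M (h : BlockParams g W U M B) : U * (272 * g) ≤ M ∧ 4 * U ≤ M ∧ 272 * (g : ℤ) ≤ M := by
  have hg : (1 : ℤ) ≤ g := by exact_mod_cast h.one_le_g
  obtain ⟨-, h1, h2⟩ := h.le_U
  rw [h.M_eq]
  refine ⟨by nlinarith, by nlinarith, by nlinarith⟩

theorem le_B (h : BlockParams g W U M B) : M + 3 * U ≤ B ∧ 272 * (g * g : ℤ) ≤ B := by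
  have hg : (1 : ℤ) ≤ g := by exact_mod_cast h.one_le_g
  obtain ⟨-, h1, h2⟩ := h.le_U
  obtain ⟨-, -, h3⟩ := h.le_M
  rw [h.B_eq]
  refine ⟨by nlinarith, by nlinarith⟩

theorem abs_profit_le (h : BlockParams g W U M B) {s e : ℤ} (hs : 0 ≤ s) (hs' : s ≤ 272 * g)
    (he : |e| ≤ U) : |M * s + e| ≤ B := by
  obtain ⟨h1, h2, h3⟩ := h.le_M
  obtain ⟨-, -, h4⟩ := h.le_U
  obtain ⟨h5, h6⟩ := abs_le.mp he
  have h7 := mul_le_mul_of_nonneg_left hs' (by omega : 0 ≤ M)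
  have h8 := mul_nonneg (by omega : 0 ≤ M) hs
  rw [h.B_eq, abs_le]
  constructor <;> linarith

theorem abs_mul_le (h : BlockParams g W U M B) {x : ℤ} (hx : |x| ≤ 26 * W) :
    |2 * g * x| + 2 * g ≤ U := by
  have hg : (1 : ℤ) ≤ g := by exact_mod_cast h.one_le_g
  have hW : (1 : ℤ) ≤ W := by exact_mod_cast h.one_le_W
  rw [abs_mul, abs_of_nonneg (by positivity), h.U_eq]
  nlinarith [mul_le_mul_of_nonneg_left hx (by positivity : (0 : ℤ) ≤ 2 * g)]

end BlockParams

/-- Write the profits of the items of sizes `σ * g + i` for `i < g`; their data are read from the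
array `arr`, from the address in register `base` on. Register `K + 1` holds `g`, register `K + 6`
holds `M`, and register `K + 7` holds `2 * g`. -/
def writeItems (K : ℕ) (σ : ℤ) (arr base : ℕ) : Prog :=
  .fill (K + 9) 0 (.reg (K + 1)) (.const σ * .reg (K + 1) + .reg (K + 9))
    (.reg (K + 6) * (.const σ * .reg (K + 1) + .reg (K + 9)) -
      .reg (K + 7) * .load arr (.reg base + .reg (K + 9)))

theorem run_writeItems {g W w K σ arr base x : ℕ} {U M B : ℤ} {α : ℕ → ℤ} {s : State}
    (h : BlockParams g W U M B) (hB : 2 * B < 2 ^ w) (hw : 2 ≤ w) (hσ : σ ≤ 112) (harr : arr ≠ 0)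
    (hbase : base ≠ K + 9) (hx : x + g ≤ g * g) (hg : s.reg (K + 1) = g) (hM : s.reg (K + 6) = M)
    (hD : s.reg (K + 7) = 2 * g) (hxs : s.reg base = x) (hα : ∀ i < g, |α (x + i)| ≤ 26 * W)
    (hmem : ∀ i < g, s.mem arr ((x + i : ℕ) : ℤ) = α (x + i)) :
    Run w (writeItems K σ arr base) s (40 * (g + 1)) (fun s' =>
      (∀ i < g, s'.mem 0 ((σ * g + i : ℕ) : ℤ) = M * (σ * g + i) + -(2 * g * α (x + i))) ∧
      ∀ y, (∀ i < g, y ≠ ((σ * g + i : ℕ) : ℤ)) → s'.mem 0 y = s.mem 0 y) := by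
  obtain ⟨hB1, hB2⟩ := h.le_B
  obtain ⟨hM1, hM2, hM3⟩ := h.le_M
  obtain ⟨hU1, hU2, hU3⟩ := h.le_U
  have hσg : (σ : ℤ) * g ≤ 112 * g := by
    gcongr
    exact_mod_cast hσ
  have hσg0 : 0 ≤ (σ : ℤ) * g := by positivity
  refine (Run.fill (s := s) g (fun i => ((σ * g + i : ℕ) : ℤ))
    (fun i => M * (σ * g + i) + -(2 * g * α (x + i))) hw (by omega)
    (fun j k h _ => by simpa using h.ne) ?_).mono ?_ fun _ _ h => h
  · intro k s' hk hi hr hb hy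
    have h1 : s'.reg (K + 1) = g := by rw [hr _ (by omega), hg]
    have h6 : s'.reg (K + 6) = M := by rw [hr _ (by omega), hM]
    have h7 : s'.reg (K + 7) = 2 * g := by rw [hr _ (by omega), hD]
    have hb' : s'.reg base = x := by rw [hr _ hbase, hxs]
    refine ⟨by rw [Expr.eval_reg, h1], fun hk => ⟨?_, ?_⟩⟩
    · simp only [Expr.eval_add, Expr.eval_mul, Expr.eval_reg, Expr.eval_const, wrap_add_wrap_left,
        wrap_mul_wrap_left, h1, hi]
      push_cast
      exact wrap_eq_self hB (by rw [abs_of_nonneg (by positivity)]; omega)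
    · have haddr : (Expr.reg base + Expr.reg (K + 9)).eval w s' = ((x + k : ℕ) : ℤ) := by
        rw [Expr.eval_add, Expr.eval_reg, Expr.eval_reg, hb', hi, ← Nat.cast_add]
        have : ((x + k : ℕ) : ℤ) ≤ (g : ℤ) * g := by exact_mod_cast (by omega : x + k ≤ g * g)
        exact wrap_eq_self hB (by rw [Nat.abs_cast]; omega)
      have hload : (Expr.load arr (Expr.reg base + Expr.reg (K + 9))).eval w s' = α (x + k) := by
        rw [Expr.eval_load, haddr, hb arr harr, hmem k hk]
      simp only [hload, Expr.eval_add, Expr.eval_sub, Expr.eval_mul, Expr.eval_reg,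
        Expr.eval_const, wrap_add_wrap_left, wrap_mul_wrap_left, wrap_mul_wrap_right,
        wrap_sub_wrap_left, wrap_sub_wrap_right, h1, h6, h7, hi]
      rw [sub_eq_add_neg]
      refine wrap_eq_self hB (h.abs_profit_le (by positivity) (by omega) ?_)
      rw [abs_neg]
      linarith [h.abs_mul_le (hα k hk)]
  · simp only [Expr.cost_reg, Expr.cost_add, Expr.cost_sub, Expr.cost_mul, Expr.cost_const,
      Expr.cost_load]
    omega

/-- Write the Knapsack instance for the blocks of `a` and `b` that start at the addresses in registers
`K + 10` and `K + 11`, and the corresponding thresholds. -/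
def writeInstance (K : ℕ) : Prog :=
  .seq (.fill (K + 9) 0 (.reg (K + 5) + 1) (.reg (K + 9)) 0)
    (.seq (writeItems K 64 K (K + 10))
    (.seq (writeItems K 96 (K + 1) (K + 11))
    (.fill (K + 9) 0 (.reg (K + 7)) (.const 112 * .reg (K + 1) - .reg (K + 9))
      (.reg (K + 6) * (.const 112 * .reg (K + 1) - .reg (K + 9)) + (.reg (K + 9) +
      .reg (K + 7) * .load (K + 3) (.reg (K + 10) + .reg (K + 11) + .reg (K + 9)))))))

/-- The part of the state that is fixed during the search. -/
structure IsSetup (n g W K : ℕ) (M : ℤ) (a b : ℕ → ℤ) (s : State) : Prop where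
  reg0 : s.reg K = n
  reg1 : s.reg (K + 1) = g
  reg2 : s.reg (K + 2) = (g * g : ℕ)
  reg3 : s.reg (K + 3) = W
  reg5 : s.reg (K + 5) = (272 * g : ℕ)
  reg6 : s.reg (K + 6) = M
  reg7 : s.reg (K + 7) = 2 * g
  left : ∀ i < g * g, s.mem K i = a i
  right : ∀ i < g * g, s.mem (K + 1) i = b i

theorem IsSetup.of_frame {n g W K : ℕ} {M : ℤ} {a b : ℕ → ℤ} {s s' : State} {p : Prog}
    (h : IsSetup n g W K M a b s) (hf : p.Frame s s')
    (hr : ∀ j, j ≤ 7 → j ≠ 4 → ¬ p.WritesReg (K + j)) (hm : ∀ j, j ≤ 1 → ¬ p.WritesMem (K + j)) :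
    IsSetup n g W K M a b s' where
  reg0 := (hf.1 K (hr 0 (by omega) (by omega))).trans h.reg0
  reg1 := (hf.1 _ (hr 1 (by omega) (by omega))).trans h.reg1
  reg2 := (hf.1 _ (hr 2 (by omega) (by omega))).trans h.reg2
  reg3 := (hf.1 _ (hr 3 (by omega) (by omega))).trans h.reg3
  reg5 := (hf.1 _ (hr 5 (by omega) (by omega))).trans h.reg5
  reg6 := (hf.1 _ (hr 6 (by omega) (by omega))).trans h.reg6
  reg7 := (hf.1 _ (hr 7 (by omega) (by omega))).trans h.reg7
  left i hi := by rw [hf.2 K (hm 0 (by omega)), h.left i hi]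
  right i hi := by rw [hf.2 (K + 1) (hm 1 (by omega)), h.right i hi]

theorem run_writeInstance {n g W w K x y : ℕ} {U M B : ℤ} {a b c : ℕ → ℤ} {s : State} (hK : 3 ≤ K)
    (h : BlockParams g W U M B) (hB : 2 * B < 2 ^ w) (hw : 2 ≤ w)
    (hs : IsSetup n g W K M a b s)
    (ha : ∀ i < g * g, |a i| ≤ 26 * W) (hb : ∀ i < g * g, |b i| ≤ 26 * W)
    (hc : ∀ i < 2 * (g * g), |c i| ≤ 26 * W) (hx : x + g ≤ g * g) (hy : y + g ≤ g * g)
    (hxs : s.reg (K + 10) = x) (hys : s.reg (K + 11) = y)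
    (hmem : ∀ i < 2 * (g * g), s.mem (K + 3) i = c i) :
    Run w (writeInstance K) s (10000 * (g + 1)) (fun s' => ∃ I : KnapsackInstance,
      (∀ i : ℕ, s'.mem 0 (i : ℤ) = I.profit i ∨ I.n < i) ∧
      I.IsGadget g M (fun i => -(2 * g * a (x + i))) (fun i => -(2 * g * b (y + i)))
        (fun i => i + 2 * g * c (x + y + i))) := by
  obtain ⟨hB1, hB2⟩ := h.le_B
  obtain ⟨hM1, hM2, hM3⟩ := h.le_M
  obtain ⟨hU1, hU2, hU3⟩ := h.le_U
  have hg1 := h.one_le_g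
  have h0 : wrap w 0 = 0 := wrap_eq_self hB (by rw [abs_zero]; omega)
  refine Run.mono (T := 20 * (272 * g + 1 + 1) + (40 * (g + 1) + (40 * (g + 1) + 50 * (2 * g + 1))))
    ?_ (by omega) fun _ _ h => h
  refine Run.seq (Run.mono (Run.fill (s := s) (272 * g + 1) (fun i => (i : ℤ)) (fun _ => 0) hw
    (by push_cast; omega) (fun j k h _ => by simpa using h.ne) ?_)
    (T' := 20 * (272 * g + 1 + 1)) ?_ fun _ _ h => h) ?_
  · intro k s' hk hi hr hb hy
    refine ⟨?_, fun _ => ⟨by rw [Expr.eval_reg, hi], by rw [Expr.eval_zero, h0]⟩⟩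
    rw [Expr.eval_add, Expr.eval_reg, Expr.eval_one, wrap_add_wrap_right, hr _ (by omega), hs.reg5]
    push_cast
    exact wrap_eq_self hB (by rw [abs_of_nonneg (by positivity)]; omega)
  · simp only [Expr.cost_reg, Expr.cost_add, Expr.cost_one, Expr.cost_zero]
    omega
  rintro s₁ hf₁ ⟨h₁, -⟩
  have hs₁ := hs.of_frame hf₁ (fun j _ _ => by simp [Prog.fill, Prog.WritesReg]; omega)
    (fun j _ => by simp [Prog.fill, Prog.WritesMem]; omega)
  have hx₁ : s₁.reg (K + 10) = x := by
    rw [hf₁.1 _ (by simp [Prog.fill, Prog.WritesReg]), hxs]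
  have hy₁ : s₁.reg (K + 11) = y := by
    rw [hf₁.1 _ (by simp [Prog.fill, Prog.WritesReg]), hys]
  have hm₁ : s₁.mem (K + 3) = s.mem (K + 3) := hf₁.2 _ (by simp [Prog.fill, Prog.WritesMem])
  refine Run.seq (run_writeItems (σ := 64) h hB hw (by omega) (by omega) (by omega) hx hs₁.reg1
    hs₁.reg6 hs₁.reg7 hx₁ (fun i hi => ha _ (by omega)) (fun i hi => hs₁.left _ (by omega))) ?_
  rintro s₂ hf₂ ⟨h₂, h₂'⟩
  have hs₂ := hs₁.of_frame hf₂
    (fun j _ _ => by simp [writeItems, Prog.fill, Prog.WritesReg]; omega)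
    (fun j _ => by simp [writeItems, Prog.fill, Prog.WritesMem]; omega)
  have hx₂ : s₂.reg (K + 10) = x := by
    rw [hf₂.1 _ (by simp [writeItems, Prog.fill, Prog.WritesReg]), hx₁]
  have hy₂ : s₂.reg (K + 11) = y := by
    rw [hf₂.1 _ (by simp [writeItems, Prog.fill, Prog.WritesReg]), hy₁]
  have hm₂ : s₂.mem (K + 3) = s.mem (K + 3) := by
    rw [hf₂.2 _ (by simp [writeItems, Prog.fill, Prog.WritesMem]), hm₁]
  refine Run.seq (run_writeItems (σ := 96) h hB hw (by omega) (by omega) (by omega) hy hs₂.reg1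
    hs₂.reg6 hs₂.reg7 hy₂ (fun i hi => hb _ (by omega)) (fun i hi => hs₂.right _ (by omega))) ?_
  rintro s₃ hf₃ ⟨h₃, h₃'⟩
  have hs₃ := hs₂.of_frame hf₃
    (fun j _ _ => by simp [writeItems, Prog.fill, Prog.WritesReg]; omega)
    (fun j _ => by simp [writeItems, Prog.fill, Prog.WritesMem]; omega)
  have hx₃ : s₃.reg (K + 10) = x := by
    rw [hf₃.1 _ (by simp [writeItems, Prog.fill, Prog.WritesReg]), hx₂]
  have hy₃ : s₃.reg (K + 11) = y := by
    rw [hf₃.1 _ (by simp [writeItems, Prog.fill, Prog.WritesReg]), hy₂]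
  have hm₃ : s₃.mem (K + 3) = s.mem (K + 3) := by
    rw [hf₃.2 _ (by simp [writeItems, Prog.fill, Prog.WritesMem]), hm₂]
  have hγ : ∀ k < 2 * g, |(k : ℤ) + 2 * g * c (x + y + k)| ≤ U := by
    intro k hk
    have h1 := h.abs_mul_le (hc (x + y + k) (by omega))
    have h2 := abs_add_le (k : ℤ) (2 * g * c (x + y + k))
    rw [Nat.abs_cast] at h2
    omega
  refine Run.mono (Run.fill (s := s₃) (2 * g) (fun k => ((112 * g - k : ℕ) : ℤ))
    (fun k => M * (112 * g - k) + (k + 2 * g * c (x + y + k))) hw (by push_cast; omega)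
    (fun j k h hk => by simp only [ne_eq, Nat.cast_inj]; omega) ?_) ?_ ?_
  · intro k s' hk hi hr hb hy
    have h1 : s'.reg (K + 1) = g := by rw [hr _ (by omega), hs₃.reg1]
    have h6 : s'.reg (K + 6) = M := by rw [hr _ (by omega), hs₃.reg6]
    have h7 : s'.reg (K + 7) = 2 * g := by rw [hr _ (by omega), hs₃.reg7]
    have hx' : s'.reg (K + 10) = x := by rw [hr _ (by omega), hx₃]
    have hy' : s'.reg (K + 11) = y := by rw [hr _ (by omega), hy₃]
    refine ⟨by rw [Expr.eval_reg, h7]; push_cast; rfl, fun hk => ⟨?_, ?_⟩⟩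
    · simp only [Expr.eval_sub, Expr.eval_mul, Expr.eval_reg, Expr.eval_const, wrap_sub_wrap_left,
        wrap_mul_wrap_left, h1, hi]
      rw [show (112 : ℤ) * g - k = ((112 * g - k : ℕ) : ℤ) by omega]
      exact wrap_eq_self hB (by rw [Nat.abs_cast]; omega)
    · have haddr : (Expr.reg (K + 10) + Expr.reg (K + 11) + Expr.reg (K + 9)).eval w s' =
          ((x + y + k : ℕ) : ℤ) := by
        rw [Expr.eval_add, Expr.eval_add, Expr.eval_reg, Expr.eval_reg, Expr.eval_reg, hx', hy', hi,
          wrap_add_wrap_left, ← Nat.cast_add, ← Nat.cast_add]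
        have : ((x + y + k : ℕ) : ℤ) ≤ 2 * ((g : ℤ) * g) := by
          exact_mod_cast (by omega : x + y + k ≤ 2 * (g * g))
        exact wrap_eq_self hB (by rw [Nat.abs_cast]; omega)
      have hload : (Expr.load (K + 3) (Expr.reg (K + 10) + Expr.reg (K + 11) +
          Expr.reg (K + 9))).eval w s' = c (x + y + k) := by
        rw [Expr.eval_load, haddr, hb (K + 3) (by omega), hm₃, hmem _ (by omega)]
      simp only [hload, Expr.eval_add, Expr.eval_sub, Expr.eval_mul, Expr.eval_reg,
        Expr.eval_const, wrap_add_wrap_left, wrap_add_wrap_right, wrap_mul_wrap_left,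
        wrap_mul_wrap_right, wrap_sub_wrap_left, h1, h6, h7, hi]
      exact wrap_eq_self hB (h.abs_profit_le (by omega) (by omega) (hγ k hk))
  · simp only [Expr.cost_reg, Expr.cost_add, Expr.cost_sub, Expr.cost_mul, Expr.cost_const,
      Expr.cost_load]
    omega
  rintro s₄ - ⟨h₄, h₄'⟩
  have left : ∀ i < g, s₄.mem 0 ((64 * g + i : ℕ) : ℤ) = M * (64 * g + i) +
      -(2 * g * a (x + i)) := by
    intro i hi
    rw [h₄' _ (fun j hj => by simp only [ne_eq, Nat.cast_inj]; omega),
      h₃' _ (fun j hj => by simp only [ne_eq, Nat.cast_inj]; omega)]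
    exact_mod_cast h₂ i hi
  have right : ∀ i < g, s₄.mem 0 ((96 * g + i : ℕ) : ℤ) = M * (96 * g + i) +
      -(2 * g * b (y + i)) := by
    intro i hi
    rw [h₄' _ (fun j hj => by simp only [ne_eq, Nat.cast_inj]; omega)]
    exact_mod_cast h₃ i hi
  have other : ∀ s, s ≤ 272 * g → ¬ (64 * g ≤ s ∧ s < 65 * g) → ¬ (96 * g ≤ s ∧ s < 97 * g) →
      ¬ (110 * g < s ∧ s ≤ 112 * g) → s₄.mem 0 (s : ℤ) = 0 := by
    intro s hs hA hB hC
    rw [h₄' _ (fun j hj => by simp only [ne_eq, Nat.cast_inj]; omega),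
      h₃' _ (fun j hj => by simp only [ne_eq, Nat.cast_inj]; omega),
      h₂' _ (fun j hj => by simp only [ne_eq, Nat.cast_inj]; omega), h₁ s (by omega)]
  have nonneg : ∀ s e : ℤ, 1 ≤ s → |e| ≤ U → 0 ≤ M * s + e := by
    intro s e hs he
    have := mul_le_mul_of_nonneg_left hs (by omega : 0 ≤ M)
    have := (abs_le.mp he).1
    linarith
  have habs : ∀ z : ℤ, |z| ≤ 26 * W → |-(2 * g * z)| ≤ U := by
    intro z hz
    rw [abs_neg]
    linarith [h.abs_mul_le hz]
  have left0 : ∀ i < g, 0 ≤ s₄.mem 0 ((64 * g + i : ℕ) : ℤ) := by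
    intro i hi
    rw [left i hi]
    exact nonneg _ _ (by omega) (habs _ (ha _ (by omega)))
  have right0 : ∀ i < g, 0 ≤ s₄.mem 0 ((96 * g + i : ℕ) : ℤ) := by
    intro i hi
    rw [right i hi]
    exact nonneg _ _ (by omega) (habs _ (hb _ (by omega)))
  have target0 : ∀ i < 2 * g, 0 ≤ s₄.mem 0 ((112 * g - i : ℕ) : ℤ) := by
    intro i hi
    rw [h₄ i hi]
    exact nonneg _ _ (by omega) (hγ i hi)
  refine ⟨⟨272 * g, fun i => (s₄.mem 0 (i : ℤ)).toNat⟩, fun i => ?_, rfl, ?_, ?_, ?_, ?_⟩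
  · by_cases hi : 272 * g < i
    · exact .inr hi
    · left
      refine (Int.toNat_of_nonneg ?_).symm
      by_cases hA : 64 * g ≤ i ∧ i < 65 * g
      · rw [show i = 64 * g + (i - 64 * g) by omega]
        exact left0 _ (by omega)
      by_cases hB : 96 * g ≤ i ∧ i < 97 * g
      · rw [show i = 96 * g + (i - 96 * g) by omega]
        exact right0 _ (by omega)
      by_cases hC : 110 * g < i ∧ i ≤ 112 * g
      · rw [show i = 112 * g - (112 * g - i) by omega]
        exact target0 _ (by omega)
      · rw [other i (by omega) hA hB hC]
  · intro i hi
    exact (Int.toNat_of_nonneg (left0 i hi)).trans (left i hi)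
  · intro i hi
    exact (Int.toNat_of_nonneg (right0 i hi)).trans (right i hi)
  · intro i hi
    exact (Int.toNat_of_nonneg (target0 i hi)).trans (h₄ i hi)
  · intro s _ hs hA hB hC
    simp only
    rw [other s hs hA hB hC, Int.toNat_zero]

/-- Search block `z` (in register `K + 8`) by a call of the Knapsack algorithm `p`: either no sum is
below its threshold, and the search goes on with the next block, or one such threshold is
marked. -/
def searchStep (p : Prog) (K : ℕ) : Prog :=
  .seq (.assign (K + 10) (.reg (K + 8) / .reg (K + 1) * .reg (K + 1)))
    (.seq (.assign (K + 11) (.reg (K + 8) % .reg (K + 1) * .reg (K + 1)))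
    (.seq (writeInstance K)
    (.seq (.assign 0 (.reg (K + 5)))
    (.seq p
    (.seq (.assign (K + 12) (.reg 1 - .reg (K + 6) * .reg (K + 5)))
    (.cond ((Expr.reg (K + 12)).lt (.reg (K + 7)))
      (.assign (K + 8) (.reg (K + 8) + 1))
      (.store (K + 3) (.reg (K + 10) + .reg (K + 11) + .reg (K + 12) % .reg (K + 7))
        (0 - .const 8 * .reg (K + 3)))))))))

theorem searchStep_writesReg {p : Prog} {K : ℕ} (hK : ∀ r, K ≤ r → ¬ p.WritesReg r) {j : ℕ}
    (hj : j ≤ 7) (hK0 : 1 ≤ K) : ¬ (searchStep p K).WritesReg (K + j) := by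
  have := hK (K + j) (by omega)
  simp only [searchStep, writeInstance, writeItems, Prog.fill, Prog.WritesReg, this,
    or_false, false_or]
  omega

theorem searchStep_writesMem {p : Prog} {K : ℕ} (hK : ∀ r, K ≤ r → ¬ p.WritesMem r) {j : ℕ}
    (hj : j ≤ 2) (hK0 : 1 ≤ K) : ¬ (searchStep p K).WritesMem (K + j) := by
  have := hK (K + j) (by omega)
  simp only [searchStep, writeInstance, writeItems, Prog.fill, Prog.WritesMem, this,
    or_false, false_or]
  omega

theorem run_searchStep {opt : KnapsackInstance → ℕ → Prop}
    (hopt : KnapsackInstance.AdmitsSets opt) {n g W w K TB z : ℕ} {U M B S : ℤ}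
    {a b lo c : ℕ → ℤ} {p : Prog} {s : State} (hK3 : 3 ≤ K)
    (hK : ∀ r, K ≤ r → ¬ p.WritesReg r ∧ ¬ p.WritesMem r)
    (h : BlockParams g W U M B) (hB : 2 * B < 2 ^ w) (hw : 2 ≤ w)
    (hp : ∀ I : KnapsackInstance, I.n = 272 * g →
      (∀ i, 1 ≤ i → i ≤ I.n → (I.profit i : ℤ) ≤ B) → ∀ s : State, s.IsWordState w →
      (knapsackProblem opt).Input I s → Run w p s TB ((knapsackProblem opt).Output I))
    (hs : IsSetup n g W K M a b s) (hsw : s.IsWordState w)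
    (ha : ∀ i < g * g, |a i| ≤ 4 * W) (hb : ∀ i < g * g, |b i| ≤ 4 * W)
    (hc : ∀ i < 2 * (g * g), |c i| ≤ 26 * W) (hz : z < g * g) (hzs : s.reg (K + 8) = z)
    (hmem : ∀ i < 2 * (g * g), s.mem (K + 3) i = c i)
    (hsearch : IsSearch a b g lo S (-(8 * W)) z c) :
    Run w (searchStep p K) s (TB + 10100 * (g + 1)) (fun s' => ∃ z' c',
      IsSearch a b g lo S (-(8 * W)) z' c' ∧ s'.reg (K + 8) = (z' : ℕ) ∧
      (∀ i < 2 * (g * g), s'.mem (K + 3) i = c' i) ∧ (∀ i < 2 * (g * g), |c' i| ≤ 26 * W) ∧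
      searchMeasure g (-(8 * W)) z' c' < searchMeasure g (-(8 * W)) z c) := by
  obtain ⟨hB1, hB2⟩ := h.le_B
  obtain ⟨hM1, hM2, hM3⟩ := h.le_M
  obtain ⟨hU1, hU2, hU3⟩ := h.le_U
  have hg1 := h.one_le_g
  have hdiv : z / g < g := Nat.div_lt_of_lt_mul hz
  have hmod : z % g < g := Nat.mod_lt _ hg1
  obtain ⟨x, hx⟩ : ∃ x, x = z / g * g := ⟨_, rfl⟩
  obtain ⟨y, hy⟩ : ∃ y, y = z % g * g := ⟨_, rfl⟩
  have hxg : x + g ≤ g * g := by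
    rw [hx, ← Nat.succ_mul]
    exact Nat.mul_le_mul_right _ hdiv
  have hyg : y + g ≤ g * g := by
    rw [hy, ← Nat.succ_mul]
    exact Nat.mul_le_mul_right _ hmod
  have hgg : ∀ u : ℕ, u ≤ 2 * (g * g) → |(u : ℤ)| ≤ B := by
    intro u hu
    rw [Nat.abs_cast]
    have : (u : ℤ) ≤ 2 * ((g : ℤ) * g) := by exact_mod_cast hu
    omega
  refine Run.mono (T := 6 + (6 + (10000 * (g + 1) + (2 + (TB + (6 + 20)))))) ?_ (by omega)
    fun _ _ h => h
  refine Run.seq (T := 6) (Run.isWordState (Run.assign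
    (e := .reg (K + 8) / .reg (K + 1) * .reg (K + 1)) (Q := fun t => t = s.setReg (K + 10) x) ?_)
    (by omega) hsw) ?_
  · rw [Expr.eval_mul, Expr.eval_div, Expr.eval_reg, Expr.eval_reg, hzs, hs.reg1,
      wrap_mul_wrap_left, ← Int.natCast_div, ← Nat.cast_mul, ← hx,
      wrap_eq_self hB (hgg x (by omega))]
  rintro _ hf₁ ⟨hsw₁, rfl⟩
  have hs₁ := hs.of_frame hf₁ (fun j _ _ => by simp only [Prog.WritesReg]; omega)
    (fun j _ => by simp [Prog.WritesMem])
  refine Run.seq (T := 6) (Run.isWordState (Run.assign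
    (e := .reg (K + 8) % .reg (K + 1) * .reg (K + 1))
    (Q := fun t => t = (s.setReg (K + 10) x).setReg (K + 11) y) ?_) (by omega) hsw₁) ?_
  · rw [Expr.eval_mul, Expr.eval_mod, Expr.eval_reg, Expr.eval_reg, hs₁.reg1, wrap_mul_wrap_left]
    simp only [State.setReg]
    rw [Function.update_of_ne (by omega), hzs, ← Int.natCast_mod, ← Nat.cast_mul, ← hy,
      wrap_eq_self hB (hgg y (by omega))]
  rintro _ hf₂ ⟨hsw₂, rfl⟩
  have hs₂ := hs₁.of_frame hf₂ (fun j _ _ => by simp only [Prog.WritesReg]; omega)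
    (fun j _ => by simp [Prog.WritesMem])
  obtain ⟨s₂, hs₂def⟩ : ∃ s₂, s₂ = (s.setReg (K + 10) x).setReg (K + 11) y := ⟨_, rfl⟩
  have hx₂ : s₂.reg (K + 10) = x := by simp [hs₂def, State.setReg]
  have hy₂ : s₂.reg (K + 11) = y := by simp [hs₂def, State.setReg]
  have hz₂ : s₂.reg (K + 8) = z := by simp [hs₂def, State.setReg, hzs]
  have hm₂ : s₂.mem (K + 3) = s.mem (K + 3) := by simp [hs₂def, State.setReg]
  rw [← hs₂def] at hs₂ hsw₂ ⊢
  have ha' : ∀ i < g * g, |a i| ≤ 26 * W := fun i hi => (ha i hi).trans (by omega)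
  have hb' : ∀ i < g * g, |b i| ≤ 26 * W := fun i hi => (hb i hi).trans (by omega)
  refine Run.seq (Run.isWordState (run_writeInstance hK3 h hB hw hs₂ ha' hb' hc hxg hyg hx₂ hy₂
    (fun i hi => by rw [hm₂, hmem i hi])) (by omega) hsw₂) ?_
  rintro s₃ hf₃ ⟨hsw₃, I, hI, hG⟩
  have hα : ∀ i < g, |-(2 * g * a (x + i))| ≤ U := fun i hi => by
    rw [abs_neg]
    linarith [h.abs_mul_le (ha' (x + i) (by omega))]
  have hβ : ∀ i < g, |-(2 * g * b (y + i))| ≤ U := fun i hi => by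
    rw [abs_neg]
    linarith [h.abs_mul_le (hb' (y + i) (by omega))]
  have hγ : ∀ k < 2 * g, |(k : ℤ) + 2 * g * c (x + y + k)| ≤ U := by
    intro k hk
    have h1 := h.abs_mul_le (hc (x + y + k) (by omega))
    have h2 := abs_add_le (k : ℤ) (2 * g * c (x + y + k))
    rw [Nat.abs_cast] at h2
    omega
  have hs₃ := hs₂.of_frame hf₃
    (fun j _ _ => by
      simp only [writeInstance, writeItems, Prog.fill, Prog.WritesReg, false_or]
      omega)
    (fun j _ => by
      simp only [writeInstance, writeItems, Prog.fill, Prog.WritesMem, or_false, false_or]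
      omega)
  have hr₃ : ∀ j, j = 8 ∨ j = 10 ∨ j = 11 → s₃.reg (K + j) = s₂.reg (K + j) := fun j hj =>
    hf₃.1 _ (by
      simp only [writeInstance, writeItems, Prog.fill, Prog.WritesReg, false_or]
      omega)
  have hm₃ : s₃.mem (K + 3) = s.mem (K + 3) := by
    rw [hf₃.2 _ (by
      simp only [writeInstance, writeItems, Prog.fill, Prog.WritesMem, or_false, false_or]
      omega), hm₂]
  have hIn : I.n = 272 * g := hG.n_eq
  refine Run.seq (T := 2) (Run.isWordState (Run.assign (e := .reg (K + 5))
    (Q := fun t => t = s₃.setReg 0 I.n) (by rw [Expr.eval_reg, hs₃.reg5, hIn])) (by omega) hsw₃) ?_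
  rintro _ hf₄ ⟨hsw₄, rfl⟩
  have hs₄ := hs₃.of_frame hf₄ (fun j _ _ => by simp only [Prog.WritesReg]; omega)
    (fun j _ => by simp [Prog.WritesMem])
  refine Run.seq (hp I hIn ?_ _ hsw₄ ⟨?_, ?_⟩) ?_
  · intro i hi1 hi2
    have h1 := hG.profit_le hα hβ hγ (by omega) (by omega) hi1 hi2
    have h2 : M * i ≤ M * (272 * g) := by
      rw [hIn] at hi2
      refine mul_le_mul_of_nonneg_left (by exact_mod_cast hi2) (by omega)
    rw [h.B_eq]
    linarith
  · simp [State.setReg]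
  · intro i hi1 hi2
    exact (hI i).resolve_right (by omega)
  rintro s₅ hf₅ ⟨v, hv, hv₅⟩
  have hs₅ := hs₄.of_frame hf₅ (fun j _ _ => (hK _ (by omega)).1) (fun j _ => (hK _ (by omega)).2)
  have hr₅ : ∀ j, j = 8 ∨ j = 10 ∨ j = 11 → s₅.reg (K + j) = s₂.reg (K + j) := fun j hj => by
    rw [hf₅.1 _ (hK _ (by omega)).1, ← hr₃ j hj]
    simp only [State.setReg]
    rw [Function.update_of_ne (by omega)]
  have hm₅ : s₅.mem (K + 3) = s.mem (K + 3) := by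
    rw [hf₅.2 _ (hK _ (by omega)).2, ← hm₃]
    rfl
  obtain ⟨⟨i₀, j₀, hi₀, hj₀, hv₀⟩, hmax⟩ := hG.optimum_of_admitsSets hopt hg1 hα hβ hγ hU3
    (by rw [h.M_eq, hIn]; push_cast; rfl) hv
  -- The excess of the optimum over `M * n` is the maximum of `2 * g * (c - a - b) + k` with
  -- `k < 2 * g` the offset of the threshold, so it reveals both the sign of `c - a - b` and `k`.
  obtain ⟨r, hr⟩ : ∃ r, r = (v : ℤ) - M * I.n := ⟨_, rfl⟩
  refine Run.seq (T := 6) (T' := 20) (Run.assign (e := .reg 1 - .reg (K + 6) * .reg (K + 5))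
    (Q := fun t => t = s₅.setReg (K + 12) r) ?_) ?_
  · rw [Expr.eval_sub, Expr.eval_mul, Expr.eval_reg, Expr.eval_reg, Expr.eval_reg, hv₅, hs₅.reg6,
      hs₅.reg5, wrap_sub_wrap_right, ← hIn, ← hr, wrap_eq_self hB]
    have e1 := abs_le.mp (hα i₀ hi₀)
    have e2 := abs_le.mp (hβ j₀ hj₀)
    have e3 := abs_le.mp (hγ (i₀ + j₀) (by omega))
    rw [hr, hv₀, abs_le]
    constructor <;> linarith
  rintro _ hf₆ rfl
  have hs₆ := hs₅.of_frame hf₆ (fun j _ _ => by simp only [Prog.WritesReg]; omega)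
    (fun j _ => by simp [Prog.WritesMem])
  obtain ⟨s₆, hs₆def⟩ : ∃ s₆, s₆ = s₅.setReg (K + 12) r := ⟨_, rfl⟩
  have hr₆ : s₆.reg (K + 12) = r := by simp [hs₆def, State.setReg]
  have hx₆ : s₆.reg (K + 10) = x := by
    rw [← hx₂, ← hr₅ 10 (by omega)]
    simp [hs₆def, State.setReg]
  have hy₆ : s₆.reg (K + 11) = y := by
    rw [← hy₂, ← hr₅ 11 (by omega)]
    simp [hs₆def, State.setReg]
  have hz₆ : s₆.reg (K + 8) = z := by
    rw [← hz₂, ← hr₅ 8 (by omega)]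
    simp [hs₆def, State.setReg]
  have hm₆ : s₆.mem (K + 3) = s.mem (K + 3) := by
    rw [← hm₅, hs₆def]
    rfl
  rw [← hs₆def] at hs₆ ⊢
  refine Run.mono (T := 4 + 16) (Run.cond (T := 16) (fun hlt => ?_) fun hlt => ?_) le_rfl
    fun _ _ h => h
  · rw [Expr.eval_lt_ne_zero hw, Expr.eval_reg, Expr.eval_reg, hr₆, hs₆.reg7] at hlt
    refine Run.mono (Run.assign (e := .reg (K + 8) + 1)
      (Q := fun t => t = s₆.setReg (K + 8) ((z + 1 : ℕ) : ℤ)) ?_) ?_ ?_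
    · rw [Expr.eval_add, Expr.eval_one, Expr.eval_reg, hz₆, wrap_add_wrap_right, ← Nat.cast_one,
        ← Nat.cast_add, wrap_eq_self hB (hgg _ (by omega))]
    · simp only [Expr.cost_add, Expr.cost_reg, Expr.cost_one]
      omega
    rintro _ - rfl
    have hnext := hsearch.next_block (c' := c) hz (fun i j hi hj => ?_) fun _ _ => rfl
    · refine ⟨z + 1, c, hnext.1, by simp [State.setReg], fun i hi => ?_, hc, hnext.2⟩
      rw [← hmem i hi, ← hm₆]
      rfl
    · rw [← hx, ← hy]
      by_contra hcon
      have h1 := hmax i j hi hj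
      have h2 : 2 * (g : ℤ) * 1 ≤ 2 * g * (c (x + y + (i + j)) - a (x + i) - b (y + j)) := by
        gcongr
        omega
      push_cast at h1
      linarith [(Nat.cast_nonneg i : (0 : ℤ) ≤ i), (Nat.cast_nonneg j : (0 : ℤ) ≤ j)]
  · rw [Expr.eval_lt_eq_zero hw, Expr.eval_reg, Expr.eval_reg, hr₆, hs₆.reg7] at hlt
    have hrr : r = ((i₀ + j₀ : ℕ) : ℤ) +
        2 * g * (c (x + y + (i₀ + j₀)) - a (x + i₀) - b (y + j₀)) := by
      rw [hr, hv₀]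
      ring
    have hmodr : r % (2 * g) = ((i₀ + j₀ : ℕ) : ℤ) := by
      rw [hrr, Int.add_mul_emod_self_left, Int.emod_eq_of_lt (by positivity) (by omega)]
    have hviol : a (x + i₀) + b (y + j₀) < c (x + i₀ + (y + j₀)) := by
      rw [show x + i₀ + (y + j₀) = x + y + (i₀ + j₀) by omega]
      by_contra hcon
      have h2 : 2 * (g : ℤ) * (c (x + y + (i₀ + j₀)) - a (x + i₀) - b (y + j₀)) ≤ 0 :=
        mul_nonpos_of_nonneg_of_nonpos (by positivity) (by omega)
      have : ((i₀ + j₀ : ℕ) : ℤ) < 2 * g := by omega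
      linarith
    have haddr : (Expr.reg (K + 10) + Expr.reg (K + 11) + Expr.reg (K + 12) %
        Expr.reg (K + 7)).eval w s₆ = ((x + i₀ + (y + j₀) : ℕ) : ℤ) := by
      rw [Expr.eval_add, Expr.eval_add, Expr.eval_mod, Expr.eval_reg, Expr.eval_reg, Expr.eval_reg,
        Expr.eval_reg, hx₆, hy₆, hr₆, hs₆.reg7, hmodr, wrap_add_wrap_left, wrap_add_wrap_right,
        ← Nat.cast_add, ← Nat.cast_add, wrap_eq_self hB (hgg _ (by omega))]
      congr 1
      omega
    have hval : (0 - Expr.const 8 * Expr.reg (K + 3)).eval w s₆ = -(8 * W) := by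
      rw [Expr.eval_sub, Expr.eval_zero, Expr.eval_mul, Expr.eval_const, Expr.eval_reg, hs₆.reg3,
        wrap_mul_wrap_left, wrap_sub_wrap_left, wrap_sub_wrap_right, zero_sub]
      exact wrap_eq_self hB (by rw [abs_neg, abs_of_nonneg (by positivity)]; omega)
    refine Run.mono (Run.store (Q := fun t => t =
      s₆.setMem (K + 3) ((x + i₀ + (y + j₀) : ℕ) : ℤ) (-(8 * W))) ?_) ?_ ?_
    · rw [haddr, hval]
    · simp only [Expr.cost_add, Expr.cost_reg, Expr.cost_zero, Expr.cost_mod, Expr.cost_sub,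
        Expr.cost_mul, Expr.cost_const]
      omega
    rintro _ - rfl
    have hmark := hsearch.mark (i := x + i₀) (j := y + j₀)
      (c' := fun k => if k = x + i₀ + (y + j₀) then -(8 * W) else c k) (fun i j hi hj => ?_)
      (by omega) (by omega) hviol fun _ _ => rfl
    · refine ⟨z, _, hmark.1, hz₆, fun i hi => ?_, fun i hi => ?_, hmark.2⟩
      · simp only [State.setMem, Function.update_self]
        split_ifs with heq
        · rw [heq, Function.update_self]
        · rw [Function.update_of_ne (by exact_mod_cast heq), hm₆, hmem i hi]
      · split_ifs with heq
        · rw [abs_neg, abs_of_nonneg (by positivity)]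
          omega
        · exact hc i hi
    · have h1 := (abs_le.mp (ha i hi)).1
      have h2 := (abs_le.mp (hb j hj)).1
      omega

/-! ### Searching all block pairs -/

/-- One phase of the binary search: register `K + 4` holds the new error bound, and array `K + 2`
the lower bounds to be improved. -/
def searchPhase (p : Prog) (K : ℕ) : Prog :=
  .seq (.fill (K + 9) (K + 3) (.const 2 * .reg (K + 2)) (.reg (K + 9))
      (.load (K + 2) (.reg (K + 9)) + .reg (K + 4)))
    (.seq (.assign (K + 8) 0)
    (.seq (.loop ((Expr.reg (K + 8)).lt (.reg (K + 2))) (searchStep p K))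
    (.fill (K + 9) (K + 2) (.const 2 * .reg (K + 2)) (.reg (K + 9))
      (.load (K + 2) (.reg (K + 9)) +
        (Expr.load (K + 2) (.reg (K + 9))).lt (.load (K + 3) (.reg (K + 9))) *
        (.load (K + 3) (.reg (K + 9)) - .load (K + 2) (.reg (K + 9)))))))

/-- Array `K + 2` holds lower bounds for the entries of the convolution, up to an error below `S`,
which lie in a range that does not depend on the phase. -/
structure HasApprox (K g W : ℕ) (a b : ℕ → ℤ) (S : ℤ) (s : State) : Prop where
  approx : IsApprox a b (g * g) (fun k => s.mem (K + 2) k) S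
  le : ∀ k : ℕ, k < 2 * (g * g) → -(8 * (W : ℤ)) ≤ s.mem (K + 2) k
  add_le : ∀ k : ℕ, k < 2 * (g * g) → s.mem (K + 2) k + S ≤ 26 * W

theorem searchPhase_writesReg {p : Prog} {K : ℕ} (hK : ∀ r, K ≤ r → ¬ p.WritesReg r) {j : ℕ}
    (hj : j ≤ 7) (hK0 : 1 ≤ K) : ¬ (searchPhase p K).WritesReg (K + j) := by
  have := searchStep_writesReg hK hj hK0
  simp only [searchPhase, Prog.fill, Prog.WritesReg, this, false_or]
  omega

theorem searchPhase_writesMem {p : Prog} {K : ℕ} (hK : ∀ r, K ≤ r → ¬ p.WritesMem r) {j : ℕ}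
    (hj : j ≤ 1) (hK0 : 1 ≤ K) : ¬ (searchPhase p K).WritesMem (K + j) := by
  have := searchStep_writesMem hK (j := j) (by omega) hK0
  simp only [searchPhase, Prog.fill, Prog.WritesMem, this, or_false, false_or]
  omega

theorem run_searchPhase {opt : KnapsackInstance → ℕ → Prop}
    (hopt : KnapsackInstance.AdmitsSets opt) {n g W w K TB : ℕ} {U M B S : ℤ}
    {a b : ℕ → ℤ} {p : Prog} {s : State} (hK3 : 3 ≤ K)
    (hK : ∀ r, K ≤ r → ¬ p.WritesReg r ∧ ¬ p.WritesMem r)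
    (h : BlockParams g W U M B) (hB : 2 * B < 2 ^ w) (hw : 2 ≤ w)
    (hp : ∀ I : KnapsackInstance, I.n = 272 * g →
      (∀ i, 1 ≤ i → i ≤ I.n → (I.profit i : ℤ) ≤ B) → ∀ s : State, s.IsWordState w →
      (knapsackProblem opt).Input I s → Run w p s TB ((knapsackProblem opt).Output I))
    (hs : IsSetup n g W K M a b s) (hsw : s.IsWordState w)
    (ha : ∀ i < g * g, |a i| ≤ 4 * W) (hb : ∀ i < g * g, |b i| ≤ 4 * W)
    (hS : 0 ≤ S) (hSs : s.reg (K + 4) = S) (hlo : HasApprox K g W a b (S + S) s) :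
    Run w (searchPhase p K) s
      (100 * (2 * (g * g) + 1) + 3 * (g * g) * (4 + (TB + 10100 * (g + 1))))
      (HasApprox K g W a b S) := by
  obtain ⟨hB1, hB2⟩ := h.le_B
  obtain ⟨hM1, hM2, hM3⟩ := h.le_M
  obtain ⟨hU1, hU2, hU3⟩ := h.le_U
  have hcnt : 2 * ((2 * (g * g) : ℕ) : ℤ) < 2 ^ w := by push_cast; omega
  have hlim : ∀ s' : State, s'.reg (K + 2) = (g * g : ℕ) →
      (Expr.const 2 * Expr.reg (K + 2)).eval w s' = ((2 * (g * g) : ℕ) : ℤ) := by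
    intro s' hs'
    rw [Expr.eval_mul, Expr.eval_const, wrap_mul_wrap_left, Expr.eval_reg, hs']
    push_cast
    exact wrap_eq_self hB (by rw [abs_of_nonneg (by positivity)]; omega)
  have hbound : ∀ x : ℤ, -(8 * (W : ℤ)) ≤ x → x ≤ 26 * W → |x| ≤ 26 * W := by
    intro x h1 h2
    rw [abs_le]
    omega
  have h0 : wrap w 0 = 0 := wrap_eq_self hB (by rw [abs_zero]; omega)
  obtain ⟨lo, hlodef⟩ : ∃ lo : ℕ → ℤ, lo = fun k : ℕ => s.mem (K + 2) (k : ℤ) := ⟨_, rfl⟩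
  obtain ⟨happ, hle, hadd⟩ := hlo
  have hlok : ∀ k : ℕ, s.mem (K + 2) k = lo k := fun k => by rw [hlodef]
  simp only [hlok] at happ hle hadd
  refine Run.mono (T := 30 * (2 * (g * g) + 1) + (2 +
    ((3 * (g * g) * (4 + (TB + 10100 * (g + 1))) + 4) + 60 * (2 * (g * g) + 1)))) ?_ (by omega)
    fun _ _ h => h
  refine Run.seq (Run.isWordState (Run.mono (Run.fill (s := s) (2 * (g * g)) (fun k => (k : ℤ))
    (fun k => lo k + S) hw hcnt (fun j k h _ => by simpa using h.ne) ?_)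
    (T' := 30 * (2 * (g * g) + 1)) ?_ fun _ _ h => h) (by omega) hsw) ?_
  · intro k s' hk hi hr hb hx
    refine ⟨hlim s' (by rw [hr _ (by omega), hs.reg2]), fun hk => ⟨by rw [Expr.eval_reg, hi], ?_⟩⟩
    rw [Expr.eval_add, Expr.eval_load, Expr.eval_reg, Expr.eval_reg, hi, hb _ (by omega), hlok,
      hr _ (by omega), hSs]
    have h1 := hle k hk
    have h2 := hadd k hk
    exact wrap_eq_self hB ((hbound _ (by omega) (by omega)).trans (by omega))
  · simp only [Expr.cost_reg, Expr.cost_add, Expr.cost_mul, Expr.cost_const, Expr.cost_load]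
    omega
  rintro s₁ hf₁ ⟨hsw₁, h₁, -⟩
  have hs₁ := hs.of_frame hf₁ (fun j _ _ => by simp [Prog.fill, Prog.WritesReg]; omega)
    (fun j _ => by simp [Prog.fill, Prog.WritesMem]; omega)
  have hm₁ : s₁.mem (K + 2) = s.mem (K + 2) := hf₁.2 _ (by simp [Prog.fill, Prog.WritesMem])
  refine Run.seq (T := 2) (Run.isWordState (Run.assign (e := 0)
    (Q := fun t => t = s₁.setReg (K + 8) 0) (by rw [Expr.eval_zero, h0])) (by omega) hsw₁) ?_
  rintro _ hf₂ ⟨hsw₂, rfl⟩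
  have hs₂ := hs₁.of_frame hf₂ (fun j _ _ => by simp only [Prog.WritesReg]; omega)
    (fun j _ => by simp [Prog.WritesMem])
  refine Run.seq (Run.mono (Run.loop (T := TB + 10100 * (g + 1)) (fun m s' =>
    s'.IsWordState w ∧ IsSetup n g W K M a b s' ∧ s'.mem (K + 2) = s.mem (K + 2) ∧ ∃ z c,
      IsSearch a b g lo S (-(8 * W)) z c ∧ s'.reg (K + 8) = (z : ℕ) ∧
      (∀ i < 2 * (g * g), s'.mem (K + 3) i = c i) ∧ (∀ i < 2 * (g * g), |c i| ≤ 26 * W) ∧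
      searchMeasure g (-(8 * W)) z c = m) ?_ (searchMeasure g (-(8 * W)) 0 fun k => lo k + S) _
    ⟨hsw₂, hs₂, hm₁, 0, fun k => lo k + S, .start fun _ _ => rfl, by simp [State.setReg],
      fun i hi => h₁ i hi, fun i hi => ?_, rfl⟩)
    (T' := 3 * (g * g) * (4 + (TB + 10100 * (g + 1))) + 4) ?_ fun _ _ h => h) ?_
  · rintro m s' ⟨hsw', hs', hm', z, c, hz, hzs, hmem, hc, rfl⟩ hne
    rw [Expr.eval_lt_ne_zero hw, Expr.eval_reg, Expr.eval_reg, hzs, hs'.reg2] at hne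
    refine Run.mono (Run.isWordState (run_searchStep hopt hK3 hK h hB hw hp hs' hsw' ha hb hc
      (by exact_mod_cast hne) hzs hmem hz) (by omega) hsw') le_rfl ?_
    rintro s'' hf ⟨hsw'', z', c', hz', hzs', hmem', hc', hlt⟩
    refine ⟨_, hlt, hsw'', hs'.of_frame hf
      (fun j hj _ => searchStep_writesReg (fun r hr => (hK r hr).1) hj (by omega))
      (fun j hj => searchStep_writesMem (fun r hr => (hK r hr).2) (by omega) (by omega)), ?_,
      z', c', hz', hzs', hmem', hc', rfl⟩
    rw [hf.2 _ (searchStep_writesMem (fun r hr => (hK r hr).2) (by omega) (by omega)), hm']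
  · have h1 := hle i hi
    have h2 := hadd i hi
    change |lo i + S| ≤ _
    exact hbound _ (by omega) (by omega)
  · simp only [Expr.cost_lt, Expr.cost_reg]
    gcongr
    exact searchMeasure_le _ _ _
  rintro s₃ - ⟨he, m, hsw₃, hs₃, hm₃, z, c, hz, hzs, hmem, hc, -⟩
  rw [Expr.eval_lt_eq_zero hw, Expr.eval_reg, Expr.eval_reg, hzs, hs₃.reg2] at he
  have hgz : g * g ≤ z := by exact_mod_cast he
  have hmax : ∀ x y : ℤ, x + (if x < y then 1 else 0) * (y - x) = max x y := by
    intro x y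
    split_ifs with hxy
    · rw [max_eq_right hxy.le]
      ring
    · rw [max_eq_left (by omega)]
      ring
  have hcle : ∀ k < 2 * (g * g), c k ≤ lo k + S := by
    intro k hk
    rcases hz.eq_or k hk with h1 | ⟨h1, -⟩
    · exact h1.le
    · rw [h1]
      linarith [hle k hk]
  refine Run.mono (Run.fill (s := s₃) (2 * (g * g)) (fun k => (k : ℤ))
    (fun k => max (lo k) (c k)) hw hcnt (fun j k h _ => by simpa using h.ne) ?_) ?_ ?_
  · intro k s' hk hi hr hb hx
    refine ⟨hlim s' (by rw [hr _ (by omega), hs₃.reg2]), fun hk => ⟨by rw [Expr.eval_reg, hi], ?_⟩⟩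
    simp only [Expr.eval_add, Expr.eval_mul, Expr.eval_sub, Expr.eval_lt, Expr.eval_load,
      Expr.eval_reg, wrap_add_wrap_right, wrap_mul_wrap_left, wrap_mul_wrap_right, hi,
      hb (K + 3) (by omega), hmem k hk, hx k (fun j hj => by simpa using hj.ne'), hm₃, hlok, hmax]
    have h1 := hle k hk
    have h2 := hadd k hk
    have h3 := hcle k hk
    exact wrap_eq_self hB ((hbound _ (le_max_of_le_left h1)
      (max_le (by omega) (by omega))).trans (by omega))
  · simp only [Expr.cost_reg, Expr.cost_add, Expr.cost_mul, Expr.cost_const, Expr.cost_load,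
      Expr.cost_sub, Expr.cost_lt]
    omega
  rintro s₄ - ⟨h₄, -⟩
  refine ⟨hz.finish hgz hS hle happ h₄, fun k hk => ?_, fun k hk => ?_⟩
  · rw [h₄ k hk]
    exact le_max_of_le_left (hle k hk)
  · rw [h₄ k hk]
    have h1 := hadd k hk
    have h2 := hcle k hk
    have h3 : max (lo k) (c k) ≤ lo k + S := max_le (by omega) h2
    omega

/-! ### Preparation of the search -/

/-- Compute the parameters of the search from `n`: the bound `W = (n + 2) ^ c` on the input numbers,
the least block length `g` with `n ≤ g * g`, and the numbers of `BlockParams`. -/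
def setParams (K c : ℕ) : Prog :=
  .seq (.assign K (.reg 0))
    (.seq (.assign (K + 3) ((Expr.reg 0 + .const 2).npow c))
    (.seq (.assign (K + 1) 0)
    (.seq (.loop ((Expr.reg (K + 1) * .reg (K + 1)).lt (.reg K))
      (.assign (K + 1) (.reg (K + 1) + 1)))
    (.seq (.assign (K + 2) (.reg (K + 1) * .reg (K + 1)))
    (.seq (.assign (K + 5) (.const 272 * .reg (K + 1)))
    (.seq (.assign (K + 6) (.reg (K + 3) * .reg (K + 5) * (.reg (K + 5) + .const 4)))
    (.assign (K + 7) (.const 2 * .reg (K + 1)))))))))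

theorem run_setParams {n g w K c : ℕ} {U M B : ℤ} {s : State} (hK3 : 3 ≤ K)
    (h : BlockParams g ((n + 2) ^ c) U M B) (hB : 2 * B < 2 ^ w) (hw : 2 ≤ w) (hn : s.reg 0 = n)
    (hng : n ≤ g * g) (hgn : (g - 1) * (g - 1) < n) :
    Run w (setParams K c) s (12 * g + 4 * c + 50) (fun s' => s'.reg K = n ∧ s'.reg (K + 1) = g ∧
      s'.reg (K + 2) = (g * g : ℕ) ∧ s'.reg (K + 3) = ((n + 2) ^ c : ℕ) ∧
      s'.reg (K + 5) = (272 * g : ℕ) ∧ s'.reg (K + 6) = M ∧ s'.reg (K + 7) = 2 * g) := by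
  obtain ⟨hB1, hB2⟩ := h.le_B
  obtain ⟨hM1, hM2, hM3⟩ := h.le_M
  obtain ⟨hU1, hU2, hU3⟩ := h.le_U
  have hg1 := h.one_le_g
  obtain ⟨W, hW⟩ : ∃ W, W = (n + 2) ^ c := ⟨_, rfl⟩
  have hUeq := h.U_eq
  have hMeq := h.M_eq
  rw [← hW] at hUeq hU1 ⊢
  have hn2 : (n : ℤ) + 2 ≤ 272 * (g * g) := by
    have : n + 2 ≤ 272 * (g * g) := by nlinarith
    exact_mod_cast this
  have h0 : wrap w 0 = 0 := wrap_eq_self hB (by rw [abs_zero]; omega)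
  refine Run.mono (T := 2 + ((4 * c + 2) + (2 + ((g * 10 + 6) + (4 + (4 + (8 + 4))))))) ?_
    (by omega) fun _ _ h => h
  refine Run.seq (T := 2) (Run.assign (e := .reg 0) (Q := fun t => t = s.setReg K n)
    (by rw [Expr.eval_reg, hn])) ?_
  rintro _ - rfl
  refine Run.seq (Run.mono (Run.assign (e := (Expr.reg 0 + .const 2).npow c)
    (Q := fun t => t = (s.setReg K n).setReg (K + 3) W) ?_)
    (T' := 4 * c + 2) ?_ fun _ _ h => h) ?_
  · have : (Expr.reg 0 + .const 2).eval w (s.setReg K n) = (n : ℤ) + 2 := by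
      rw [Expr.eval_add, Expr.eval_reg, Expr.eval_const, wrap_add_wrap_right]
      simp only [State.setReg, Function.update_of_ne (show 0 ≠ K by omega), hn]
      exact wrap_eq_self hB (by rw [abs_of_nonneg (by positivity)]; omega)
    rw [Expr.eval_npow, this]
    have hW' : ((n : ℤ) + 2) ^ c = W := by rw [hW]; push_cast; rfl
    rw [hW', wrap_eq_self hB (by rw [Nat.abs_cast]; omega)]
  · rw [Expr.cost_npow]
    simp only [Expr.cost_add, Expr.cost_reg, Expr.cost_const]
    omega
  rintro _ - rfl
  refine Run.seq (T := 2) (Run.assign (e := 0)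
    (Q := fun t => t = ((s.setReg K n).setReg (K + 3) W).setReg (K + 1) 0)
    (by rw [Expr.eval_zero, h0])) ?_
  rintro _ - rfl
  obtain ⟨s₃, hs₃⟩ : ∃ s₃, s₃ = ((s.setReg K n).setReg (K + 3) W).setReg (K + 1) 0 := ⟨_, rfl⟩
  have hn₃ : s₃.reg K = n := by simp [hs₃, State.setReg]
  have hg₃ : s₃.reg (K + 1) = 0 := by simp [hs₃, State.setReg]
  have hW₃ : s₃.reg (K + 3) = W := by simp [hs₃, State.setReg]
  rw [← hs₃]
  have hsq : ∀ j : ℕ, j ≤ g → |((j * j : ℕ) : ℤ)| ≤ B := by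
    intro j hj
    have : ((j * j : ℕ) : ℤ) ≤ (g : ℤ) * g := by exact_mod_cast Nat.mul_le_mul hj hj
    rw [Nat.abs_cast]
    omega
  have hev : ∀ (j : ℕ) (s' : State), j ≤ g → s'.reg (K + 1) = j →
      (Expr.reg (K + 1) * .reg (K + 1)).eval w s' = ((j * j : ℕ) : ℤ) := by
    intro j s' hj hs'
    rw [Expr.eval_mul, Expr.eval_reg, hs', ← Nat.cast_mul, wrap_eq_self hB (hsq j hj)]
  refine Run.seq (Run.mono (Run.loop (T := 4) (fun m s' => ∃ j : ℕ, j + m = g ∧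
      s'.reg (K + 1) = j ∧ s'.reg K = n ∧ s'.reg (K + 3) = W) ?_ g s₃
      ⟨0, by omega, by simpa using hg₃, hn₃, hW₃⟩) (T' := g * 10 + 6) ?_ fun _ _ h => h) ?_
  · rintro m s' ⟨j, hjm, hj, hn', hW'⟩ hne
    rw [Expr.eval_lt_ne_zero hw, hev j s' (by omega) hj, Expr.eval_reg, hn', Nat.cast_lt] at hne
    have hjg : j < g := by
      by_contra hcon
      have := Nat.mul_le_mul (not_lt.mp hcon) (not_lt.mp hcon)
      omega
    refine Run.assign (e := .reg (K + 1) + 1) ?_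
    refine ⟨m - 1, by omega, j + 1, by omega, ?_, ?_, ?_⟩
    · rw [Expr.eval_add, Expr.eval_one, Expr.eval_reg, hj, wrap_add_wrap_right]
      simp only [State.setReg, Function.update_self]
      push_cast
      exact wrap_eq_self hB (by rw [abs_of_nonneg (by positivity)]; omega)
    · simp [State.setReg, hn']
    · simp [State.setReg, hW']
  · simp only [Expr.cost_lt, Expr.cost_mul, Expr.cost_reg]
    omega
  rintro s₄ - ⟨he, m, j, hjm, hj, hn₄, hW₄⟩
  rw [Expr.eval_lt_eq_zero hw, hev j s₄ (by omega) hj, Expr.eval_reg, hn₄, Nat.cast_le] at he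
  obtain rfl : j = g := by
    by_contra hcon
    have h1 : j ≤ g - 1 := by omega
    have := Nat.mul_le_mul h1 h1
    omega
  refine Run.seq (T := 4) (Run.assign (e := .reg (K + 1) * .reg (K + 1))
    (Q := fun t => t = s₄.setReg (K + 2) (j * j : ℕ)) (by rw [hev j s₄ le_rfl hj])) ?_
  rintro _ - rfl
  refine Run.seq (T := 4) (Run.assign (e := .const 272 * .reg (K + 1))
    (Q := fun t => t = (s₄.setReg (K + 2) (j * j : ℕ)).setReg (K + 5) (272 * j : ℕ)) ?_) ?_
  · rw [Expr.eval_mul, Expr.eval_const, Expr.eval_reg, wrap_mul_wrap_left]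
    simp only [State.setReg, Function.update_of_ne (show K + 1 ≠ K + 2 by omega), hj]
    push_cast
    rw [wrap_eq_self hB (by rw [abs_of_nonneg (by positivity)]; omega)]
  rintro _ - rfl
  refine Run.seq (T := 8) (Run.assign
    (e := .reg (K + 3) * .reg (K + 5) * (.reg (K + 5) + .const 4))
    (Q := fun t => t = ((s₄.setReg (K + 2) (j * j : ℕ)).setReg (K + 5)
      (272 * j : ℕ)).setReg (K + 6) M) ?_) ?_
  · simp only [Expr.eval_mul, Expr.eval_add, Expr.eval_const, Expr.eval_reg, wrap_add_wrap_right,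
      wrap_mul_wrap_left, wrap_mul_wrap_right, State.setReg, Function.update_self,
      Function.update_of_ne (show K + 3 ≠ K + 5 by omega),
      Function.update_of_ne (show K + 3 ≠ K + 2 by omega), hW₄]
    push_cast
    rw [← hUeq, ← hMeq, wrap_eq_self hB (by rw [abs_of_nonneg (by omega)]; omega)]
  rintro _ - rfl
  refine Run.assign (e := .const 2 * .reg (K + 1)) ?_
  have hD : (Expr.const 2 * .reg (K + 1)).eval w (((s₄.setReg (K + 2) (j * j : ℕ)).setReg (K + 5)
      (272 * j : ℕ)).setReg (K + 6) M) = 2 * j := by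
    rw [Expr.eval_mul, Expr.eval_const, Expr.eval_reg, wrap_mul_wrap_left]
    simp only [State.setReg, Function.update_of_ne (show K + 1 ≠ K + 2 by omega),
      Function.update_of_ne (show K + 1 ≠ K + 5 by omega),
      Function.update_of_ne (show K + 1 ≠ K + 6 by omega), hj]
    rw [wrap_eq_self hB (by rw [abs_of_nonneg (by positivity)]; omega)]
  rw [hD]
  simp [State.setReg, hn₄, hj, hW₄]

/-- The vector `v` of length `n`, continued by the entry `4 * W`. -/
def padded (n : ℕ) (W : ℤ) (v : ℕ → ℤ) (i : ℕ) : ℤ := if i < n then v i else 4 * W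

theorem ConvInstance.isPadding_padded (I : ConvInstance) {G : ℕ} (W : ℤ) (h : I.n ≤ G) :
    I.IsPadding G W (padded I.n W I.a) (padded I.n W I.b) where
  n_le := h
  left i hi := by simp [padded, hi]
  right i _ hi := by simp [padded, not_lt.mpr hi]

/-- Copy the vector in array `src` to array `dst` and pad it. -/
def padVector (K dst src : ℕ) : Prog :=
  .seq (.fill (K + 9) dst (.reg (K + 2)) (.reg (K + 9)) (.const 4 * .reg (K + 3)))
    (.fill (K + 9) dst (.reg K) (.reg (K + 9)) (.load src (.reg (K + 9))))

theorem run_padVector {n G W w K dst src : ℕ} {B : ℤ} {s : State} (hB : 2 * B < 2 ^ w) (hw : 2 ≤ w)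
    (hne : src ≠ dst) (hnG : n ≤ G) (hGB : (G : ℤ) ≤ B) (hWB : 4 * (W : ℤ) ≤ B) (h0 : s.reg K = n)
    (h2 : s.reg (K + 2) = G) (h3 : s.reg (K + 3) = W) {v : ℕ → ℤ}
    (hv : ∀ i < n, s.mem src i = v i) :
    Run w (padVector K dst src) s (40 * (G + 1)) (fun s' =>
      ∀ i < G, s'.mem dst i = padded n W v i) := by
  refine Run.mono (T := 20 * (G + 1) + 20 * (G + 1)) ?_ (by omega) fun _ _ h => h
  refine Run.seq (Run.mono (Run.fill (s := s) G (fun k => (k : ℤ)) (fun _ => 4 * (W : ℤ)) hw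
    (by omega) (fun j k h _ => by simpa using h.ne) ?_) (T' := 20 * (G + 1)) ?_ fun _ _ h => h) ?_
  · intro k s' hk hi hr hb hx
    refine ⟨by rw [Expr.eval_reg, hr _ (by omega), h2], fun _ => ⟨by rw [Expr.eval_reg, hi], ?_⟩⟩
    rw [Expr.eval_mul, Expr.eval_const, wrap_mul_wrap_left, Expr.eval_reg, hr _ (by omega), h3]
    exact wrap_eq_self hB (by rw [abs_of_nonneg (by positivity)]; omega)
  · simp only [Expr.cost_mul, Expr.cost_reg, Expr.cost_const]
    omega
  rintro s₁ hf₁ ⟨h₁, -⟩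
  have hn₁ : s₁.reg K = n := by rw [hf₁.1 _ (by simp [Prog.fill, Prog.WritesReg]), h0]
  have hm₁ : s₁.mem src = s.mem src := hf₁.2 _ (by simp [Prog.fill, Prog.WritesMem, hne])
  refine Run.mono (Run.fill (s := s₁) n (fun k => (k : ℤ)) v hw (by omega)
    (fun j k h _ => by simpa using h.ne) ?_) ?_ ?_
  · intro k s' hk hi hr hb hx
    refine ⟨by rw [Expr.eval_reg, hr _ (by omega), hn₁], fun hk => ⟨by rw [Expr.eval_reg, hi], ?_⟩⟩
    rw [Expr.eval_load, Expr.eval_reg, hi, hb _ hne, hm₁, hv k hk]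
  · simp only [Expr.cost_load, Expr.cost_reg]
    omega
  rintro s₂ - ⟨h₂, h₂'⟩ i hi
  unfold padded
  split_ifs with hin
  · exact h₂ i hin
  · rw [h₂' i (fun j hj => by simp only [ne_eq, Nat.cast_inj]; omega)]
    exact h₁ i hi

/-- Set up the vectors and the trivial approximation of their convolution, with a power of two as
error bound. -/
def initSearch (K : ℕ) : Prog :=
  .seq (padVector K K 0)
    (.seq (padVector K (K + 1) 1)
    (.seq (.fill (K + 9) (K + 2) (.const 2 * .reg (K + 2)) (.reg (K + 9))
      (0 - .const 8 * .reg (K + 3)))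
    (.seq (.assign (K + 4) 1)
    (.loop ((Expr.reg (K + 4)).lt (.const 16 * .reg (K + 3) + 1))
      (.assign (K + 4) (.reg (K + 4) + .reg (K + 4)))))))

theorem run_initSearch {g W w K : ℕ} {U M B : ℤ} {s : State} (I : ConvInstance) (hK3 : 3 ≤ K)
    (h : BlockParams g W U M B) (hB : 2 * B < 2 ^ w) (hw : 2 ≤ w) (hng : I.n ≤ g * g)
    (hI : minPlusConvolution.Bounded W I)
    (hin : ∀ i : ℕ, i < I.n → s.mem 0 (i : ℤ) = I.a i ∧ s.mem 1 (i : ℤ) = I.b i)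
    (h0 : s.reg K = I.n) (h1 : s.reg (K + 1) = g) (h2 : s.reg (K + 2) = (g * g : ℕ))
    (h3 : s.reg (K + 3) = W) (h5 : s.reg (K + 5) = (272 * g : ℕ)) (h6 : s.reg (K + 6) = M)
    (h7 : s.reg (K + 7) = 2 * g) :
    Run w (initSearch K) s (200 * (g * g + 1) + Nat.log 2 (32 * W) * 20) (fun s' =>
      IsSetup I.n g W K M (padded I.n W I.a) (padded I.n W I.b) s' ∧
      ∃ q, q ≤ Nat.log 2 (32 * W) ∧ s'.reg (K + 4) = 2 ^ q ∧
        HasApprox K g W (padded I.n W I.a) (padded I.n W I.b) (2 ^ q) s') := by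
  obtain ⟨hB1, hB2⟩ := h.le_B
  obtain ⟨hM1, hM2, hM3⟩ := h.le_M
  obtain ⟨hU1, hU2, hU3⟩ := h.le_U
  have hW1 := h.one_le_W
  have hGB : ((g * g : ℕ) : ℤ) ≤ B := by push_cast; omega
  have hz1 : wrap w 1 = 1 := wrap_eq_self hB (by rw [abs_one]; omega)
  refine Run.mono (T := 40 * (g * g + 1) + (40 * (g * g + 1) + (30 * (2 * (g * g) + 1) + (2 +
    (Nat.log 2 (32 * W) * 12 + 8))))) ?_ (by omega) fun _ _ h => h
  refine Run.seq (run_padVector (v := I.a) hB hw (by omega) hng hGB (by omega) h0 h2 h3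
    fun i hi => (hin i hi).1) ?_
  intro s₁ hf₁ ha₁
  have hr₁ : ∀ j, j ≤ 7 → s₁.reg (K + j) = s.reg (K + j) := fun j hj => hf₁.1 _ (by
    simp only [padVector, Prog.fill, Prog.WritesReg, false_or]
    omega)
  have hm₁ : s₁.mem 1 = s.mem 1 := hf₁.2 _ (by
    simp only [padVector, Prog.fill, Prog.WritesMem, or_false, false_or]
    omega)
  refine Run.seq (run_padVector (v := I.b) hB hw (by omega) hng hGB (by omega) ((hr₁ 0 (by omega)).trans h0)
    ((hr₁ 2 (by omega)).trans h2) ((hr₁ 3 (by omega)).trans h3)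
    fun i hi => by rw [hm₁]; exact (hin i hi).2) ?_
  intro s₂ hf₂ hb₂
  have hr₂ : ∀ j, j ≤ 7 → s₂.reg (K + j) = s.reg (K + j) := fun j hj => by
    rw [← hr₁ j hj]
    refine hf₂.1 _ ?_
    simp only [padVector, Prog.fill, Prog.WritesReg, false_or]
    omega
  have hm₂ : s₂.mem K = s₁.mem K := hf₂.2 _ (by
    simp only [padVector, Prog.fill, Prog.WritesMem, or_false, false_or]
    omega)
  have hs₂ : IsSetup I.n g W K M (padded I.n W I.a) (padded I.n W I.b) s₂ :=
    ⟨(hr₂ 0 (by omega)).trans h0, (hr₂ 1 (by omega)).trans h1, (hr₂ 2 (by omega)).trans h2,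
      (hr₂ 3 (by omega)).trans h3, (hr₂ 5 (by omega)).trans h5, (hr₂ 6 (by omega)).trans h6,
      (hr₂ 7 (by omega)).trans h7, fun i hi => by rw [hm₂, ha₁ i hi], hb₂⟩
  refine Run.seq (Run.mono (Run.fill (s := s₂) (2 * (g * g)) (fun k => (k : ℤ))
    (fun _ => -(8 * (W : ℤ))) hw (by push_cast; omega) (fun j k h _ => by simpa using h.ne) ?_)
    (T' := 30 * (2 * (g * g) + 1)) ?_ fun _ _ h => h) ?_
  · intro k s' hk hi hr hb hx
    refine ⟨?_, fun hk => ⟨by rw [Expr.eval_reg, hi], ?_⟩⟩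
    · rw [Expr.eval_mul, Expr.eval_const, wrap_mul_wrap_left, Expr.eval_reg, hr _ (by omega),
        hs₂.reg2]
      push_cast
      exact wrap_eq_self hB (by rw [abs_of_nonneg (by positivity)]; omega)
    · rw [Expr.eval_sub, Expr.eval_zero, Expr.eval_mul, Expr.eval_const, Expr.eval_reg,
        hr _ (by omega), hs₂.reg3, wrap_mul_wrap_left, wrap_sub_wrap_left, wrap_sub_wrap_right,
        zero_sub]
      exact wrap_eq_self hB (by rw [abs_neg, abs_of_nonneg (by positivity)]; omega)
  · simp only [Expr.cost_reg, Expr.cost_mul, Expr.cost_const, Expr.cost_sub, Expr.cost_zero]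
    omega
  rintro s₃ hf₃ ⟨h₃, -⟩
  have hs₃ := hs₂.of_frame hf₃ (fun j _ _ => by simp [Prog.fill, Prog.WritesReg]; omega)
    (fun j _ => by simp [Prog.fill, Prog.WritesMem]; omega)
  refine Run.seq (T := 2) (Run.assign (e := 1) (Q := fun t => t = s₃.setReg (K + 4) 1)
    (by rw [Expr.eval_one, hz1])) ?_
  rintro _ hf₄ rfl
  have hs₄ := hs₃.of_frame hf₄ (fun j _ _ => by simp only [Prog.WritesReg]; omega)
    (fun j _ => by simp [Prog.WritesMem])
  have hlim : ∀ s' : State, s'.reg (K + 3) = W →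
      (Expr.const 16 * Expr.reg (K + 3) + 1).eval w s' = 16 * W + 1 := by
    intro s' hs'
    rw [Expr.eval_add, Expr.eval_mul, Expr.eval_const, Expr.eval_one, wrap_mul_wrap_left,
      wrap_add_wrap_left, wrap_add_wrap_right, Expr.eval_reg, hs']
    exact wrap_eq_self hB (by rw [abs_of_nonneg (by positivity)]; omega)
  refine Run.mono (Run.loop (T := 4) (fun m s' =>
    IsSetup I.n g W K M (padded I.n W I.a) (padded I.n W I.b) s' ∧ s'.mem (K + 2) = s₃.mem (K + 2) ∧
    ∃ q, q + m = Nat.log 2 (32 * W) ∧ s'.reg (K + 4) = 2 ^ q) ?_ (Nat.log 2 (32 * W)) _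
    ⟨hs₄, rfl, 0, by omega, by simp [State.setReg]⟩) ?_ ?_
  · rintro m s' ⟨hs', hm', q, hq, hqs⟩ hne
    rw [Expr.eval_lt_ne_zero hw, Expr.eval_reg, hqs, hlim s' hs'.reg3] at hne
    have hle : (2 : ℤ) ^ (q + 1) ≤ 32 * W := by
      rw [pow_succ]
      omega
    have hlog : q + 1 ≤ Nat.log 2 (32 * W) :=
      Nat.le_log_of_pow_le (by norm_num) (by exact_mod_cast hle)
    refine Run.mono (Run.assign (e := .reg (K + 4) + .reg (K + 4))
      (Q := fun t => t = s'.setReg (K + 4) (2 ^ (q + 1))) ?_) le_rfl ?_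
    · rw [Expr.eval_add, Expr.eval_reg, hqs, ← two_mul, ← pow_succ',
        wrap_eq_self hB (by rw [abs_of_nonneg (by positivity)]; omega)]
    · rintro _ hf rfl
      exact ⟨m - 1, by omega, hs'.of_frame hf (fun j _ _ => by simp only [Prog.WritesReg]; omega)
        (fun j _ => by simp [Prog.WritesMem]), hm', q + 1, by omega, by simp [State.setReg]⟩
  · simp only [Expr.cost_lt, Expr.cost_add, Expr.cost_mul, Expr.cost_reg, Expr.cost_const,
      Expr.cost_one]
    omega
  rintro s₅ - ⟨he, m, hs₅, hm₅, q, hq, hqs⟩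
  rw [Expr.eval_lt_eq_zero hw, Expr.eval_reg, hqs, hlim s₅ hs₅.reg3] at he
  have hpow : (2 : ℤ) ^ q ≤ 32 * W := by
    exact_mod_cast (Nat.pow_le_pow_right (by norm_num) (by omega)).trans
      (Nat.pow_log_le_self 2 (by omega : 32 * W ≠ 0))
  have hlo : ∀ k < 2 * (g * g), s₅.mem (K + 2) ((k : ℕ) : ℤ) = -(8 * (W : ℤ)) := fun k hk => by
    rw [hm₅]
    exact h₃ k hk
  refine ⟨hs₅, q, by omega, hqs, ?_, fun k hk => by rw [hlo k hk], fun k hk => ?_⟩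
  · refine IsApprox.init (V := 4 * W)
      (fun i hi => (I.isPadding_padded (W : ℤ) hng).abs_le hI hi) (fun k hk => ?_) (by omega)
    rw [hlo k hk]
    ring
  · rw [hlo k hk]
    omega

/-! ### `(min,+)`-convolution reduces to Knapsack -/

/-- The algorithm for `(min,+)`-convolution that calls the algorithm `p` for Knapsack: phases of the
binary search, until the error bound is `1`. -/
def convolutionViaKnapsack (p : Prog) (K c : ℕ) : Prog :=
  .seq (setParams K c)
    (.seq (initSearch K)
    (.seq (.loop ((1 : Expr).lt (.reg (K + 4)))
      (.seq (.assign (K + 4) (.reg (K + 4) / .const 2)) (searchPhase p K)))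
    (.fill (K + 9) 2 (.const 2 * .reg K) (.reg (K + 9)) (.load (K + 2) (.reg (K + 9))))))

theorem run_convolutionViaKnapsack {opt : KnapsackInstance → ℕ → Prop}
    (hopt : KnapsackInstance.AdmitsSets opt) {g w K c TB : ℕ} {U M B : ℤ} {p : Prog} {s : State}
    (I : ConvInstance) (hK3 : 3 ≤ K) (hK : ∀ r, K ≤ r → ¬ p.WritesReg r ∧ ¬ p.WritesMem r)
    (h : BlockParams g ((I.n + 2) ^ c) U M B) (hB : 2 * B < 2 ^ w) (hw : 2 ≤ w)
    (hp : ∀ I : KnapsackInstance, I.n = 272 * g →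
      (∀ i, 1 ≤ i → i ≤ I.n → (I.profit i : ℤ) ≤ B) → ∀ s : State, s.IsWordState w →
      (knapsackProblem opt).Input I s → Run w p s TB ((knapsackProblem opt).Output I))
    (hng : I.n ≤ g * g) (hgn : (g - 1) * (g - 1) < I.n)
    (hI : minPlusConvolution.Bounded ((I.n + 2) ^ c) I) (hs : s.IsWordState w)
    (hin : minPlusConvolution.Input I s) :
    Run w (convolutionViaKnapsack p K c) s ((12 * g + 4 * c + 50) +
      ((200 * (g * g + 1) + Nat.log 2 (32 * (I.n + 2) ^ c) * 20) +
      ((Nat.log 2 (32 * (I.n + 2) ^ c) * (8 + (100 * (2 * (g * g) + 1) +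
        3 * (g * g) * (4 + (TB + 10100 * (g + 1))))) + 4) + 20 * (2 * I.n + 1))))
      (minPlusConvolution.Output I) := by
  obtain ⟨hB1, hB2⟩ := h.le_B
  obtain ⟨hM1, hM2, hM3⟩ := h.le_M
  obtain ⟨hU1, hU2, hU3⟩ := h.le_U
  obtain ⟨hn, hin⟩ := hin
  have hz1 : wrap w 1 = 1 := wrap_eq_self hB (by rw [abs_one]; omega)
  have hpad := I.isPadding_padded (((I.n + 2) ^ c : ℕ) : ℤ) hng
  refine Run.seq (Run.isWordState (run_setParams hK3 h hB hw hn hng hgn) (by omega) hs) ?_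
  rintro s₁ hf₁ ⟨hsw₁, h0, h1, h2, h3, h5, h6, h7⟩
  have hm₁ : s₁.mem = s.mem := by
    funext a
    exact hf₁.2 a (by simp [setParams, Prog.WritesMem])
  refine Run.seq (Run.isWordState (run_initSearch I hK3 h hB hw hng hI
    (fun i hi => by rw [hm₁]; exact hin i hi) h0 h1 h2 h3 h5 h6 h7) (by omega) hsw₁) ?_
  rintro s₂ - ⟨hsw₂, hs₂, q, hq, hqs, happ⟩
  refine Run.seq (Run.mono (Run.loop (fun m s' => s'.IsWordState w ∧
    IsSetup I.n g ((I.n + 2) ^ c) K M (padded I.n ((I.n + 2) ^ c : ℕ) I.a)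
      (padded I.n ((I.n + 2) ^ c : ℕ) I.b) s' ∧ s'.reg (K + 4) = 2 ^ m ∧
    HasApprox K g ((I.n + 2) ^ c) (padded I.n ((I.n + 2) ^ c : ℕ) I.a)
      (padded I.n ((I.n + 2) ^ c : ℕ) I.b) (2 ^ m) s')
    (T := 4 + (100 * (2 * (g * g) + 1) + 3 * (g * g) * (4 + (TB + 10100 * (g + 1))))) ?_ q s₂
    ⟨hsw₂, hs₂, hqs, happ⟩) (T' := Nat.log 2 (32 * (I.n + 2) ^ c) * (8 + (100 * (2 * (g * g) + 1) +
        3 * (g * g) * (4 + (TB + 10100 * (g + 1))))) + 4) ?_ fun _ _ h => h) ?_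
  · rintro m s' ⟨hsw', hs', hm, happ'⟩ hne
    rw [Expr.eval_lt_ne_zero hw, Expr.eval_one, hz1, Expr.eval_reg, hm] at hne
    obtain ⟨m, rfl⟩ : ∃ m', m = m' + 1 := by
      refine ⟨m - 1, ?_⟩
      rcases m with - | m
      · simp at hne
      · rfl
    have hle : (2 : ℤ) ^ m + 2 ^ m ≤ 34 * ((I.n + 2) ^ c : ℕ) := by
      have hg1 := h.one_le_g
      have h1 := happ'.le 0 (by nlinarith)
      have h2 := happ'.add_le 0 (by nlinarith)
      rw [pow_succ] at h2
      omega
    have hpos : (0 : ℤ) < 2 ^ m := by positivity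
    refine Run.seq (T := 4) (Run.isWordState (Run.assign (e := .reg (K + 4) / .const 2)
      (Q := fun t => t = s'.setReg (K + 4) (2 ^ m)) ?_) (by omega) hsw') ?_
    · have hz2 : wrap w 2 = 2 := wrap_eq_self hB (by rw [abs_two]; omega)
      rw [Expr.eval_div, Expr.eval_reg, Expr.eval_const, hm, hz2, pow_succ,
        Int.mul_ediv_cancel _ (by norm_num), wrap_eq_self hB (by rw [abs_of_pos hpos]; omega)]
    · rintro _ hf ⟨hsw'', rfl⟩
      have hs'' := hs'.of_frame hf (fun j _ _ => by simp only [Prog.WritesReg]; omega)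
        (fun j _ => by simp [Prog.WritesMem])
      have happ'' : HasApprox K g ((I.n + 2) ^ c) (padded I.n ((I.n + 2) ^ c : ℕ) I.a)
          (padded I.n ((I.n + 2) ^ c : ℕ) I.b) (2 ^ m + 2 ^ m) (s'.setReg (K + 4) (2 ^ m)) := by
        rw [← mul_two, ← pow_succ]
        exact ⟨happ'.approx, happ'.le, happ'.add_le⟩
      refine Run.mono (Run.isWordState (run_searchPhase hopt hK3 hK h hB hw hp hs'' hsw''
        (fun i hi => (hpad.abs_le hI hi).1) (fun i hi => (hpad.abs_le hI hi).2) hpos.le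
        (by simp [State.setReg]) happ'') (by omega) hsw'') le_rfl ?_
      rintro s₃ hf₃ ⟨hsw₃, happ₃⟩
      refine ⟨m, by omega, hsw₃, hs''.of_frame hf₃
        (fun j hj _ => searchPhase_writesReg (fun r hr => (hK r hr).1) hj (by omega))
        (fun j hj => searchPhase_writesMem (fun r hr => (hK r hr).2) hj (by omega)), ?_, happ₃⟩
      rw [hf₃.1 _ (searchPhase_writesReg (fun r hr => (hK r hr).1) (by omega) (by omega))]
      simp [State.setReg]
  · simp only [Expr.cost_lt, Expr.cost_one, Expr.cost_reg]
    have := Nat.mul_le_mul_right (8 + (100 * (2 * (g * g) + 1) +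
        3 * (g * g) * (4 + (TB + 10100 * (g + 1))))) hq
    refine Nat.add_le_add (le_trans (le_of_eq ?_) this) le_rfl
    congr 1
    omega
  rintro s₃ - ⟨he, m, hsw₃, hs₃, hm, happ₃⟩
  rw [Expr.eval_lt_eq_zero hw, Expr.eval_one, hz1, Expr.eval_reg, hm] at he
  have hm1 : (2 : ℤ) ^ m = 1 := le_antisymm he (one_le_pow₀ (by norm_num))
  have hn2 : ((2 * I.n : ℕ) : ℤ) ≤ 2 * ((g : ℤ) * g) := by exact_mod_cast (by omega)
  refine Run.mono (Run.fill (s := s₃) (2 * I.n) (fun k => (k : ℤ))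
    (fun k => s₃.mem (K + 2) k) hw (by omega) (fun j k h _ => by simpa using h.ne) ?_) ?_ ?_
  · intro k s' hk hi hr hb hx
    refine ⟨?_, fun _ => ⟨by rw [Expr.eval_reg, hi], ?_⟩⟩
    · rw [Expr.eval_mul, Expr.eval_const, wrap_mul_wrap_left, Expr.eval_reg, hr _ (by omega),
        hs₃.reg0]
      push_cast at hn2 ⊢
      exact wrap_eq_self hB (by rw [abs_of_nonneg (by positivity)]; omega)
    · rw [Expr.eval_load, Expr.eval_reg, hi, hb _ (by omega)]
  · simp only [Expr.cost_reg, Expr.cost_mul, Expr.cost_const, Expr.cost_load]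
    omega
  rintro s₄ - ⟨h₄, -⟩ k hk
  have happ := happ₃.approx
  rw [hm1] at happ
  rw [h₄ k (by omega)]
  exact hpad.isEntry h.one_le_W hI happ hk

/-- The total number of steps, in terms of the time `TB` of one call of Knapsack. -/
theorem convolutionViaKnapsack_time {n g c TB : ℕ} (hn : 1 ≤ n) (hg : g * g ≤ 4 * n) :
    (12 * g + 4 * c + 50) + ((200 * (g * g + 1) + Nat.log 2 (32 * (n + 2) ^ c) * 20) +
      ((Nat.log 2 (32 * (n + 2) ^ c) * (8 + (100 * (2 * (g * g) + 1) +
        3 * (g * g) * (4 + (TB + 10100 * (g + 1))))) + 4) + 20 * (2 * n + 1))) ≤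
    (1000000 * (c + 3)) * (Nat.log 2 n + 1) * (n * (TB + (g + 1))) := by
  have hlog : Nat.log 2 (32 * (n + 2) ^ c) ≤ (5 + 2 * c) * (Nat.log 2 n + 1) := by
    have h1 : n + 1 ≤ 2 ^ (Nat.log 2 n + 1) := Nat.lt_pow_succ_log_self (by norm_num) n
    have h2 : n + 2 ≤ 2 ^ (2 * (Nat.log 2 n + 1)) := by
      rw [pow_mul', pow_two]
      nlinarith
    have h3 : 32 * (n + 2) ^ c ≤ 2 ^ ((5 + 2 * c) * (Nat.log 2 n + 1)) := by
      calc 32 * (n + 2) ^ c ≤ 32 * (2 ^ (2 * (Nat.log 2 n + 1))) ^ c := by gcongr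
        _ = 2 ^ (5 + 2 * (Nat.log 2 n + 1) * c) := by rw [← pow_mul, pow_add]; norm_num
        _ ≤ _ := Nat.pow_le_pow_right (by norm_num) (by nlinarith)
    exact (Nat.log_mono_right h3).trans (Nat.log_pow (by norm_num) _).le
  generalize Nat.log 2 (32 * (n + 2) ^ c) = m at hlog ⊢
  have hL : 1 ≤ Nat.log 2 n + 1 := by omega
  generalize Nat.log 2 n + 1 = L at hlog hL ⊢
  obtain ⟨Y, hY⟩ : ∃ Y, Y = n * (TB + (g + 1)) := ⟨_, rfl⟩
  rw [← hY]
  have hnY : n ≤ Y := by rw [hY]; exact Nat.le_mul_of_pos_right _ (by omega)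
  have hgY : g ≤ Y := by rw [hY]; nlinarith
  have hGY : (g * g) * (TB + (g + 1)) ≤ 4 * Y := by
    rw [hY, ← mul_assoc]
    exact Nat.mul_le_mul_right _ hg
  have hphase : 28 + (100 * (2 * (g * g) + 1) + 3 * (g * g) * (4 + (TB + 10100 * (g + 1)))) ≤
      130000 * Y := by
    have : 3 * (g * g) * (4 + (TB + 10100 * (g + 1))) ≤ 30312 * ((g * g) * (TB + (g + 1))) := by
      rw [mul_assoc, show 30312 = 3 * 10104 by norm_num, mul_assoc 3, mul_left_comm 10104]
      gcongr
      omega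
    omega
  have h1 := Nat.mul_le_mul hlog hphase
  have h2 : 12 * g + 4 * c + 50 + 200 * (g * g + 1) + 4 + 20 * (2 * n + 1) ≤
      (2000 + 4 * c) * Y := by
    nlinarith
  have h3 := Nat.mul_le_mul hL h2
  have h4 : (2000 + 4 * c) * (L * Y) + (5 + 2 * c) * 130000 * (L * Y) ≤
      1000000 * (c + 3) * (L * Y) := by
    rw [← Nat.add_mul]
    gcongr
    omega
  nlinarith

theorem minPlusConvolution_reduces_knapsack {opt : KnapsackInstance → ℕ → Prop}
    (hopt : KnapsackInstance.AdmitsSets opt) :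
    SubquadraticallyReduces minPlusConvolution (knapsackProblem opt) := by
  refine .of_le_one fun ε hε hε1 => ⟨ε / 4, by linarith, fun hB =>
    Problem.solvableInTime_of_run fun c => ?_⟩
  -- With `N = 272 * g` the budget, `n + 2 ≤ (N + 2) ^ 2`, and profits are at most
  -- `(n + 2) ^ c * (N + 2) ^ 4`.
  obtain ⟨p, κ, C, K, hK3, hK, hp⟩ := hB.exists_subroutine (2 * c + 4)
  obtain ⟨κ', hκ'⟩ := exists_wordSize (272 ^ 4) (c + 4)
  obtain ⟨C', hC'⟩ := time_bound_blocks (C := C) hε hε1 (1000000 * (c + 3)) 272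
  refine ⟨convolutionViaKnapsack p K c, 273 * κ + κ', C',
    fun (I : ConvInstance) hI hb w hw s hs hin => ?_⟩
  change 1 ≤ I.n at hI
  change (273 * κ + κ') * (Nat.log 2 I.n + 1) ≤ w at hw
  change minPlusConvolution.Bounded ((I.n + 2) ^ c) I at hb
  obtain ⟨hB, hw2⟩ := hκ' I.n hI w (le_trans (by gcongr; omega) hw)
  -- The block length is `√n`, rounded up.
  obtain ⟨g, hg1, hng, hgn⟩ : ∃ g, 1 ≤ g ∧ I.n ≤ g * g ∧ (g - 1) * (g - 1) < I.n := by
    refine ⟨Nat.sqrt (I.n - 1) + 1, by omega, ?_, ?_⟩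
    · have := Nat.lt_succ_sqrt (I.n - 1)
      simp only [Nat.succ_eq_add_one] at this
      omega
    · have := Nat.sqrt_le (I.n - 1)
      simp only [Nat.add_sub_cancel]
      omega
  have hg4 : g * g ≤ 4 * I.n := by
    obtain ⟨k, rfl⟩ : ∃ k, g = k + 1 := ⟨g - 1, by omega⟩
    simp only [Nat.add_sub_cancel] at hgn
    nlinarith
  have hgI : g ≤ I.n := by
    obtain ⟨k, rfl⟩ : ∃ k, g = k + 1 := ⟨g - 1, by omega⟩
    simp only [Nat.add_sub_cancel] at hgn
    nlinarith
  have hW1 : 1 ≤ (I.n + 2) ^ c := Nat.one_le_pow _ _ (by omega)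
  obtain ⟨B, U, M, h⟩ : ∃ B U M, BlockParams g ((I.n + 2) ^ c) U M B :=
    ⟨_, _, _, hg1, hW1, rfl, rfl, rfl⟩
  have hBle : B ≤ ((I.n + 2) ^ c * (272 * g + 2) ^ 4 : ℕ) := by
    rw [h.B_eq, h.M_eq, h.U_eq]
    push_cast
    have h1 : (0 : ℤ) ≤ ((I.n : ℤ) + 2) ^ c := by positivity
    have h2 : (1 : ℤ) ≤ 272 * g := by exact_mod_cast (by omega : 1 ≤ 272 * g)
    calc ((I.n : ℤ) + 2) ^ c * (272 * g) * (272 * g + 4) * (272 * g) +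
          3 * (((I.n : ℤ) + 2) ^ c * (272 * g))
        = ((I.n : ℤ) + 2) ^ c * ((272 * g) * (272 * g + 4) * (272 * g) + 3 * (272 * g)) := by ring
      _ ≤ _ := by
          refine mul_le_mul_of_nonneg_left ?_ h1
          generalize (272 : ℤ) * g = N at h2 ⊢
          have h3 : 0 ≤ N ^ 4 := by positivity
          have h4 : 0 ≤ N ^ 3 := by positivity
          have h5 : 0 ≤ N ^ 2 := by positivity
          linarith [show (N + 2) ^ 4 = N ^ 4 + 8 * N ^ 3 + 24 * N ^ 2 + 32 * N + 16 by ring,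
            show N * (N + 4) * N + 3 * N = N ^ 3 + 4 * N ^ 2 + 3 * N by ring]
  have hBw : 2 * B < 2 ^ w := by
    refine lt_of_le_of_lt (mul_le_mul_of_nonneg_left (hBle.trans ?_) (by norm_num)) hB
    have : (I.n + 2) ^ c * (272 * g + 2) ^ 4 ≤ 272 ^ 4 * (I.n + 2) ^ (c + 4) := by
      calc (I.n + 2) ^ c * (272 * g + 2) ^ 4 ≤ (I.n + 2) ^ c * (272 * (I.n + 2)) ^ 4 := by
            gcongr
            omega
        _ = 272 ^ 4 * (I.n + 2) ^ (c + 4) := by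
            rw [mul_pow, pow_add]
            ring
    exact_mod_cast this
  set TB := ⌊C * ((272 * g : ℕ) : ℝ) ^ (2 - ε)⌋₊ with hTB
  have hp' : ∀ J : KnapsackInstance, J.n = 272 * g →
      (∀ i, 1 ≤ i → i ≤ J.n → (J.profit i : ℤ) ≤ B) → ∀ s : State, s.IsWordState w →
      (knapsackProblem opt).Input J s → Run w p s TB ((knapsackProblem opt).Output J) := by
    intro J hJ hJB s hs hin
    have hsize : (knapsackProblem opt).size J = 272 * g := hJ
    have := hp J (by rw [hsize]; omega) ?_ w (le_trans ?_ hw) s hs hin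
    · rwa [hsize] at this
    · rw [hsize]
      intro i h1 h2
      have h3 : J.profit i ≤ (I.n + 2) ^ c * (272 * g + 2) ^ 4 := by
        exact_mod_cast (hJB i h1 h2).trans hBle
      calc J.profit i ≤ (I.n + 2) ^ c * (272 * g + 2) ^ 4 := h3
        _ ≤ ((272 * g + 2) ^ 2) ^ c * (272 * g + 2) ^ 4 := by
            gcongr
            nlinarith
        _ = (272 * g + 2) ^ (2 * c + 4) := by rw [← pow_mul, ← pow_add]
    · rw [hsize]
      calc κ * (Nat.log 2 (272 * g) + 1) ≤ κ * ((272 + 1) * (Nat.log 2 I.n + 1)) := by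
            gcongr
            exact log_add_one_le_of_le_mul (by gcongr)
        _ = 273 * κ * (Nat.log 2 I.n + 1) := by ring
        _ ≤ _ := by
            gcongr
            omega
  refine ⟨_, hC' I.n g hI (by rw [pow_two]; exact hg4), ?_⟩
  exact (run_convolutionViaKnapsack hopt I hK3 hK h hBw hw2 hp' hng hgn hb hs hin).mono
    (convolutionViaKnapsack_time hI hg4) fun _ _ h => h

theorem mainTheorem2 :
    SubquadraticallyEquivalent minPlusConvolution coinChange ∧
    SubquadraticallyEquivalent coinChange unboundedKnapsack ∧
    SubquadraticallyEquivalent minPlusConvolution unboundedKnapsack ∧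
    (¬ StronglySubquadratic minPlusConvolution → ¬ StronglySubquadratic boundedKnapsack) := by
  have h1 : SubquadraticallyReduces minPlusConvolution unboundedKnapsack :=
    minPlusConvolution_reduces_knapsack KnapsackInstance.admitsSets_isUnboundedOptimum
  have h2 := unboundedKnapsack_reduces_coinChange
  have h3 := coinChange_reduces_minPlusConvolution
  have h4 : SubquadraticallyReduces minPlusConvolution boundedKnapsack :=
    minPlusConvolution_reduces_knapsack KnapsackInstance.admitsSets_isBoundedOptimum
  exact ⟨⟨h1.trans h2, h3⟩, ⟨h3.trans h1, h2⟩, ⟨h1, h2.trans h3⟩,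
    fun h hB => h (hB.of_reduces h4)⟩
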